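/- **Setting.** Let $d\ge1$, $\alpha,\beta,\gamma>0$, $s=(\alpha+\beta)/2$, $x_0\in(0,1)^d$. Let $Z=(X,A,Y)\sim P$ with $X\in[0,1]^d$, $A\in\{0,1\}$, $Y\in\mathbb R$; let $F$ be the law of $X$, $\pi(x)=P(A=1\mid X=x)$, $\mu_a(x)=E(Y\mid X=x,A=a)$, $\tau=\mu_1-\mu_0$. Let $\lfloor r\rfloor$ be the largest integer strictly smaller than $r$. A function on $[0,1]^d$ is $r$-smooth with constant $L$ if it is $\lfloor r\rfloor$ times continuously differentiable, its partial derivatives of order at most $\lfloor r\rfloor$ are bounded by $L$, and those of order $\lfloor r\rfloor$ are $(r-\lfloor r\rfloor)$-Hölder with constant $L$ in the Euclidean norm $\|\cdot\|$. **Localization.** For $h>0$ let $K_h(x)=h^{-d}1(\|x-x_0\|\le h/2)$, and let $F^*$ be $h^{-d}$ times the image of $F$ restricted to $\{\|x-x_0\|\le h/2\}$ under $x\mapsto \frac12+(x-x_0)/h$ (that is, $dF^*(v)=dF(x_0+h(v-\frac12))$ on $\|v-\frac12\|\le\frac12$). Write $\|g\|_{F^*}^2=\int g(x_0+h(v-\frac12))^2\,dF^*(v)$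 for functions $g$ of $x$. Let $\rho$ be the vector of all tensor products, of total degree at most $\lfloor\gamma\rfloor$, of the Legendre polynomials orthonormal on $[0,1]$, and $\rho_h(x)=\rho(\frac12+(x-x_0)/h)$. Let $b:\mathbb R^d\to\mathbb R^k$ be measurable, $b_{hk}(x)=b(\frac12+(x-x_0)/h)1(\|x-x_0\|\le h/2)$, $\Omega=\int bb^{T}dF^*$, $\Pi_b g=b^{T}\Omega^{-1}\int bg\,dF^*$ (the $L_2(F^*)$-projection on the span of $b$), and $Q=\int\rho_hK_h\pi(1-\pi)\rho_h^{T}dF$. **Estimator.** Let $\widehat\pi,\widehat\mu_0$ and a probability distribution $\widehat F$ be constructed from a training sample independent of the i.i.d. sample $Z_1,\dots,Z_n\sim P$, $n\ge2$. Define $\widehat F^*$ from $\widehat F$ as $F^*$ from $F$, and $\widehat\Omega=\int bb^{T}d\widehat F^*$. With $\mathbb P_n$ the sample average and $\mathbb U_n f=\frac1{n(n-1)}\sum_{i\ne j}f(Z_i,Z_j)$, put $$\widehat Q=\mathbb P_n\{\rho_hK_h\,A(A-\widehat\pi)\,\rho_h^{T}\}-\mathbb U_n\{\rho_h(X_1)K_h(X_1)(A_1-\widehat\pi(X_1))\,b_{hk}(X_1)^{T}\widehat\Omega^{-1}b_{hk}(X_2)\,A_2\,K_h(X_2)\rho_h(X_2)^{T}\},$$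 $$\widehat R=\mathbb P_n\{\rho_hK_h(Y-\widehat\mu_0)(A-\widehat\pi)\}-\mathbb U_n\{\rho_h(X_1)K_h(X_1)(A_1-\widehat\pi(X_1))\,b_{hk}(X_1)^{T}\widehat\Omega^{-1}b_{hk}(X_2)(Y_2-\widehat\mu_0(X_2))K_h(X_2)\},$$ and $\widehat\tau(x_0)=\rho_h(x_0)^{T}\widehat Q^{-1}\widehat R$. **Theorem.** There is $\bar r>0$, depending only on $(d,\alpha,\beta,\gamma)$, such that for all $x_0\in(0,1)^d$, all constants $\varepsilon,c>0$, $L$, $M$ and every function $B:\mathbb R\to\mathbb R$ there is a constant $C$ such that the following holds for all $n\ge2$ and all $P$, $h$, $k$, $b$, $\widehat\pi,\widehat\mu_0,\widehat F$ and laws of the training sample. Assume: (i) $\pi$ is $\alpha$-smooth, $\mu_0$ is $\beta$-smooth and $\tau$ is $\gamma$-smooth, with constant $L$; $\varepsilon\le\pi\le1-\varepsilon$ on $[0,1]^d$; $Y^2\le M$ almost surely; (ii) the eigenvalues of $Q$ and $\Omega$ lie in $[c,M]$; (iii) $\|g-\Pi_bg\|_{L_2(F^*)}\le B(r)\,k^{-r/d}$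 for all $0<r\le\bar r$ and all $g$ that are $r$-smooth with constant $1$; (iv) if $s<\frac{d/4}{1+d/2\gamma}$, then $h$ and $k$ lie within the factors $c$ and $M$ of $n^{-(1/\gamma)/(1+\frac d{2\gamma}+\frac d{4s})}$ and $n^{(\frac d{2s}-\frac d\gamma)/(1+\frac d{2\gamma}+\frac d{4s})}$, respectively; otherwise $h$ and $k$ lie within these factors of $n^{-1/(2\gamma+d)}$ and $nh^d$. Let $G$ be any event (for instance the sure event), measurable with respect to the training sample and $Z_1,\dots,Z_n$, on which, almost surely: (v) $\widehat\pi-\pi$ is $\alpha$-smooth and $\widehat\mu_0-\mu_0$ is $\beta$-smooth, with constant $L$; $\widehat\pi^2,\widehat\mu_0^2\le M$ on $[0,1]^d$; $\|\widehat\mu_0-\mu_0\|_{F^*}\le M$; $\widehat F^*\ll F^*$ with $c\le d\widehat F^*/dF^*\le M$ $F^*$-a.e.; (vi) $\|d\widehat F^*/dF^*-1\|_\infty\,\|\widehat\pi-\pi\|_{F^*}\left(\|\widehat\mu_0-\mu_0\|_{F^*}+h^\gamma\right)\le M\,n^{-1/\left(1+\frac d{2\gamma}+\max\{\frac d{4s},\,1+\frac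 d{2\gamma}\}\right)}$; (vii) $\widehat Q$ is invertible and the operator norm of $\widehat Q^{-1}-Q^{-1}$ is at most $M$. Then $$E\left[\,|\widehat\tau(x_0)-\tau(x_0)|\,1_G\right]\le\begin{cases}C\,n^{-1/\left(1+\frac d{2\gamma}+\frac d{4s}\right)}&\text{if } s<\frac{d/4}{1+d/2\gamma},\\ C\,n^{-1/\left(2+\frac d\gamma\right)}&\text{otherwise.}\end{cases}$$ In particular, if (v)-(vii) hold almost surely, then the mean absolute error $E|\widehat\tau(x_0)-\tau(x_0)|$ itself satisfies this bound. -/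

import Mathlib

open MeasureTheory ProbabilityTheory

noncomputable section

namespace RLearner

/-! ### Observations -/

/-- The space in which covariates live, `ℝ^d` with the Euclidean norm. -/
abbrev Cov (d : ℕ) := EuclideanSpace ℝ (Fin d)

/-- An observation `Z = (X, A, Y)`: covariates, binary treatment, real outcome. -/
abbrev Obs (d : ℕ) := Cov d × Bool × ℝ

/-- The covariates `X` of an observation. -/
def cov {d : ℕ} (z : Obs d) : Cov d := z.1

/-- The treatment `A ∈ {0, 1}` of an observation, as a real number. -/
def trt {d : ℕ} (z : Obs d) : ℝ := if z.2.1 then 1 else 0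

/-- The outcome `Y` of an observation. -/
def out {d : ℕ} (z : Obs d) : ℝ := z.2.2

/-- The cube `[0,1]^d`. -/
def unitCube (d : ℕ) : Set (Cov d) := {x | ∀ j, x j ∈ Set.Icc (0 : ℝ) 1}

/-- `P` is a law of `(X, A, Y)` with `X ∈ [0,1]^d` almost surely, with propensity score
`π(x) = P(A = 1 | X = x)` and outcome regressions `μ_a(x) = E(Y | X = x, A = a)`. -/
structure IsModel {d : ℕ} (P : Measure (Obs d)) (π μ₀ μ₁ : Cov d → ℝ) : Prop where
  cov_mem : ∀ᵐ z ∂P, cov z ∈ unitCube d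
  measurable_pi : Measurable π
  measurable_mu₀ : Measurable μ₀
  measurable_mu₁ : Measurable μ₁
  propensity : P[trt | MeasurableSpace.comap cov inferInstance] =ᵐ[P] fun z => π (cov z)
  regression : P[out | MeasurableSpace.comap (fun z => (cov z, trt z)) inferInstance]
    =ᵐ[P] fun z => if z.2.1 then μ₁ (cov z) else μ₀ (cov z)

/-- The conditional average treatment effect `τ = μ₁ - μ₀`. -/
def cate {d : ℕ} (μ₀ μ₁ : Cov d → ℝ) (x : Cov d) : ℝ := μ₁ x - μ₀ x

/-! ### Hölder classes -/

/-- The largest integer strictly smaller than `s` (for `s > 0`). -/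
def sfloor (s : ℝ) : ℕ := ⌈s⌉₊ - 1

/-- The partial derivative `∂^m g / ∂x_{j 0} ⋯ ∂x_{j (m-1)}` on the cube `[0,1]^d`. -/
def partialD {d m : ℕ} (j : Fin m → Fin d) (g : Cov d → ℝ) (x : Cov d) : ℝ :=
  iteratedFDerivWithin ℝ m g (unitCube d) x (fun i => EuclideanSpace.single (j i) (1 : ℝ))

/-- `g` is `s`-smooth on `[0,1]^d`, with constant `L`. -/
structure IsHolder {d : ℕ} (s L : ℝ) (g : Cov d → ℝ) : Prop where
  contDiffOn : ContDiffOn ℝ (sfloor s) g (unitCube d)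
  bounded : ∀ m ≤ sfloor s, ∀ j : Fin m → Fin d, ∀ x ∈ unitCube d, |partialD j g x| ≤ L
  holder : ∀ j : Fin (sfloor s) → Fin d, ∀ x ∈ unitCube d, ∀ y ∈ unitCube d,
    |partialD j g x - partialD j g y| ≤ L * ‖x - y‖ ^ (s - sfloor s)

/-! ### Localization at `x₀` with bandwidth `h` -/

/-- `x ↦ 1/2 + (x - x₀)/h`. -/
def toUnit {d : ℕ} (x₀ : Cov d) (h : ℝ) (x : Cov d) : Cov d :=
  WithLp.toLp 2 fun j => 1 / 2 + (x j - x₀ j) / h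

/-- `v ↦ x₀ + h (v - 1/2)`. -/
def fromUnit {d : ℕ} (x₀ : Cov d) (h : ℝ) (v : Cov d) : Cov d :=
  WithLp.toLp 2 fun j => x₀ j + h * (v j - 1 / 2)

/-- `K_h(x) = h^{-d} 1(‖x - x₀‖ ≤ h/2)`. -/
def kern {d : ℕ} (x₀ : Cov d) (h : ℝ) (x : Cov d) : ℝ :=
  (Metric.closedBall x₀ (h / 2)).indicator (fun _ => 1 / h ^ d) x

/-- The measure `dF*(v) = dF(x₀ + h (v - 1/2))` on `{v : ‖v - 1/2‖ ≤ 1/2} ⊆ [0,1]^d`: if `F` has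
density `f`, then `F*` has density `v ↦ f (x₀ + h (v - 1/2))` there. -/
def locMeasure {d : ℕ} (F : Measure (Cov d)) (x₀ : Cov d) (h : ℝ) : Measure (Cov d) :=
  ENNReal.ofReal (1 / h ^ d) • (F.restrict (Metric.closedBall x₀ (h / 2))).map (toUnit x₀ h)

/-- The `L₂(ν)` norm. -/
def l2norm {d : ℕ} (ν : Measure (Cov d)) (g : Cov d → ℝ) : ℝ :=
  Real.sqrt (∫ v, g v ^ 2 ∂ν)

/-- `‖g‖_{F*}` for a function `g` of the covariates, through `g*(v) = g(x₀ + h (v - 1/2))`. -/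
def locNorm {d : ℕ} (F : Measure (Cov d)) (x₀ : Cov d) (h : ℝ) (g : Cov d → ℝ) : ℝ :=
  l2norm (locMeasure F x₀ h) (fun v => g (fromUnit x₀ h v))

/-! ### The Legendre basis `ρ` -/

/-- The `m`-th Legendre polynomial, shifted to be orthonormal on `[0,1]`. -/
def legendre (m : ℕ) (t : ℝ) : ℝ :=
  ∑ l ∈ Finset.range (m + 1),
    (-1 : ℝ) ^ (l + m) * Real.sqrt (2 * m + 1) * (m.choose l) * ((m + l).choose l) * t ^ l

/-- Multi-indices in `d` variables of total order at most `N`. -/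
abbrev MIdx (d N : ℕ) := {m : Fin d → Fin (N + 1) // ∑ j, (m j : ℕ) ≤ N}

/-- `ρ(x)`: tensor products of Legendre polynomials, of total order at most `N`. -/
def rho {d : ℕ} (N : ℕ) (x : Cov d) (m : MIdx d N) : ℝ :=
  ∏ j, legendre (m.1 j) (x j)

/-- `ρ_h(x) = ρ(1/2 + (x - x₀)/h)`. -/
def rhoh {d : ℕ} (N : ℕ) (x₀ : Cov d) (h : ℝ) (x : Cov d) : MIdx d N → ℝ :=
  rho N (toUnit x₀ h x)

/-- `Q = ∫ ρ_h K_h π (1 - π) ρ_hᵀ dF`. -/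
def popQ {d : ℕ} (N : ℕ) (F : Measure (Cov d)) (π : Cov d → ℝ) (x₀ : Cov d) (h : ℝ) :
    Matrix (MIdx d N) (MIdx d N) ℝ :=
  Matrix.of fun i j =>
    ∫ x, rhoh N x₀ h x i * kern x₀ h x * (π x * (1 - π x)) * rhoh N x₀ h x j ∂F

/-! ### The basis `b` of dimension `k` -/

/-- The Gram matrix `∫_{[0,1]^d} b bᵀ dν`. It is `Ω` for `ν = F*`, and `Ω̂` for `ν = F̂*`. -/
def gram {d k : ℕ} (b : Cov d → Fin k → ℝ) (ν : Measure (Cov d)) : Matrix (Fin k) (Fin k) ℝ :=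
  Matrix.of fun i j => ∫ v in unitCube d, b v i * b v j ∂ν

/-- The `L₂(ν)` projection `Π_b g = bᵀ (∫ b bᵀ dν)⁻¹ ∫ b g dν` of `g` on the span of `b`
(used only where the Gram matrix is invertible). -/
def proj {d k : ℕ} (b : Cov d → Fin k → ℝ) (ν : Measure (Cov d)) (g : Cov d → ℝ) (v : Cov d) : ℝ :=
  b v ⬝ᵥ ((gram b ν)⁻¹.mulVec fun i => ∫ u in unitCube d, b u i * g u ∂ν)

/-- Hölder approximation: `‖(I - Π_b) g‖_ν ≤ A(r) k^{-r/d}` for each `r`-smooth `g` (normalized to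
have Hölder constant `1`), for all orders of smoothness `r ≤ rmax`. -/
def HolderApprox {d k : ℕ} (b : Cov d → Fin k → ℝ) (ν : Measure (Cov d)) (rmax : ℝ)
    (A : ℝ → ℝ) : Prop :=
  ∀ r : ℝ, 0 < r → r ≤ rmax → ∀ g : Cov d → ℝ, IsHolder r 1 g →
    l2norm ν (fun v => g v - proj b ν g v) ≤ A r * (k : ℝ) ^ (-(r / d))

/-- `b_{hk}(x) = b(1/2 + (x - x₀)/h) 1(‖x - x₀‖ ≤ h/2)`. -/
def locBasis {d k : ℕ} (b : Cov d → Fin k → ℝ) (x₀ : Cov d) (h : ℝ) (x : Cov d) : Fin k → ℝ :=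
  (Metric.closedBall x₀ (h / 2)).indicator (fun x => b (toUnit x₀ h x)) x

/-! ### The estimator

In this section `p`, `m` and `Fh` are the nuisance estimates of `π`, `μ₀` and `F`. -/

/-- The sample average `P_n f`. -/
def sampleMean {d n : ℕ} (Z : Fin n → Obs d) (f : Obs d → ℝ) : ℝ :=
  (1 / (n : ℝ)) * ∑ i, f (Z i)

/-- The second-order U-statistic `U_n f`, over ordered pairs of distinct indices. -/
def uStat {d n : ℕ} (Z : Fin n → Obs d) (f : Obs d → Obs d → ℝ) : ℝ :=
  (1 / ((n : ℝ) * ((n : ℝ) - 1))) * ∑ i, ∑ j ∈ Finset.univ.erase i, f (Z i) (Z j)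

def phiA1 {d : ℕ} (p : Cov d → ℝ) (z : Obs d) : ℝ :=
  trt z * (trt z - p (cov z))

def phiY1 {d : ℕ} (p m : Cov d → ℝ) (z : Obs d) : ℝ :=
  (out z - m (cov z)) * (trt z - p (cov z))

/-- `b_{hk}(x₁)ᵀ Ω̂⁻¹ b_{hk}(x₂)`. -/
def projKernel {d k : ℕ} (b : Cov d → Fin k → ℝ) (Fh : Measure (Cov d)) (x₀ : Cov d) (h : ℝ)
    (x₁ x₂ : Cov d) : ℝ :=
  locBasis b x₀ h x₁ ⬝ᵥ ((gram b (locMeasure Fh x₀ h))⁻¹.mulVec (locBasis b x₀ h x₂))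

def phiA2 {d k : ℕ} (p : Cov d → ℝ) (Fh : Measure (Cov d)) (b : Cov d → Fin k → ℝ)
    (x₀ : Cov d) (h : ℝ) (z₁ z₂ : Obs d) : ℝ :=
  -((trt z₁ - p (cov z₁)) * projKernel b Fh x₀ h (cov z₁) (cov z₂) * trt z₂)

def phiY2 {d k : ℕ} (p m : Cov d → ℝ) (Fh : Measure (Cov d)) (b : Cov d → Fin k → ℝ)
    (x₀ : Cov d) (h : ℝ) (z₁ z₂ : Obs d) : ℝ :=
  -((trt z₁ - p (cov z₁)) * projKernel b Fh x₀ h (cov z₁) (cov z₂) * (out z₂ - m (cov z₂)))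

/-- The matrix `Q̂`. -/
def estQ {d n k : ℕ} (N : ℕ) (p : Cov d → ℝ) (Fh : Measure (Cov d))
    (b : Cov d → Fin k → ℝ) (x₀ : Cov d) (h : ℝ) (Z : Fin n → Obs d) :
    Matrix (MIdx d N) (MIdx d N) ℝ :=
  Matrix.of fun i j =>
    sampleMean Z (fun z =>
      rhoh N x₀ h (cov z) i * kern x₀ h (cov z) * phiA1 p z * rhoh N x₀ h (cov z) j)
    + uStat Z (fun z₁ z₂ =>
      rhoh N x₀ h (cov z₁) i * kern x₀ h (cov z₁) * phiA2 p Fh b x₀ h z₁ z₂ *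
        kern x₀ h (cov z₂) * rhoh N x₀ h (cov z₂) j)

/-- The vector `R̂`. -/
def estR {d n k : ℕ} (N : ℕ) (p m : Cov d → ℝ) (Fh : Measure (Cov d))
    (b : Cov d → Fin k → ℝ) (x₀ : Cov d) (h : ℝ) (Z : Fin n → Obs d) : MIdx d N → ℝ :=
  fun i =>
    sampleMean Z (fun z => rhoh N x₀ h (cov z) i * kern x₀ h (cov z) * phiY1 p m z)
    + uStat Z (fun z₁ z₂ =>
      rhoh N x₀ h (cov z₁) i * kern x₀ h (cov z₁) * phiY2 p m Fh b x₀ h z₁ z₂ *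
        kern x₀ h (cov z₂))

/-- The higher-order local polynomial R-learner `τ̂(x₀) = ρ_h(x₀)ᵀ Q̂⁻¹ R̂`. -/
def tauHat {d n k : ℕ} (N : ℕ) (p m : Cov d → ℝ) (Fh : Measure (Cov d))
    (b : Cov d → Fin k → ℝ) (x₀ : Cov d) (h : ℝ) (Z : Fin n → Obs d) : ℝ :=
  rhoh N x₀ h x₀ ⬝ᵥ ((estQ N p Fh b x₀ h Z)⁻¹.mulVec (estR N p m Fh b x₀ h Z))

/-! ### Conditions -/

/-- All (real) eigenvalues of the matrix lie in `[c, M]`. -/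
def EigBounded {ι : Type*} [Fintype ι] [DecidableEq ι] (c M : ℝ) (Q : Matrix ι ι ℝ) : Prop :=
  ∀ t ∈ spectrum ℝ Q, c ≤ t ∧ t ≤ M

/-- The operator (spectral) norm of a real square matrix. -/
def opNorm {ι : Type*} [Fintype ι] [DecidableEq ι] (Q : Matrix ι ι ℝ) : ℝ :=
  ‖Matrix.toEuclideanCLM (𝕜 := ℝ) Q‖

/-- `‖dF̂*/dF* - 1‖_∞`. -/
def covErr {d : ℕ} (F Fh : Measure (Cov d)) (x₀ : Cov d) (h : ℝ) : ℝ :=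
  (eLpNorm (fun v => ((locMeasure Fh x₀ h).rnDeriv (locMeasure F x₀ h) v).toReal - 1) ⊤
    (locMeasure F x₀ h)).toReal

/-- The conditions on the estimates `p`, `m`, `Fh` of `π`, `μ₀`, `F`. -/
structure NuisanceOK {d : ℕ} (α β γ L c M : ℝ) (n : ℕ) (F : Measure (Cov d)) (π μ₀ : Cov d → ℝ)
    (x₀ : Cov d) (h : ℝ) (p m : Cov d → ℝ) (Fh : Measure (Cov d)) : Prop where
  smooth_pi : IsHolder α L (fun x => p x - π x)
  smooth_mu : IsHolder β L (fun x => m x - μ₀ x)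
  bound_pi : ∀ x ∈ unitCube d, p x ^ 2 ≤ M
  bound_mu : ∀ x ∈ unitCube d, m x ^ 2 ≤ M
  bound_err : locNorm F x₀ h (fun x => m x - μ₀ x) ≤ M
  abs_cont : locMeasure Fh x₀ h ≪ locMeasure F x₀ h
  density : ∀ᵐ v ∂(locMeasure F x₀ h),
    ENNReal.ofReal c ≤ (locMeasure Fh x₀ h).rnDeriv (locMeasure F x₀ h) v ∧
      (locMeasure Fh x₀ h).rnDeriv (locMeasure F x₀ h) v ≤ ENNReal.ofReal M
  cov_accuracy : covErr F Fh x₀ h *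
      (locNorm F x₀ h (fun x => p x - π x) * (locNorm F x₀ h (fun x => m x - μ₀ x) + h ^ γ)) ≤
    M * (n : ℝ) ^ (-1 / (1 + d / (2 * γ) + max (d / (4 * ((α + β) / 2))) (1 + d / (2 * γ))))

/-- The choice of the tuning parameters `h` and `k`, up to constant factors in `[c, M]`. -/
structure TuningOK (d : ℕ) (s γ c M : ℝ) (n : ℕ) (h : ℝ) (k : ℕ) : Prop where
  low : s < (d / 4) / (1 + d / (2 * γ)) →
    h ∈ Set.Icc (c * (n : ℝ) ^ (-(1 / γ) / (1 + d / (2 * γ) + d / (4 * s))))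
        (M * (n : ℝ) ^ (-(1 / γ) / (1 + d / (2 * γ) + d / (4 * s)))) ∧
    (k : ℝ) ∈ Set.Icc (c * (n : ℝ) ^ ((d / (2 * s) - d / γ) / (1 + d / (2 * γ) + d / (4 * s))))
        (M * (n : ℝ) ^ ((d / (2 * s) - d / γ) / (1 + d / (2 * γ) + d / (4 * s))))
  high : (d / 4) / (1 + d / (2 * γ)) ≤ s →
    h ∈ Set.Icc (c * (n : ℝ) ^ (-1 / (2 * γ + d))) (M * (n : ℝ) ^ (-1 / (2 * γ + d))) ∧
    (k : ℝ) ∈ Set.Icc (c * (n * h ^ d)) (M * (n * h ^ d))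

end RLearner

end

noncomputable section

namespace RLearner

/-! ### Partial derivatives on the cube -/

/-! Let `T` be the Taylor polynomial of τ at x₀ of order ⌊γ⌋. It is a linear combination ρ_hᵀθ, and
T(x₀) = τ(x₀), so τ̂(x₀) - τ(x₀) = ρ_h(x₀)ᵀ Q̂⁻¹ (R̂ - Q̂θ). Since ρ_h(x₀) does not depend on h and
Q̂⁻¹ is bounded on the event, it suffices to bound the mean absolute value of each coordinate of R̂
- Q̂θ (`abs_dotProduct_inv_mulVec_sub_le`, `exists_integral_abs_error_le`). This is done for a
frozen training sample; `setLIntegral_prod_le` then integrates over it.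

By bilinearity (`estR_sub_estQ_mulVec`) a coordinate of R̂ - Q̂θ is a sample mean of K X₁ X₂ minus a
U-statistic with kernel K X₁ · bᵀΩ̂⁻¹b · K X₂, where X₁ = q (A - π̂), X₂ = Y - μ̂₀ - A T, and q is a
coordinate of ρ_h. Given X, the residuals have means ξ = q (π - π̂) and g = (μ₀ - μ̂₀) + π (τ - T),
and their product has mean ξ g + q π (1 - π)(τ - T).

Bias. In the scaled variable let w be the density of F̂* with respect to F*, and Π_w f = bᵀΩ_w⁻¹∫ b
f dF*, where Ω_w = Ω̂. The mean of R̂ - Q̂θ is ∫ ξ (g - Π_w g) dF* plus a term of order h^γ.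
Replacing Π_w by the orthogonal projection Π costs at most a multiple of ‖w - 1‖_∞ ‖ξ‖ ‖g‖, which
condition (vi) controls. For Π itself, orthogonality gives ∫ (ξ - Πξ)(g - Πg), a product of two
approximation errors (`abs_integral_mul_sub_wproj_le`, `exists_bias_le`). A rescaled α-smooth
function is a polynomial with bounded Hölder norms of every order plus a remainder with Hölder
constant of order h^α. So its approximation error is h^α k^{-α/d} + k^{-r̄/d} up to a constant, and
r̄ is taken so large that the last term is negligible (`exists_l2norm_sub_wproj_le`).

Variance. By Hoeffding's decomposition (`integral_abs_uStat_sub_le`) the linear parts have variance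
of order 1/(n h^d). The degenerate part has variance of order k/(n h^d)², because the squared L₂
norm of the projection kernel is at most a multiple of its trace, which is at most a multiple of k
(`integral_wkernel_sq_le`, `integral_wkernel_self_le`).

Rates. In the low-smoothness case h and k balance h^γ, (h k^{-1/d})^{α+β} and √k/(n h^d), with 1/√(n
h^d) of smaller order. Otherwise h^γ is balanced with 1/√(n h^d), and k ≍ n h^d keeps the quadratic
variance at that order (`exists_tuningRates`). -/

lemma unitCube_eq_preimage (d : ℕ) : unitCube d = ⋂ j, {x : Cov d | x j ∈ Set.Icc (0 : ℝ) 1} := by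
  ext x; simp [unitCube]

lemma convex_unitCube (d : ℕ) : Convex ℝ (unitCube d) := by
  intro x hx y hy a b ha hb hab j
  have := (convex_Icc (0 : ℝ) 1) (hx j) (hy j) ha hb hab
  simpa using this

lemma isClosed_unitCube (d : ℕ) : IsClosed (unitCube d) := by
  rw [unitCube_eq_preimage]
  exact isClosed_iInter fun j => isClosed_Icc.preimage (by fun_prop)

lemma measurableSet_unitCube (d : ℕ) : MeasurableSet (unitCube d) :=
  (isClosed_unitCube d).measurableSet

lemma interior_unitCube_nonempty (d : ℕ) : (interior (unitCube d)).Nonempty := by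
  refine ⟨WithLp.toLp 2 fun _ => 1 / 2, ?_⟩
  rw [mem_interior]
  refine ⟨⋂ j, {x : Cov d | x j ∈ Set.Ioo (0 : ℝ) 1}, ?_, ?_, ?_⟩
  · intro x hx j
    exact Set.Ioo_subset_Icc_self (Set.mem_iInter.1 hx j)
  · exact isOpen_iInter_of_finite fun j => isOpen_Ioo.preimage (by fun_prop)
  · simp only [Set.mem_iInter, Set.mem_ofPred_eq, Set.mem_Ioo]
    intro j; norm_num

lemma uniqueDiffOn_unitCube (d : ℕ) : UniqueDiffOn ℝ (unitCube d) :=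
  uniqueDiffOn_convex (convex_unitCube d) (interior_unitCube_nonempty d)

lemma mem_closure_interior_unitCube {d : ℕ} {x : Cov d} (hx : x ∈ unitCube d) :
    x ∈ closure (interior (unitCube d)) := by
  rw [(convex_unitCube d).closure_interior_eq_closure_of_nonempty_interior
    (interior_unitCube_nonempty d)]
  exact subset_closure hx

lemma norm_sub_le_of_mem_unitCube {d : ℕ} {x y : Cov d} (hx : x ∈ unitCube d)
    (hy : y ∈ unitCube d) : ‖x - y‖ ≤ Real.sqrt d := by
  rw [EuclideanSpace.norm_eq]
  apply Real.sqrt_le_sqrt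
  calc ∑ i, ‖(x - y) i‖ ^ 2 ≤ ∑ _i : Fin d, (1 : ℝ) := by
        refine Finset.sum_le_sum fun i _ => ?_
        have h1 := hx i
        have h2 := hy i
        simp only [Set.mem_Icc] at h1 h2
        rw [Real.norm_eq_abs, sq_abs, PiLp.sub_apply]
        nlinarith
    _ = d := by simp

/-- The partial derivative `∂g/∂x_i` on the cube. -/
def pd {d : ℕ} (i : Fin d) (g : Cov d → ℝ) (x : Cov d) : ℝ :=
  fderivWithin ℝ g (unitCube d) x (EuclideanSpace.single i (1 : ℝ))

section
variable {d : ℕ}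

lemma pd_eq_of_hasFDerivWithinAt {g : Cov d → ℝ} {g' : Cov d →L[ℝ] ℝ} {x : Cov d}
    (h : HasFDerivWithinAt g g' (unitCube d) x) (hx : x ∈ unitCube d) (i : Fin d) :
    pd i g x = g' (EuclideanSpace.single i (1 : ℝ)) := by
  rw [pd, h.fderivWithin (uniqueDiffOn_unitCube d x hx)]

lemma pd_congr {f g : Cov d → ℝ} (h : Set.EqOn f g (unitCube d)) (i : Fin d) :
    Set.EqOn (pd i f) (pd i g) (unitCube d) := by
  intro x hx
  rw [pd, pd, fderivWithin_congr h (h hx)]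

lemma clm_apply_eq_sum (l : Cov d →L[ℝ] ℝ) (v : Cov d) :
    l v = ∑ i, v i * l (EuclideanSpace.single i (1 : ℝ)) := by
  conv_lhs => rw [← (EuclideanSpace.basisFun (Fin d) ℝ).sum_repr v]
  simp [map_sum]

lemma clm_norm_le_sum (l : Cov d →L[ℝ] ℝ) :
    ‖l‖ ≤ ∑ i, |l (EuclideanSpace.single i (1 : ℝ))| := by
  refine l.opNorm_le_bound (Finset.sum_nonneg fun i _ => abs_nonneg _) fun v => ?_
  rw [clm_apply_eq_sum l v, Finset.sum_mul]
  refine (norm_sum_le _ _).trans (Finset.sum_le_sum fun i _ => ?_)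
  rw [norm_mul, mul_comm, Real.norm_eq_abs]
  exact mul_le_mul_of_nonneg_left (PiLp.norm_apply_le v i) (abs_nonneg _)

lemma pd_add {f g : Cov d → ℝ} (hf : DifferentiableOn ℝ f (unitCube d))
    (hg : DifferentiableOn ℝ g (unitCube d)) (i : Fin d) :
    Set.EqOn (pd i fun x => f x + g x) (fun x => pd i f x + pd i g x) (unitCube d) := by
  intro x hx
  refine (pd_eq_of_hasFDerivWithinAt
    ((hf x hx).hasFDerivWithinAt.add (hg x hx).hasFDerivWithinAt) hx i).trans ?_
  rfl

lemma pd_sub {f g : Cov d → ℝ} (hf : DifferentiableOn ℝ f (unitCube d))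
    (hg : DifferentiableOn ℝ g (unitCube d)) (i : Fin d) :
    Set.EqOn (pd i fun x => f x - g x) (fun x => pd i f x - pd i g x) (unitCube d) := by
  intro x hx
  refine (pd_eq_of_hasFDerivWithinAt
    ((hf x hx).hasFDerivWithinAt.sub (hg x hx).hasFDerivWithinAt) hx i).trans ?_
  rfl

lemma pd_const_mul {f : Cov d → ℝ} (hf : DifferentiableOn ℝ f (unitCube d)) (c : ℝ) (i : Fin d) :
    Set.EqOn (pd i fun x => c * f x) (fun x => c * pd i f x) (unitCube d) := by
  intro x hx
  rw [pd_eq_of_hasFDerivWithinAt ((hf x hx).hasFDerivWithinAt.const_mul c) hx]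
  rfl

lemma pd_mul {f g : Cov d → ℝ} (hf : DifferentiableOn ℝ f (unitCube d))
    (hg : DifferentiableOn ℝ g (unitCube d)) (i : Fin d) :
    Set.EqOn (pd i fun x => f x * g x) (fun x => f x * pd i g x + pd i f x * g x)
      (unitCube d) := by
  intro x hx
  refine (pd_eq_of_hasFDerivWithinAt
    ((hf x hx).hasFDerivWithinAt.mul (hg x hx).hasFDerivWithinAt) hx i).trans ?_
  simp [pd, mul_comm]

lemma pd_const (c : ℝ) (i : Fin d) : Set.EqOn (pd i fun _ => c) (fun _ => 0) (unitCube d) := by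
  intro x hx
  rw [pd_eq_of_hasFDerivWithinAt (hasFDerivWithinAt_const c x _) hx]
  rfl

lemma hasFDerivAt_coord (j : Fin d) (x : Cov d) :
    HasFDerivAt (fun x : Cov d => x j) (EuclideanSpace.proj j : Cov d →L[ℝ] ℝ) x :=
  (EuclideanSpace.proj j : Cov d →L[ℝ] ℝ).hasFDerivAt

lemma pd_coord (i j : Fin d) (c : ℝ) :
    Set.EqOn (pd i fun x => x j - c) (fun _ => if j = i then 1 else 0) (unitCube d) := by
  intro x hx
  rw [pd_eq_of_hasFDerivWithinAt ((hasFDerivAt_coord j x).hasFDerivWithinAt.sub_const c) hx]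
  simp

/-- Symmetry of the second derivative persists on the boundary of the cube because each of its
points is a limit of interior points. -/
lemma pd_comm {g : Cov d → ℝ} (hg : ContDiffOn ℝ 2 g (unitCube d)) (i j : Fin d) :
    Set.EqOn (pd i (pd j g)) (pd j (pd i g)) (unitCube d) := by
  intro x hx
  have hd : DifferentiableWithinAt ℝ (fderivWithin ℝ g (unitCube d)) (unitCube d) x :=
    (hg.fderivWithin (m := 1) (uniqueDiffOn_unitCube d) (by norm_num)).differentiableOn
      (by norm_num) x hx
  have key : ∀ a b : Fin d, pd a (pd b g) x =
      fderivWithin ℝ (fderivWithin ℝ g (unitCube d)) (unitCube d) x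
        (EuclideanSpace.single a (1 : ℝ)) (EuclideanSpace.single b (1 : ℝ)) := by
    intro a b
    have := hd.hasFDerivWithinAt.clm_apply
      (hasFDerivWithinAt_const (EuclideanSpace.single b (1 : ℝ)) x (unitCube d))
    have h2 := pd_eq_of_hasFDerivWithinAt this hx a
    change pd a (fun x => fderivWithin ℝ g (unitCube d) x (EuclideanSpace.single b (1 : ℝ))) x = _
    rw [h2]; simp
  rw [key, key]
  exact (hg x hx).isSymmSndFDerivWithinAt (by simp) (uniqueDiffOn_unitCube d)
    (mem_closure_interior_unitCube hx) hx _ _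

/-- Mean value inequality with derivatives taken within the cube but bounded only on a convex
subset. The Taylor remainder needs this with the cube intersected with a ball around x₀. -/
lemma abs_sub_le_of_pd_bound {f : Cov d → ℝ} {S : Set (Cov d)} {B : ℝ} (hS : Convex ℝ S)
    (hSc : S ⊆ unitCube d) (hf : DifferentiableOn ℝ f (unitCube d))
    (hB : ∀ x ∈ S, ∀ i, |pd i f x| ≤ B) {x y : Cov d} (hx : x ∈ S) (hy : y ∈ S) :
    |f y - f x| ≤ d * B * ‖y - x‖ := by
  refine hS.norm_image_sub_le_of_norm_hasFDerivWithin_le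
    (f' := fun z => fderivWithin ℝ f (unitCube d) z)
    (fun z hz => (hf z (hSc hz)).hasFDerivWithinAt.mono hSc) (fun z hz => ?_) hx hy
  refine (clm_norm_le_sum _).trans ?_
  calc _ ≤ ∑ _i : Fin d, B := Finset.sum_le_sum fun i _ => hB z hz i
    _ = d * B := by simp

/-! ### Hölder classes by recursion on the partial derivatives -/

/-- `g` has partial derivatives on the cube up to order `N`, bounded by `K`, and those of order
`N` are `s`-Hölder with constant `K`. -/
def HolderRec (s K : ℝ) : ℕ → (Cov d → ℝ) → Prop
  | 0, g => (∀ x ∈ unitCube d, |g x| ≤ K) ∧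
      ∀ x ∈ unitCube d, ∀ y ∈ unitCube d, |g x - g y| ≤ K * ‖x - y‖ ^ s
  | N + 1, g => (∀ x ∈ unitCube d, |g x| ≤ K) ∧ DifferentiableOn ℝ g (unitCube d) ∧
      ∀ i, HolderRec s K N (pd i g)

namespace HolderRec

variable {s K L : ℝ} {N : ℕ} {f g : Cov d → ℝ}

lemma bound (h : HolderRec s K N f) : ∀ x ∈ unitCube d, |f x| ≤ K := by
  cases N <;> exact h.1

lemma nonneg (h : HolderRec s K N f) : 0 ≤ K := by
  obtain ⟨x, hx⟩ := interior_unitCube_nonempty d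
  exact (abs_nonneg _).trans (h.bound x (interior_subset hx))

lemma congr (h : HolderRec s K N f) (hfg : Set.EqOn f g (unitCube d)) : HolderRec s K N g := by
  induction N generalizing f g with
  | zero =>
    refine ⟨fun x hx => hfg hx ▸ h.1 x hx, fun x hx y hy => ?_⟩
    rw [← hfg hx, ← hfg hy]; exact h.2 x hx y hy
  | succ N ih =>
    exact ⟨fun x hx => hfg hx ▸ h.1 x hx, h.2.1.congr fun x hx => (hfg hx).symm,
      fun i => ih (h.2.2 i) (pd_congr hfg i)⟩

lemma mono (h : HolderRec s K N f) (hKL : K ≤ L) : HolderRec s L N f := by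
  induction N generalizing f with
  | zero =>
    exact ⟨fun x hx => (h.1 x hx).trans hKL, fun x hx y hy => (h.2 x hx y hy).trans
      (mul_le_mul_of_nonneg_right hKL (by positivity))⟩
  | succ N ih => exact ⟨fun x hx => (h.1 x hx).trans hKL, h.2.1, fun i => ih (h.2.2 i)⟩

lemma add (hf : HolderRec s K N f) (hg : HolderRec s L N g) :
    HolderRec s (K + L) N (fun x => f x + g x) := by
  induction N generalizing f g with
  | zero =>
    refine ⟨fun x hx => (abs_add_le _ _).trans (add_le_add (hf.1 x hx) (hg.1 x hx)),
      fun x hx y hy => ?_⟩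
    calc |f x + g x - (f y + g y)| = |(f x - f y) + (g x - g y)| := by ring_nf
      _ ≤ _ := (abs_add_le _ _).trans (add_le_add (hf.2 x hx y hy) (hg.2 x hx y hy))
      _ = _ := by ring
  | succ N ih =>
    refine ⟨fun x hx => (abs_add_le _ _).trans (add_le_add (hf.1 x hx) (hg.1 x hx)),
      hf.2.1.add hg.2.1, fun i => ?_⟩
    exact (ih (hf.2.2 i) (hg.2.2 i)).congr (pd_add hf.2.1 hg.2.1 i).symm

lemma const_mul (hf : HolderRec s K N f) (c : ℝ) :
    HolderRec s (|c| * K) N (fun x => c * f x) := by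
  have hb : ∀ {f : Cov d → ℝ}, (∀ x ∈ unitCube d, |f x| ≤ K) →
      ∀ x ∈ unitCube d, |c * f x| ≤ |c| * K := fun h x hx => by
    rw [abs_mul]; exact mul_le_mul_of_nonneg_left (h x hx) (abs_nonneg c)
  induction N generalizing f with
  | zero =>
    refine ⟨hb hf.1, fun x hx y hy => ?_⟩
    rw [← mul_sub, abs_mul, mul_assoc]
    exact mul_le_mul_of_nonneg_left (hf.2 x hx y hy) (abs_nonneg c)
  | succ N ih =>
    exact ⟨hb hf.1, hf.2.1.const_mul c,
      fun i => (ih (hf.2.2 i)).congr (pd_const_mul hf.2.1 c i).symm⟩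

lemma const (s : ℝ) (N : ℕ) (c : ℝ) : HolderRec s |c| N (fun _ : Cov d => c) := by
  induction N generalizing c with
  | zero => exact ⟨fun x _ => le_rfl, fun x _ y _ => by simp; positivity⟩
  | succ N ih =>
    refine ⟨fun x _ => le_rfl, differentiableOn_const c, fun i => ?_⟩
    exact ((ih 0).mono (by simp)).congr (pd_const c i).symm

/-- Bounded partial derivatives make a function Lipschitz, and on a set of diameter √d a Lipschitz
function is `s`-Hölder for `s ≤ 1`. In the constant, `d` comes from summing the partial derivatives
and `1 + √d` bounds ‖x - y‖^(1-s). -/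
lemma lower (hs0 : 0 < s) (hs1 : s ≤ 1) (h : HolderRec s K (N + 1) f) :
    HolderRec s ((1 + d * (1 + Real.sqrt d)) * K) N f := by
  have hC : 1 ≤ 1 + d * (1 + Real.sqrt d) := by
    have := Real.sqrt_nonneg d
    have : 0 ≤ (d : ℝ) * (1 + Real.sqrt d) := by positivity
    linarith
  induction N generalizing f with
  | zero =>
    have hK := h.nonneg
    have hKC : K ≤ (1 + d * (1 + Real.sqrt d)) * K := by nlinarith
    refine ⟨fun x hx => (h.1 x hx).trans hKC, fun x hx y hy => ?_⟩
    have h1 := abs_sub_le_of_pd_bound (convex_unitCube d) subset_rfl h.2.1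
      (fun z hz i => (h.2.2 i).bound z hz) hy hx
    refine h1.trans ?_
    have h2 : ‖x - y‖ ≤ (1 + Real.sqrt d) * ‖x - y‖ ^ s := by
      rcases (norm_nonneg (x - y)).eq_or_lt with h0 | h0
      · rw [← h0]; positivity
      · have h3 : ‖x - y‖ = ‖x - y‖ ^ (1 - s) * ‖x - y‖ ^ s := by
          rw [← Real.rpow_add h0]; simp
        have h4 : ‖x - y‖ ^ (1 - s) ≤ 1 + Real.sqrt d := by
          have h5 : ‖x - y‖ ≤ 1 + Real.sqrt d :=
            (norm_sub_le_of_mem_unitCube hx hy).trans (by linarith)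
          calc ‖x - y‖ ^ (1 - s) ≤ (1 + Real.sqrt d) ^ (1 - s) :=
                Real.rpow_le_rpow h0.le h5 (by linarith)
            _ ≤ (1 + Real.sqrt d) ^ (1 : ℝ) :=
                Real.rpow_le_rpow_of_exponent_le (by linarith [Real.sqrt_nonneg d]) (by linarith)
            _ = _ := Real.rpow_one _
        calc ‖x - y‖ = ‖x - y‖ ^ (1 - s) * ‖x - y‖ ^ s := h3
          _ ≤ _ := mul_le_mul_of_nonneg_right h4 (by positivity)
    calc d * K * ‖x - y‖ ≤ d * K * ((1 + Real.sqrt d) * ‖x - y‖ ^ s) :=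
          mul_le_mul_of_nonneg_left h2 (by positivity)
      _ = (d * (1 + Real.sqrt d)) * K * ‖x - y‖ ^ s := by ring
      _ ≤ _ := by
        refine mul_le_mul_of_nonneg_right (mul_le_mul_of_nonneg_right ?_ hK) (by positivity)
        linarith
  | succ N ih =>
    have hK := h.nonneg
    exact ⟨fun x hx => (h.1 x hx).trans (by nlinarith), h.2.1, fun i => ih (h.2.2 i)⟩

end HolderRec

/-- Leibniz rule and induction on the order. In f ∂g + ∂f g the undifferentiated factor has one
order more than its partner, and `HolderRec.lower` brings it down. -/
lemma HolderRec.exists_mul (d : ℕ) {s : ℝ} (hs0 : 0 < s) (hs1 : s ≤ 1) (N : ℕ) :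
    ∃ C : ℝ, 0 ≤ C ∧ ∀ (K L : ℝ) (f g : Cov d → ℝ), HolderRec s K N f → HolderRec s L N g →
      HolderRec s (C * (K * L)) N (fun x => f x * g x) := by
  induction N with
  | zero =>
    refine ⟨2, by norm_num, fun K L f g hf hg => ?_⟩
    have hK := hf.nonneg
    have hL := hg.nonneg
    have hKL : 0 ≤ K * L := by positivity
    have hb : ∀ x ∈ unitCube d, |f x * g x| ≤ K * L := fun x hx => by
      rw [abs_mul]; exact mul_le_mul (hf.1 x hx) (hg.1 x hx) (abs_nonneg _) hK
    refine ⟨fun x hx => (hb x hx).trans (by linarith), fun x hx y hy => ?_⟩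
    calc |f x * g x - f y * g y| = |f x * (g x - g y) + (f x - f y) * g y| := by ring_nf
      _ ≤ |f x| * |g x - g y| + |f x - f y| * |g y| := by
        refine (abs_add_le _ _).trans ?_
        rw [abs_mul, abs_mul]
      _ ≤ K * (L * ‖x - y‖ ^ s) + K * ‖x - y‖ ^ s * L := by
        refine add_le_add ?_ ?_
        · exact mul_le_mul (hf.1 x hx) (hg.2 x hx y hy) (abs_nonneg _) hK
        · exact mul_le_mul (hf.2 x hx y hy) (hg.1 y hy) (abs_nonneg _) (by positivity)
      _ = _ := by ring
  | succ N ih =>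
    obtain ⟨C, hC, ih⟩ := ih
    set D : ℝ := 1 + d * (1 + Real.sqrt d) with hD
    have hD0 : 0 ≤ D := by have := Real.sqrt_nonneg d; positivity
    refine ⟨1 + 2 * (C * D), by positivity, fun K L f g hf hg => ?_⟩
    have hK := hf.nonneg
    have hL := hg.nonneg
    have hKL : 0 ≤ K * L := by positivity
    refine ⟨fun x hx => ?_, hf.2.1.mul hg.2.1, fun i => ?_⟩
    · rw [abs_mul]
      have h1 : 0 ≤ 2 * (C * D) * (K * L) := by positivity
      calc |f x| * |g x| ≤ K * L := mul_le_mul (hf.1 x hx) (hg.1 x hx) (abs_nonneg _) hK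
        _ ≤ _ := by linarith
    · have h1 := ih _ _ _ _ (hf.lower hs0 hs1) (hg.2.2 i)
      have h2 := ih _ _ _ _ (hf.2.2 i) (hg.lower hs0 hs1)
      refine ((h1.add h2).mono ?_).congr (pd_mul hf.2.1 hg.2.1 i).symm
      nlinarith

/-! ### Comparison with the classes of the statement -/

lemma partialD_zero (j : Fin 0 → Fin d) (g : Cov d → ℝ) (x : Cov d) : partialD j g x = g x := by
  simp [partialD]

lemma contDiffOn_pd {N : ℕ} {g : Cov d → ℝ} (hg : ContDiffOn ℝ (N + 1 : ℕ) g (unitCube d))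
    (i : Fin d) : ContDiffOn ℝ N (pd i g) (unitCube d) := by
  have h := hg.fderivWithin (m := N) (uniqueDiffOn_unitCube d) (by norm_cast)
  exact h.clm_apply contDiffOn_const

/-- The last index is the derivative taken first, so peeling it off leaves a lower-order derivative
of `pd i g`. This is the induction step in passing between `IsHolder` and `HolderRec`. -/
lemma partialD_snoc {N m : ℕ} {g : Cov d → ℝ} (hg : ContDiffOn ℝ (N + 1 : ℕ) g (unitCube d))
    (hm : m ≤ N) (j : Fin m → Fin d) (i : Fin d) {x : Cov d} (hx : x ∈ unitCube d) :
    partialD (Fin.snoc j i : Fin (m + 1) → Fin d) g x = partialD j (pd i g) x := by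
  have h := hg.fderivWithin (m := N) (uniqueDiffOn_unitCube d) (by norm_cast)
  have h2 := (ContinuousLinearMap.apply ℝ ℝ
    (EuclideanSpace.single i (1 : ℝ) : Cov d)).iteratedFDerivWithin_comp_left (h x hx)
      (uniqueDiffOn_unitCube d) hx (i := m) (by exact_mod_cast hm)
  unfold partialD
  rw [iteratedFDerivWithin_succ_apply_right (uniqueDiffOn_unitCube d) hx]
  have h3 : (ContinuousLinearMap.apply ℝ ℝ (EuclideanSpace.single i (1 : ℝ) : Cov d)) ∘
      fderivWithin ℝ g (unitCube d) = pd i g := rfl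
  rw [h3] at h2
  rw [h2]
  simp [Fin.init_def]

lemma HolderRec.of_partialD {s K : ℝ} {N : ℕ} {g : Cov d → ℝ}
    (hg : ContDiffOn ℝ N g (unitCube d))
    (hb : ∀ m ≤ N, ∀ j : Fin m → Fin d, ∀ x ∈ unitCube d, |partialD j g x| ≤ K)
    (hh : ∀ j : Fin N → Fin d, ∀ x ∈ unitCube d, ∀ y ∈ unitCube d,
      |partialD j g x - partialD j g y| ≤ K * ‖x - y‖ ^ s) : HolderRec s K N g := by
  have h0 : ∀ x ∈ unitCube d, |g x| ≤ K := fun x hx => by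
    simpa [partialD_zero] using hb 0 (Nat.zero_le _) Fin.elim0 x hx
  induction N generalizing g with
  | zero =>
    exact ⟨h0, fun x hx y hy => by simpa [partialD_zero] using hh Fin.elim0 x hx y hy⟩
  | succ N ih =>
    refine ⟨h0, hg.differentiableOn (by simp), fun i => ?_⟩
    have hb' : ∀ m ≤ N, ∀ j : Fin m → Fin d, ∀ x ∈ unitCube d, |partialD j (pd i g) x| ≤ K :=
      fun m hm j x hx => by
        rw [← partialD_snoc hg hm j i hx]; exact hb _ (by omega) _ x hx
    refine ih (contDiffOn_pd hg i) hb' (fun j x hx y hy => ?_) (fun x hx => ?_)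
    · rw [← partialD_snoc hg le_rfl j i hx, ← partialD_snoc hg le_rfl j i hy]
      exact hh _ x hx y hy
    · simpa [partialD_zero] using hb' 0 (Nat.zero_le _) Fin.elim0 x hx

/-- The Fréchet derivative is a finite combination of the partial derivatives, which are smooth by
induction; at order zero a positive Hölder exponent gives continuity. -/
lemma HolderRec.contDiffOn {s K : ℝ} (hs : 0 < s) {N : ℕ} {g : Cov d → ℝ}
    (h : HolderRec s K N g) : ContDiffOn ℝ N g (unitCube d) := by
  induction N generalizing g with
  | zero =>
    simp only [Nat.cast_zero, contDiffOn_zero]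
    intro x hx
    have h1 : Filter.Tendsto (fun y => K * ‖y - x‖ ^ s) (nhdsWithin x (unitCube d)) (nhds 0) := by
      have : ContinuousAt (fun y : Cov d => K * ‖y - x‖ ^ s) x :=
        (((continuous_id.sub continuous_const).norm).rpow_const
          (fun _ => Or.inr hs.le)).continuousAt.const_mul K
      have h2 := this.tendsto.mono_left (nhdsWithin_le_nhds (s := unitCube d))
      simpa [hs.ne'] using h2
    rw [ContinuousWithinAt, tendsto_iff_norm_sub_tendsto_zero]
    refine squeeze_zero' (Filter.Eventually.of_forall fun _ => norm_nonneg _) ?_ h1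
    filter_upwards [self_mem_nhdsWithin] with y hy
    exact h.2 y hy x hx
  | succ N ih =>
    have : ((N + 1 : ℕ) : WithTop ℕ∞) = (N : WithTop ℕ∞) + 1 := by push_cast; rfl
    rw [this, contDiffOn_succ_iff_fderivWithin (uniqueDiffOn_unitCube d)]
    refine ⟨h.2.1, by simp, ?_⟩
    have h2 : fderivWithin ℝ g (unitCube d) = fun x => ∑ i, pd i g x •
        (EuclideanSpace.proj i : Cov d →L[ℝ] ℝ) := by
      funext x; ext v
      rw [clm_apply_eq_sum]
      simp [pd, mul_comm]
    rw [h2]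
    exact ContDiffOn.sum fun i _ => (ih (h.2.2 i)).smul contDiffOn_const

lemma HolderRec.partialD_bound {s K : ℝ} (hs : 0 < s) {N : ℕ} {g : Cov d → ℝ}
    (h : HolderRec s K N g) {m : ℕ} (hm : m ≤ N) (j : Fin m → Fin d) {x : Cov d}
    (hx : x ∈ unitCube d) : |partialD j g x| ≤ K := by
  induction N generalizing g m with
  | zero =>
    obtain rfl : m = 0 := by omega
    rw [partialD_zero]; exact h.bound x hx
  | succ N ih =>
    cases m with
    | zero => rw [partialD_zero]; exact h.bound x hx
    | succ m =>
      rw [← Fin.snoc_init_self j, partialD_snoc (h.contDiffOn hs) (by omega) _ _ hx]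
      exact ih (h.2.2 _) (by omega) _

lemma HolderRec.partialD_holder {s K : ℝ} (hs : 0 < s) {N : ℕ} {g : Cov d → ℝ}
    (h : HolderRec s K N g) (j : Fin N → Fin d) {x y : Cov d}
    (hx : x ∈ unitCube d) (hy : y ∈ unitCube d) :
    |partialD j g x - partialD j g y| ≤ K * ‖x - y‖ ^ s := by
  induction N generalizing g with
  | zero => rw [partialD_zero, partialD_zero]; exact h.2 x hx y hy
  | succ N ih =>
    rw [← Fin.snoc_init_self j, partialD_snoc (h.contDiffOn hs) le_rfl _ _ hx,
      partialD_snoc (h.contDiffOn hs) le_rfl _ _ hy]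
    exact ih (h.2.2 _) _

lemma sfloor_lt {r : ℝ} (hr : 0 < r) : (sfloor r : ℝ) < r := by
  have h1 : 1 ≤ ⌈r⌉₊ := Nat.one_le_iff_ne_zero.2 (Nat.ceil_pos.2 hr).ne'
  have h2 := Nat.ceil_lt_add_one hr.le
  rw [sfloor, Nat.cast_sub h1]; push_cast; linarith

/-- Together with `sfloor_lt`, this puts the exponent `r - sfloor r` in (0, 1], the range in which
the product lemma works; an integer `r` gives exponent 1. -/
lemma le_sfloor_add_one {r : ℝ} (hr : 0 < r) : r ≤ sfloor r + 1 := by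
  have h1 : 1 ≤ ⌈r⌉₊ := Nat.one_le_iff_ne_zero.2 (Nat.ceil_pos.2 hr).ne'
  have h2 := Nat.le_ceil r
  rw [sfloor, Nat.cast_sub h1]; push_cast; linarith

lemma IsHolder.holderRec {r L : ℝ} {g : Cov d → ℝ} (h : IsHolder r L g) :
    HolderRec (r - sfloor r) L (sfloor r) g :=
  .of_partialD h.contDiffOn h.bounded h.holder

lemma HolderRec.isHolder {r L : ℝ} (hr : 0 < r) {g : Cov d → ℝ}
    (h : HolderRec (r - sfloor r) L (sfloor r) g) : IsHolder r L g := by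
  have hs : 0 < r - sfloor r := by linarith [sfloor_lt hr]
  exact ⟨h.contDiffOn hs, fun m hm j x hx => h.partialD_bound hs hm j hx,
    fun j x hx y hy => h.partialD_holder hs j hx hy⟩

end

/-! ### Taylor polynomials -/

section
variable {d : ℕ}

/-- The homogeneous part of order `m` of the Taylor expansion of `f` at `x₀`, through
`m H_m f = ∑ᵢ (xᵢ - x₀ᵢ) H_{m-1} (∂ᵢ f)`. -/
def taylorTerm (x₀ : Cov d) : ℕ → (Cov d → ℝ) → Cov d → ℝ
  | 0, f, _ => f x₀
  | m + 1, f, x => (1 / ((m : ℝ) + 1)) * ∑ i, (x i - x₀ i) * taylorTerm x₀ m (pd i f) x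

/-- The Taylor polynomial of `f` of order `N` at `x₀`. -/
def taylorPoly (x₀ : Cov d) (N : ℕ) (f : Cov d → ℝ) (x : Cov d) : ℝ :=
  ∑ m ∈ Finset.range (N + 1), taylorTerm x₀ m f x

lemma taylorTerm_congr {x₀ : Cov d} (hx₀ : x₀ ∈ unitCube d) (m : ℕ) {f g : Cov d → ℝ}
    (h : Set.EqOn f g (unitCube d)) : taylorTerm x₀ m f = taylorTerm x₀ m g := by
  induction m generalizing f g with
  | zero => funext x; exact h hx₀
  | succ m ih =>
    funext x
    simp only [taylorTerm]
    congr 1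
    exact Finset.sum_congr rfl fun i _ => by rw [ih (pd_congr h i)]

lemma contDiff_taylorTerm (x₀ : Cov d) (m : ℕ) (f : Cov d → ℝ) (n : WithTop ℕ∞) :
    ContDiff ℝ n (taylorTerm x₀ m f) := by
  induction m generalizing f with
  | zero => exact contDiff_const
  | succ m ih =>
    refine contDiff_const.mul (ContDiff.sum fun i _ => ContDiff.mul ?_ (ih _))
    exact (EuclideanSpace.proj i : Cov d →L[ℝ] ℝ).contDiff.sub contDiff_const

lemma continuous_taylorPoly (x₀ : Cov d) (N : ℕ) (f : Cov d → ℝ) :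
    Continuous (taylorPoly x₀ N f) :=
  continuous_finsetSum _ fun m _ => (contDiff_taylorTerm x₀ m f 0).continuous

lemma differentiableOn_taylorTerm (x₀ : Cov d) (m : ℕ) (f : Cov d → ℝ) :
    DifferentiableOn ℝ (taylorTerm x₀ m f) (unitCube d) :=
  ((contDiff_taylorTerm x₀ m f 1).differentiable (by simp)).differentiableOn

lemma pd_sum {ι : Type*} (S : Finset ι) {F : ι → Cov d → ℝ}
    (hF : ∀ i ∈ S, DifferentiableOn ℝ (F i) (unitCube d)) (j : Fin d) :
    Set.EqOn (pd j fun x => ∑ i ∈ S, F i x) (fun x => ∑ i ∈ S, pd j (F i) x) (unitCube d) := by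
  intro x hx
  refine (pd_eq_of_hasFDerivWithinAt
    (HasFDerivWithinAt.fun_sum fun i hi => (hF i hi x hx).hasFDerivWithinAt) hx j).trans ?_
  simp [pd]

lemma differentiableOn_coord_sub (i : Fin d) (c : ℝ) :
    DifferentiableOn ℝ (fun x : Cov d => x i - c) (unitCube d) := fun x _ =>
  ((hasFDerivAt_coord i x).differentiableAt.sub_const c).differentiableWithinAt

/-- Differentiating the recursion by the product rule gives, by induction and symmetry of mixed
derivatives, the sum of (xᵢ - x₀ᵢ) H_m(∂ᵢ∂ⱼf) plus one copy of H_{m+1}(∂ⱼf). The sum is (m + 1)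
H_{m+1}(∂ⱼf) by the recursion again, and the prefactor 1/(m + 2) cancels the total. -/
lemma pd_taylorTerm_succ {x₀ : Cov d} (hx₀ : x₀ ∈ unitCube d) (m : ℕ) {f : Cov d → ℝ}
    (hf : ContDiffOn ℝ (m + 1 : ℕ) f (unitCube d)) (j : Fin d) :
    Set.EqOn (pd j (taylorTerm x₀ (m + 1) f)) (taylorTerm x₀ m (pd j f)) (unitCube d) := by
  induction m generalizing f j with
  | zero =>
    intro x hx
    have h1 := pd_const_mul (f := fun x => ∑ i, (x i - x₀ i) * taylorTerm x₀ 0 (pd i f) x)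
      (DifferentiableOn.fun_sum fun i _ => (differentiableOn_coord_sub i _).mul
        (differentiableOn_taylorTerm x₀ 0 _)) (1 / (((0 : ℕ) : ℝ) + 1)) j hx
    refine h1.trans ?_
    simp only
    rw [pd_sum _ (fun i _ => (differentiableOn_coord_sub i (x₀ i)).fun_mul
      (differentiableOn_taylorTerm x₀ 0 (pd i f))) j hx]
    have h2 : ∀ i, pd j (fun x => (x i - x₀ i) * taylorTerm x₀ 0 (pd i f) x) x =
        if i = j then pd i f x₀ else 0 := fun i => by
      rw [pd_mul (differentiableOn_coord_sub i _) (differentiableOn_taylorTerm x₀ 0 _) j hx]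
      simp only
      rw [pd_coord j i _ hx]
      have h3 : pd j (taylorTerm x₀ 0 (pd i f)) x = 0 := pd_const (pd i f x₀) j hx
      rw [h3]
      simp [taylorTerm]
    simp only [h2]
    simp [taylorTerm]
  | succ m ih =>
    intro x hx
    have h1 := pd_const_mul (f := fun x => ∑ i, (x i - x₀ i) * taylorTerm x₀ (m + 1) (pd i f) x)
      (DifferentiableOn.fun_sum fun i _ => (differentiableOn_coord_sub i _).mul
        (differentiableOn_taylorTerm x₀ (m + 1) _)) (1 / (((m + 1 : ℕ) : ℝ) + 1)) j hx
    refine h1.trans ?_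
    simp only
    rw [pd_sum _ (fun i _ => (differentiableOn_coord_sub i (x₀ i)).fun_mul
      (differentiableOn_taylorTerm x₀ (m + 1) (pd i f))) j hx]
    have h2 : ∀ i, pd j (fun x => (x i - x₀ i) * taylorTerm x₀ (m + 1) (pd i f) x) x =
        (x i - x₀ i) * taylorTerm x₀ m (pd i (pd j f)) x +
        if i = j then taylorTerm x₀ (m + 1) (pd j f) x else 0 := fun i => by
      rw [pd_mul (differentiableOn_coord_sub i _) (differentiableOn_taylorTerm x₀ (m + 1) _) j hx]
      simp only
      rw [pd_coord j i _ hx, ih (contDiffOn_pd hf i) j hx]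
      have hc : ContDiffOn ℝ 2 f (unitCube d) := hf.of_le (by norm_cast; omega)
      rw [taylorTerm_congr hx₀ m (pd_comm hc j i)]
      split_ifs with hij
      · subst hij; ring
      · ring
    simp only [h2, Finset.sum_add_distrib]
    have h3 : ∑ i, (x i - x₀ i) * taylorTerm x₀ m (pd i (pd j f)) x =
        ((m : ℝ) + 1) * taylorTerm x₀ (m + 1) (pd j f) x := by
      simp only [taylorTerm]
      field_simp
    rw [h3]
    simp only [Finset.sum_ite_eq', Finset.mem_univ, if_true]
    have : (m : ℝ) + 1 + 1 ≠ 0 := by positivity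
    push_cast
    field_simp

lemma pd_taylorPoly_succ {x₀ : Cov d} (hx₀ : x₀ ∈ unitCube d) (N : ℕ) {f : Cov d → ℝ}
    (hf : ContDiffOn ℝ (N + 1 : ℕ) f (unitCube d)) (j : Fin d) :
    Set.EqOn (pd j (taylorPoly x₀ (N + 1) f)) (taylorPoly x₀ N (pd j f)) (unitCube d) := by
  intro x hx
  have h1 := pd_sum (Finset.range (N + 1 + 1)) (F := fun m => taylorTerm x₀ m f)
    (fun m _ => differentiableOn_taylorTerm x₀ m f) j hx
  refine h1.trans ?_
  simp only
  rw [Finset.sum_range_succ', taylorPoly]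
  have h0 : pd j (taylorTerm x₀ 0 f) x = 0 := pd_const (f x₀) j hx
  rw [h0, add_zero]
  refine Finset.sum_congr rfl fun m hm => ?_
  rw [Finset.mem_range] at hm
  exact pd_taylorTerm_succ hx₀ m (hf.of_le (by norm_cast)) j hx

lemma taylorPoly_self (x₀ : Cov d) (N : ℕ) (f : Cov d → ℝ) : taylorPoly x₀ N f x₀ = f x₀ := by
  rw [taylorPoly, Finset.sum_range_succ']
  simp [taylorTerm]

lemma differentiableOn_taylorPoly (x₀ : Cov d) (m : ℕ) (f : Cov d → ℝ) :
    DifferentiableOn ℝ (taylorPoly x₀ m f) (unitCube d) :=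
  DifferentiableOn.fun_sum fun m _ => differentiableOn_taylorTerm x₀ m f

/-- Induction on the order: the partial derivatives of the remainder are the remainders of the
partial derivatives, and the remainder vanishes at x₀. The mean value inequality on the part of the
cube within ‖x - x₀‖ of x₀ then adds one power of ‖x - x₀‖ and a factor `d`. -/
lemma HolderRec.taylor_remainder {s K : ℝ} (hs : 0 < s) {N : ℕ} {f : Cov d → ℝ}
    (hf : HolderRec s K N f) {x₀ x : Cov d} (hx₀ : x₀ ∈ unitCube d) (hx : x ∈ unitCube d) :
    |f x - taylorPoly x₀ N f x| ≤ d ^ N * K * ‖x - x₀‖ ^ (N + s) := by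
  induction N generalizing f x with
  | zero => simpa [taylorPoly, taylorTerm] using hf.2 x hx x₀ hx₀
  | succ N ih =>
    have hK := hf.nonneg
    set S : Set (Cov d) := unitCube d ∩ Metric.closedBall x₀ ‖x - x₀‖
    have hd : DifferentiableOn ℝ (fun x => f x - taylorPoly x₀ (N + 1) f x) (unitCube d) :=
      hf.2.1.sub (differentiableOn_taylorPoly _ _ _)
    have h1 := abs_sub_le_of_pd_bound (S := S) (f := fun x => f x - taylorPoly x₀ (N + 1) f x)
      (B := d ^ N * K * ‖x - x₀‖ ^ (N + s)) ((convex_unitCube d).inter (convex_closedBall _ _))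
      Set.inter_subset_left hd
      (fun z hz i => by
        rw [pd_sub hf.2.1 (differentiableOn_taylorPoly _ _ _) i hz.1]
        simp only
        rw [pd_taylorPoly_succ hx₀ N (hf.contDiffOn hs) i hz.1]
        refine (ih (hf.2.2 i) hz.1).trans ?_
        refine mul_le_mul_of_nonneg_left ?_ (by positivity)
        exact Real.rpow_le_rpow (norm_nonneg _) (by simpa [dist_eq_norm] using hz.2)
          (by positivity))
      (x := x₀) (y := x) ⟨hx₀, by simp⟩ ⟨hx, by simp [dist_eq_norm]⟩
    simp only [taylorPoly_self, sub_self, sub_zero] at h1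
    refine h1.trans (le_of_eq ?_)
    have h2 : ‖x - x₀‖ ^ ((N + 1 : ℕ) + s) = ‖x - x₀‖ ^ (N + s) * ‖x - x₀‖ := by
      rw [show (((N + 1 : ℕ) : ℝ) + s) = (N + s) + 1 by push_cast; ring,
        Real.rpow_add' (norm_nonneg _) (by positivity), Real.rpow_one]
    rw [h2]; ring

/-! ### Rescaling -/

lemma fromUnit_sub (x₀ : Cov d) (h : ℝ) (v w : Cov d) :
    fromUnit x₀ h v - fromUnit x₀ h w = h • (v - w) := by
  ext j; simp [fromUnit]; ring

lemma fromUnit_toUnit (x₀ : Cov d) {h : ℝ} (hh : h ≠ 0) (v : Cov d) :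
    fromUnit x₀ h (toUnit x₀ h v) = v := by
  ext j; simp [fromUnit, toUnit]; field_simp; ring

lemma toUnit_self_mem (x₀ : Cov d) (h : ℝ) : toUnit x₀ h x₀ ∈ unitCube d := by
  intro j; simp [toUnit]; norm_num

lemma hasFDerivAt_fromUnit (x₀ : Cov d) (h : ℝ) (v : Cov d) :
    HasFDerivAt (fromUnit x₀ h) (h • ContinuousLinearMap.id ℝ (Cov d)) v := by
  have h1 : fromUnit x₀ h = fun w : Cov d => h • w + fromUnit x₀ h 0 := by
    funext w
    have := fromUnit_sub x₀ h w 0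
    rw [sub_zero] at this
    rw [← this]; abel
  rw [h1]
  exact ((hasFDerivAt_id v).const_smul h).add_const _

lemma pd_comp_fromUnit {x₀ : Cov d} {h : ℝ} (hm : Set.MapsTo (fromUnit x₀ h) (unitCube d)
    (unitCube d)) {G : Cov d → ℝ} (hG : DifferentiableOn ℝ G (unitCube d)) (i : Fin d) :
    Set.EqOn (pd i fun v => G (fromUnit x₀ h v)) (fun v => h * pd i G (fromUnit x₀ h v))
      (unitCube d) := by
  intro v hv
  refine (pd_eq_of_hasFDerivWithinAt (((hG _ (hm hv)).hasFDerivWithinAt).comp v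
    (hasFDerivAt_fromUnit x₀ h v).hasFDerivWithinAt hm) hv i).trans ?_
  simp [pd]

lemma differentiableOn_comp_fromUnit {x₀ : Cov d} {h : ℝ}
    (hm : Set.MapsTo (fromUnit x₀ h) (unitCube d) (unitCube d)) {G : Cov d → ℝ}
    (hG : DifferentiableOn ℝ G (unitCube d)) :
    DifferentiableOn ℝ (fun v => G (fromUnit x₀ h v)) (unitCube d) := fun v hv =>
  (((hG _ (hm hv)).hasFDerivWithinAt).comp v
    (hasFDerivAt_fromUnit x₀ h v).hasFDerivWithinAt hm).differentiableWithinAt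

lemma norm_fromUnit_sub_le {x₀ : Cov d} {h : ℝ} (hh : 0 < h) {v : Cov d} (hv : v ∈ unitCube d) :
    ‖fromUnit x₀ h v - x₀‖ ≤ h * Real.sqrt d := by
  have h1 := fromUnit_sub x₀ h v (toUnit x₀ h x₀)
  rw [fromUnit_toUnit x₀ hh.ne'] at h1
  rw [h1, norm_smul, Real.norm_of_nonneg hh.le]
  exact mul_le_mul_of_nonneg_left (norm_sub_le_of_mem_unitCube hv (toUnit_self_mem _ _)) hh.le

/-- Each differentiation of the rescaled remainder yields a factor `h` times the rescaled remainder
of a partial derivative of `f`. Lower derivatives get their missing powers of `h` from the Taylor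
bound, and the top one gets h^s from its Hölder condition. Hence the whole Hölder norm is of order
h^(N+s). -/
lemma HolderRec.exists_scaled_remainder (d : ℕ) {s : ℝ} (hs0 : 0 < s) (N : ℕ) :
    ∃ C : ℝ, 0 ≤ C ∧ ∀ (K h : ℝ) (x₀ : Cov d) (f : Cov d → ℝ), 0 < h → x₀ ∈ unitCube d →
      Set.MapsTo (fromUnit x₀ h) (unitCube d) (unitCube d) → HolderRec s K N f →
      HolderRec s (C * K * h ^ (N + s)) N
        (fun v => f (fromUnit x₀ h v) - taylorPoly x₀ N f (fromUnit x₀ h v)) := by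
  have hq := Real.sqrt_nonneg d
  have hbd : ∀ (N : ℕ) (K h : ℝ) (x₀ : Cov d) (f : Cov d → ℝ), 0 < h → x₀ ∈ unitCube d →
      Set.MapsTo (fromUnit x₀ h) (unitCube d) (unitCube d) → HolderRec s K N f →
      ∀ v ∈ unitCube d, |f (fromUnit x₀ h v) - taylorPoly x₀ N f (fromUnit x₀ h v)| ≤
        (d ^ N * Real.sqrt d ^ (N + s)) * K * h ^ (N + s) := by
    intro N K h x₀ f hh hx₀ hm hf v hv
    have hK := hf.nonneg
    refine (hf.taylor_remainder hs0 hx₀ (hm hv)).trans ?_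
    calc _ ≤ (d : ℝ) ^ N * K * (h * Real.sqrt d) ^ (N + s) :=
          mul_le_mul_of_nonneg_left (Real.rpow_le_rpow (norm_nonneg _)
            (norm_fromUnit_sub_le hh hv) (by positivity)) (by positivity)
      _ = _ := by rw [Real.mul_rpow hh.le hq]; ring
  induction N with
  | zero =>
    refine ⟨Real.sqrt d ^ s + 1, by positivity, fun K h x₀ f hh hx₀ hm hf => ?_⟩
    have hK := hf.nonneg
    have hp : 0 ≤ K * h ^ (((0 : ℕ) : ℝ) + s) := by positivity
    refine ⟨fun v hv => (hbd 0 K h x₀ f hh hx₀ hm hf v hv).trans ?_, fun v hv w hw => ?_⟩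
    · simp only [pow_zero, one_mul, Nat.cast_zero, zero_add] at hp ⊢
      nlinarith
    · simp only [taylorPoly, zero_add, Finset.range_one, Finset.sum_singleton, taylorTerm,
        sub_sub_sub_cancel_right, Nat.cast_zero]
      refine (hf.2 _ (hm hv) _ (hm hw)).trans ?_
      rw [fromUnit_sub, norm_smul, Real.norm_of_nonneg hh.le,
        Real.mul_rpow hh.le (norm_nonneg _)]
      have h3 : 0 ≤ Real.sqrt d ^ s := by positivity
      have h4 : 0 ≤ K * h ^ s * ‖v - w‖ ^ s := by positivity
      nlinarith
  | succ N ih =>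
    obtain ⟨C, hC, ih⟩ := ih
    refine ⟨C + d ^ (N + 1) * Real.sqrt d ^ ((N + 1 : ℕ) + s), by positivity,
      fun K h x₀ f hh hx₀ hm hf => ?_⟩
    have hK := hf.nonneg
    refine ⟨fun v hv => (hbd (N + 1) K h x₀ f hh hx₀ hm hf v hv).trans ?_, ?_, fun i => ?_⟩
    · have : 0 ≤ C * K * h ^ (((N + 1 : ℕ) : ℝ) + s) := by positivity
      linarith
    · exact (differentiableOn_comp_fromUnit hm hf.2.1).sub
        (differentiableOn_comp_fromUnit hm (differentiableOn_taylorPoly _ _ _))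
    · have h1 := (ih K h x₀ (pd i f) hh hx₀ hm (hf.2.2 i)).const_mul h
      refine (h1.mono ?_).congr fun v hv => ?_
      · rw [abs_of_pos hh]
        have h2 : h ^ (((N + 1 : ℕ) : ℝ) + s) = h ^ (N + s) * h := by
          rw [show (((N + 1 : ℕ) : ℝ) + s) = (N + s) + 1 by push_cast; ring,
            Real.rpow_add hh, Real.rpow_one]
        rw [h2]
        have : 0 ≤ d ^ (N + 1) * Real.sqrt d ^ (((N + 1 : ℕ) : ℝ) + s) * K * (h ^ (N + s) * h) := by
          positivity
        linarith
      · rw [pd_sub (differentiableOn_comp_fromUnit hm hf.2.1)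
          (differentiableOn_comp_fromUnit hm (differentiableOn_taylorPoly _ _ _)) i hv]
        simp only
        rw [pd_comp_fromUnit hm hf.2.1 i hv, pd_comp_fromUnit hm (differentiableOn_taylorPoly _ _ _)
          i hv]
        simp only
        rw [pd_taylorPoly_succ hx₀ N (hf.contDiffOn hs0) i (hm hv), mul_sub]

/-! ### Functions in every Hölder class -/

/-- Membership in every Hölder class. -/
def AllHolder (f : Cov d → ℝ) : Prop :=
  ∀ (N : ℕ) (s : ℝ), 0 < s → s ≤ 1 → ∃ K, HolderRec s K N f

namespace AllHolder

variable {f g : Cov d → ℝ}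

lemma const (c : ℝ) : AllHolder (fun _ : Cov d => c) := fun N s _ _ => ⟨_, .const s N c⟩

lemma add (hf : AllHolder f) (hg : AllHolder g) : AllHolder (fun x => f x + g x) :=
  fun N s h0 h1 => by
    obtain ⟨K, hK⟩ := hf N s h0 h1
    obtain ⟨L, hL⟩ := hg N s h0 h1
    exact ⟨_, hK.add hL⟩

lemma mul (hf : AllHolder f) (hg : AllHolder g) : AllHolder (fun x => f x * g x) :=
  fun N s h0 h1 => by
    obtain ⟨K, hK⟩ := hf N s h0 h1
    obtain ⟨L, hL⟩ := hg N s h0 h1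
    obtain ⟨C, -, hC⟩ := HolderRec.exists_mul d h0 h1 N
    exact ⟨_, hC _ _ _ _ hK hL⟩

lemma sum {ι : Type*} (S : Finset ι) {F : ι → Cov d → ℝ} (h : ∀ i ∈ S, AllHolder (F i)) :
    AllHolder (fun x => ∑ i ∈ S, F i x) := by
  classical
  induction S using Finset.induction_on with
  | empty => simpa using const 0
  | insert a S ha ih =>
    simp only [Finset.sum_insert ha]
    exact (h a (by simp)).add (ih fun i hi => h i (by simp [hi]))

lemma prod {ι : Type*} (S : Finset ι) {F : ι → Cov d → ℝ} (h : ∀ i ∈ S, AllHolder (F i)) :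
    AllHolder (fun x => ∏ i ∈ S, F i x) := by
  classical
  induction S using Finset.induction_on with
  | empty => simpa using const 1
  | insert a S ha ih =>
    simp only [Finset.prod_insert ha]
    exact (h a (by simp)).mul (ih fun i hi => h i (by simp [hi]))

lemma pow (hf : AllHolder f) (n : ℕ) : AllHolder (fun x => f x ^ n) := by
  induction n with
  | zero => simpa using const 1
  | succ n ih => simpa only [pow_succ] using ih.mul hf

lemma coord_sub (i : Fin d) (c : ℝ) : AllHolder (fun x : Cov d => x i - c) := by
  intro N s h0 h1
  have key : HolderRec s (1 + |c| + 1) 1 (fun x : Cov d => x i - c) := by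
    refine ⟨fun x hx => ?_, differentiableOn_coord_sub i c, fun j => ?_⟩
    · have := hx i
      refine (abs_sub _ _).trans ?_
      rw [abs_of_nonneg this.1]; linarith [this.2]
    · refine ((HolderRec.const s 0 (if i = j then 1 else 0)).mono ?_).congr (pd_coord j i c).symm
      have := abs_nonneg c
      split_ifs <;> simp <;> linarith
  -- At order zero the Hölder bound is read off from order one; at higher orders the partial
  -- derivatives are constants.
  cases N with
  | zero => exact ⟨_, key.lower h0 h1⟩
  | succ N =>
    refine ⟨1 + |c| + 1, key.1, key.2.1, fun j => ?_⟩
    refine ((HolderRec.const s N (if i = j then 1 else 0)).mono ?_).congr (pd_coord j i c).symm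
    have := abs_nonneg c
    split_ifs <;> simp <;> linarith

lemma coord (i : Fin d) : AllHolder (fun x : Cov d => x i) := by
  simpa using coord_sub i 0

lemma rho (N : ℕ) (m : MIdx d N) : AllHolder (fun v : Cov d => rho N v m) :=
  prod _ fun j _ => sum _ fun l _ => (const _).mul ((coord j).pow l)

lemma exists_bound (hf : AllHolder f) : ∃ K, 0 ≤ K ∧ ∀ v ∈ unitCube d, |f v| ≤ K := by
  obtain ⟨K, hK⟩ := hf 0 1 one_pos le_rfl
  exact ⟨K, hK.nonneg, hK.bound⟩

end AllHolder

/-! ### Rescaled Taylor polynomials -/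

lemma HolderRec.exists_sum (d : ℕ) {ι : Type*} (s K : ℝ) (N : ℕ) (S : Finset ι)
    {F : ι → Cov d → ℝ} (h : ∀ i ∈ S, HolderRec s K N (F i)) :
    HolderRec s (S.card * K) N (fun x => ∑ i ∈ S, F i x) := by
  classical
  induction S using Finset.induction_on with
  | empty => simpa using HolderRec.const s N 0
  | insert a S ha ih =>
    simp only [Finset.sum_insert ha]
    refine ((h a (by simp)).add (ih fun i hi => h i (by simp [hi]))).mono (le_of_eq ?_)
    rw [Finset.card_insert_of_notMem ha]; push_cast; ring

lemma fromUnit_coord_sub (x₀ : Cov d) (h : ℝ) (v : Cov d) (i : Fin d) :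
    fromUnit x₀ h v i - x₀ i = h * (v i - 1 / 2) := by
  simp [fromUnit]

/-- The term is a polynomial in h (vᵢ - 1/2) whose coefficients are derivatives of `f` at x₀. So its
Hölder norm of any order `R`, which may exceed the smoothness of `f`, is bounded for `h ≤ H`. -/
lemma HolderRec.exists_scaled_taylorTerm (d : ℕ) {s t H : ℝ} (ht0 : 0 < t) (ht1 : t ≤ 1)
    (hH : 0 ≤ H) (m R N : ℕ) (hm : m ≤ N) :
    ∃ C : ℝ, 0 ≤ C ∧ ∀ (K h : ℝ) (x₀ : Cov d) (f : Cov d → ℝ), 0 < h → h ≤ H → x₀ ∈ unitCube d →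
      HolderRec s K N f →
      HolderRec t (C * K) R (fun v => taylorTerm x₀ m f (fromUnit x₀ h v)) := by
  induction m generalizing N with
  | zero =>
    refine ⟨1, zero_le_one, fun K h x₀ f _ _ hx₀ hf => (HolderRec.const t R (f x₀)).mono ?_⟩
    simpa using hf.bound x₀ hx₀
  | succ m ih =>
    obtain ⟨N, rfl⟩ : ∃ N', N = N' + 1 := ⟨N - 1, by omega⟩
    obtain ⟨C, hC, ih⟩ := ih N (by omega)
    obtain ⟨D, hD, hmul⟩ := HolderRec.exists_mul d ht0 ht1 R
    choose k hk using fun i : Fin d => AllHolder.coord_sub i (1 / 2) R t ht0 ht1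
    set k' := ∑ i, |k i|
    have hk'0 : 0 ≤ k' := Finset.sum_nonneg fun i _ => abs_nonneg _
    have hk' : ∀ i, k i ≤ k' := fun i => (le_abs_self _).trans
      (Finset.single_le_sum (f := fun i => |k i|) (fun i _ => abs_nonneg _) (Finset.mem_univ i))
    refine ⟨|1 / ((m : ℝ) + 1)| * (d * (D * (H * k' * C))), by positivity,
      fun K h x₀ f h0 hh hx₀ hf => ?_⟩
    have hK := hf.nonneg
    have h1 : ∀ i ∈ Finset.univ, HolderRec t (D * ((H * k') * (C * K))) R
        (fun v => (fromUnit x₀ h v i - x₀ i) * taylorTerm x₀ m (pd i f) (fromUnit x₀ h v)) := by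
      intro i _
      simp only [fromUnit_coord_sub]
      refine hmul _ _ _ _ (((hk i).const_mul h).mono ?_) (ih K h x₀ (pd i f) h0 hh hx₀ (hf.2.2 i))
      rw [abs_of_pos h0]
      exact mul_le_mul hh (hk' i) (hk i).nonneg hH
    have h2 := (HolderRec.exists_sum d t _ R Finset.univ h1).const_mul (1 / ((m : ℝ) + 1))
    refine h2.mono (le_of_eq ?_)
    simp only [Finset.card_univ, Fintype.card_fin]
    ring

lemma HolderRec.exists_scaled_taylorPoly (d : ℕ) {s t H : ℝ} (ht0 : 0 < t) (ht1 : t ≤ 1)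
    (hH : 0 ≤ H) (R N : ℕ) :
    ∃ C : ℝ, 0 ≤ C ∧ ∀ (K h : ℝ) (x₀ : Cov d) (f : Cov d → ℝ), 0 < h → h ≤ H → x₀ ∈ unitCube d →
      HolderRec s K N f →
      HolderRec t (C * K) R (fun v => taylorPoly x₀ N f (fromUnit x₀ h v)) := by
  have h1 : ∀ m : ℕ, ∃ C : ℝ, 0 ≤ C ∧ ∀ (K h : ℝ) (x₀ : Cov d) (f : Cov d → ℝ), m ≤ N → 0 < h →
      h ≤ H → x₀ ∈ unitCube d → HolderRec s K N f →
      HolderRec t (C * K) R (fun v => taylorTerm x₀ m f (fromUnit x₀ h v)) := fun m => by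
    by_cases hm : m ≤ N
    · obtain ⟨C, hC, h⟩ := HolderRec.exists_scaled_taylorTerm d (s := s) ht0 ht1 hH m R N hm
      exact ⟨C, hC, fun K h' x₀ f _ => h K h' x₀ f⟩
    · exact ⟨0, le_rfl, fun _ _ _ _ h => absurd h hm⟩
  choose C hC0 hC using h1
  have hle : ∀ m ∈ Finset.range (N + 1), C m ≤ ∑ m ∈ Finset.range (N + 1), C m := fun m hm =>
    Finset.single_le_sum (fun i _ => hC0 i) hm
  have hS : 0 ≤ ∑ m ∈ Finset.range (N + 1), C m := Finset.sum_nonneg fun i _ => hC0 i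
  refine ⟨(N + 1) * ∑ m ∈ Finset.range (N + 1), C m, by positivity,
    fun K h x₀ f h0 hh hx₀ hf => ?_⟩
  have hK := hf.nonneg
  refine (HolderRec.exists_sum d t ((∑ m ∈ Finset.range (N + 1), C m) * K) R
    (Finset.range (N + 1)) fun m hm => ((hC m) K h x₀ f (by simpa [Nat.lt_succ_iff] using hm)
      h0 hh hx₀ hf).mono (mul_le_mul_of_nonneg_right (hle m hm) hK)).mono (le_of_eq ?_)
  simp; ring

/-! ### Legendre polynomials span -/

/-- The Legendre polynomial of degree `a` has a nonzero leading coefficient, so t^a is solved for in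
terms of it and lower powers, which are expanded by strong induction. -/
lemma exists_pow_eq_sum_legendre (a : ℕ) :
    ∃ c : ℕ → ℝ, ∀ t : ℝ, t ^ a = ∑ l ∈ Finset.range (a + 1), c l * legendre l t := by
  induction a using Nat.strong_induction_on with
  | _ a ih =>
    choose! c hc using ih
    set lc : ℕ → ℝ := fun l =>
      (-1 : ℝ) ^ (l + a) * Real.sqrt (2 * a + 1) * (a.choose l) * ((a + l).choose l) with hlc
    have hne : lc a ≠ 0 := by
      have h1 : (0 : ℝ) < Real.sqrt (2 * a + 1) := Real.sqrt_pos.2 (by positivity)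
      have h2 : (0 : ℝ) < ((a + a).choose a : ℝ) := by
        exact_mod_cast Nat.choose_pos (Nat.le_add_left a a)
      simp only [hlc, Nat.choose_self]
      have h3 : (-1 : ℝ) ^ (a + a) = 1 := by rw [← two_mul, pow_mul]; simp
      rw [h3]; positivity
    have hleg : ∀ t, legendre a t = (∑ l ∈ Finset.range a, lc l * t ^ l) + lc a * t ^ a := fun t => by
      rw [legendre, Finset.sum_range_succ]
    -- extend each lower expansion to the full range
    have hext : ∀ l < a, ∀ t : ℝ, t ^ l =
        ∑ i ∈ Finset.range a, (if i ≤ l then c l i else 0) * legendre i t := fun l hl t => by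
      rw [hc l hl t]
      have : Finset.range (l + 1) = (Finset.range a).filter (· ≤ l) := by
        ext i; simp; omega
      rw [this, Finset.sum_filter]
      exact Finset.sum_congr rfl fun i _ => by split_ifs <;> simp
    refine ⟨fun i => if i = a then 1 / lc a else
      -(1 / lc a) * ∑ l ∈ Finset.range a, lc l * (if i ≤ l then c l i else 0), fun t => ?_⟩
    rw [Finset.sum_range_succ]
    have h1 : ∑ i ∈ Finset.range a, (if i = a then 1 / lc a else
        -(1 / lc a) * ∑ l ∈ Finset.range a, lc l * (if i ≤ l then c l i else 0)) * legendre i t =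
        -(1 / lc a) * ∑ l ∈ Finset.range a, lc l * t ^ l := by
      rw [Finset.mul_sum]
      rw [Finset.sum_congr rfl (g := fun i => ∑ l ∈ Finset.range a, -(1 / lc a) * (lc l *
        ((if i ≤ l then c l i else 0) * legendre i t))) fun i hi => by
          rw [if_neg (by simp at hi; omega), mul_assoc, Finset.sum_mul, Finset.mul_sum]
          exact Finset.sum_congr rfl fun l _ => by ring, Finset.sum_comm]
      refine Finset.sum_congr rfl fun l hl => ?_
      rw [hext l (by simpa using hl) t, Finset.mul_sum, Finset.mul_sum]
    rw [h1, hleg]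
    simp only [if_true]
    field_simp
    ring

/-- The span of the Legendre tensor products of total order at most `N`. -/
def rhoSpan (d N : ℕ) : Submodule ℝ (Cov d → ℝ) :=
  Submodule.span ℝ (Set.range fun (m : MIdx d N) (v : Cov d) => rho N v m)

/-- Each factor expands in Legendre polynomials of degree at most its own exponent, so the product
only involves tensor products of total degree at most `N`. -/
lemma monomial_mem_rhoSpan {N : ℕ} (a : Fin d → ℕ) (ha : ∑ j, a j ≤ N) :
    (fun v : Cov d => ∏ j, v j ^ a j) ∈ rhoSpan d N := by
  choose c hc using exists_pow_eq_sum_legendre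
  have h1 : (fun v : Cov d => ∏ j, v j ^ a j) = ∑ l ∈ Fintype.piFinset fun j =>
      Finset.range (a j + 1), (∏ j, c (a j) (l j)) • fun v : Cov d => ∏ j, legendre (l j) (v j) := by
    funext v
    simp only [hc, Finset.prod_univ_sum, Finset.sum_apply, Pi.smul_apply, smul_eq_mul,
      Finset.prod_mul_distrib]
  rw [h1]
  refine Submodule.sum_mem _ fun l hl => Submodule.smul_mem _ _ (Submodule.subset_span ?_)
  have hl' : ∀ j, l j ≤ a j := fun j => by
    have := Fintype.mem_piFinset.1 hl j
    simpa [Nat.lt_succ_iff] using this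
  have hsum : ∑ j, l j ≤ N := (Finset.sum_le_sum fun j _ => hl' j).trans ha
  refine ⟨⟨fun j => ⟨l j, Nat.lt_succ_of_le ((Finset.single_le_sum (f := l)
    (fun _ _ => Nat.zero_le _) (Finset.mem_univ j)).trans hsum)⟩, hsum⟩, ?_⟩
  funext v
  simp [rho]

/-- The span of the monomials of total degree at most `N`. -/
def monoSpan (d N : ℕ) : Submodule ℝ (Cov d → ℝ) :=
  Submodule.span ℝ {f | ∃ a : Fin d → ℕ, ∑ j, a j ≤ N ∧ f = fun v => ∏ j, v j ^ a j}

lemma monoSpan_le_rhoSpan (d N : ℕ) : monoSpan d N ≤ rhoSpan d N := by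
  refine Submodule.span_le.2 ?_
  rintro _ ⟨a, ha, rfl⟩
  exact monomial_mem_rhoSpan a ha

lemma monoSpan_mono {M N : ℕ} (h : M ≤ N) : monoSpan d M ≤ monoSpan d N := by
  refine Submodule.span_mono ?_
  rintro _ ⟨a, ha, rfl⟩
  exact ⟨a, ha.trans h, rfl⟩

lemma const_mem_monoSpan (N : ℕ) (c : ℝ) : (fun _ : Cov d => c) ∈ monoSpan d N := by
  have h : (fun _ : Cov d => (1 : ℝ)) ∈ monoSpan d N :=
    Submodule.subset_span ⟨0, by simp, by simp⟩
  have := (monoSpan d N).smul_mem c h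
  convert this using 1
  funext x; simp

lemma coord_mul_mem_monoSpan {N : ℕ} {f : Cov d → ℝ} (hf : f ∈ monoSpan d N) (i : Fin d) :
    (fun v => v i * f v) ∈ monoSpan d (N + 1) := by
  induction hf using Submodule.span_induction with
  | mem f hf =>
    obtain ⟨a, ha, rfl⟩ := hf
    refine Submodule.subset_span ⟨a + Pi.single i 1, ?_, ?_⟩
    · have : ∑ j, (Pi.single i 1 : Fin d → ℕ) j = 1 := Fintype.sum_pi_single' i 1
      simp only [Pi.add_apply, Finset.sum_add_distrib, this]; omega
    · funext v
      simp only [Pi.add_apply, pow_add, Finset.prod_mul_distrib]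
      have h1 : ∏ j, v j ^ (Pi.single i 1 : Fin d → ℕ) j = v i :=
        (Finset.prod_eq_single i (fun j _ hj => by simp [hj]) (by simp)).trans (by simp)
      rw [h1, mul_comm]
  | zero =>
    convert (monoSpan d (N + 1)).zero_mem using 1
    funext v; simp
  | add f g _ _ hf hg =>
    convert Submodule.add_mem _ hf hg using 1
    funext v; simp [mul_add]
  | smul c f _ hf =>
    convert Submodule.smul_mem _ c hf using 1
    funext v; simp; ring

lemma taylorTerm_fromUnit_mem_monoSpan (x₀ : Cov d) (h : ℝ) (m : ℕ) (f : Cov d → ℝ) :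
    (fun v => taylorTerm x₀ m f (fromUnit x₀ h v)) ∈ monoSpan d m := by
  induction m generalizing f with
  | zero => exact const_mem_monoSpan 0 (f x₀)
  | succ m ih =>
    have h1 : (fun v => taylorTerm x₀ (m + 1) f (fromUnit x₀ h v)) = (1 / ((m : ℝ) + 1)) •
        ∑ i, (h • (fun v : Cov d => v i * taylorTerm x₀ m (pd i f) (fromUnit x₀ h v)) +
          (-(h / 2)) • fun v => taylorTerm x₀ m (pd i f) (fromUnit x₀ h v)) := by
      funext v
      simp only [taylorTerm, fromUnit_coord_sub, Pi.smul_apply, Finset.sum_apply, Pi.add_apply,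
        smul_eq_mul]
      congr 1
      exact Finset.sum_congr rfl fun i _ => by ring
    rw [h1]
    refine Submodule.smul_mem _ _ (Submodule.sum_mem _ fun i _ => Submodule.add_mem _ ?_ ?_)
    · exact Submodule.smul_mem _ _ (coord_mul_mem_monoSpan (ih _) i)
    · exact Submodule.smul_mem _ _ (monoSpan_mono (Nat.le_succ m) (ih _))

/-- This supplies the vector θ at which the estimating equation R̂ - Q̂θ is evaluated. -/
lemma exists_taylorPoly_eq_rhoh (x₀ : Cov d) {h : ℝ} (hh : h ≠ 0) (N : ℕ) (f : Cov d → ℝ) :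
    ∃ θ : MIdx d N → ℝ, ∀ x, taylorPoly x₀ N f x = rhoh N x₀ h x ⬝ᵥ θ := by
  have h1 : (fun v => taylorPoly x₀ N f (fromUnit x₀ h v)) ∈ rhoSpan d N := by
    refine monoSpan_le_rhoSpan d N ?_
    have : (fun v => taylorPoly x₀ N f (fromUnit x₀ h v)) = ∑ m ∈ Finset.range (N + 1),
        fun v => taylorTerm x₀ m f (fromUnit x₀ h v) := by
      funext v; simp [taylorPoly]
    rw [this]
    exact Submodule.sum_mem _ fun m hm => monoSpan_mono (by simpa [Nat.lt_succ_iff] using hm)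
      (taylorTerm_fromUnit_mem_monoSpan x₀ h m f)
  obtain ⟨θ, hθ⟩ := (Submodule.mem_span_range_iff_exists_fun ℝ).1 h1
  refine ⟨θ, fun x => ?_⟩
  have h2 := congrFun hθ (toUnit x₀ h x)
  simp only [fromUnit_toUnit x₀ hh] at h2
  rw [← h2]
  simp [dotProduct, rhoh, mul_comm]

end

/-! ### The `L₂` norm -/

section
variable {d : ℕ} {μ : Measure (Cov d)} {f g : Cov d → ℝ}

lemma l2norm_nonneg (μ : Measure (Cov d)) (f : Cov d → ℝ) : 0 ≤ l2norm μ f := Real.sqrt_nonneg _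

lemma l2norm_sq (μ : Measure (Cov d)) (f : Cov d → ℝ) : l2norm μ f ^ 2 = ∫ v, f v ^ 2 ∂μ :=
  Real.sq_sqrt (integral_nonneg fun _ => sq_nonneg _)

lemma l2norm_eq_toReal_eLpNorm (hf : MemLp f 2 μ) : l2norm μ f = (eLpNorm f 2 μ).toReal := by
  rw [hf.eLpNorm_eq_integral_rpow_norm (by norm_num) (by norm_num), ENNReal.toReal_ofReal
    (by positivity), l2norm, Real.sqrt_eq_rpow]
  norm_num

lemma l2norm_add_le (hf : MemLp f 2 μ) (hg : MemLp g 2 μ) :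
    l2norm μ (fun v => f v + g v) ≤ l2norm μ f + l2norm μ g := by
  rw [l2norm_eq_toReal_eLpNorm hf, l2norm_eq_toReal_eLpNorm hg,
    ← ENNReal.toReal_add hf.2.ne hg.2.ne]
  have h := l2norm_eq_toReal_eLpNorm (hf.add hg)
  change l2norm μ (f + g) ≤ _
  rw [h]
  exact ENNReal.toReal_mono (ENNReal.add_ne_top.2 ⟨hf.2.ne, hg.2.ne⟩)
    (eLpNorm_add_le hf.1 hg.1 (by norm_num))

lemma l2norm_const_mul (c : ℝ) (f : Cov d → ℝ) :
    l2norm μ (fun v => c * f v) = |c| * l2norm μ f := by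
  simp only [l2norm, mul_pow, integral_const_mul]
  rw [Real.sqrt_mul (sq_nonneg c), Real.sqrt_sq_eq_abs]

lemma l2norm_mono (hg : MemLp g 2 μ) (h : ∀ᵐ v ∂μ, |f v| ≤ |g v|) : l2norm μ f ≤ l2norm μ g := by
  refine Real.sqrt_le_sqrt (integral_mono_of_nonneg (.of_forall fun _ => sq_nonneg _)
    hg.integrable_sq ?_)
  filter_upwards [h] with v hv using sq_le_sq.2 hv

lemma l2norm_le_of_bound [IsFiniteMeasure μ] {B : ℝ} (hB : 0 ≤ B) (h : ∀ᵐ v ∂μ, |f v| ≤ B) :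
    l2norm μ f ≤ B * Real.sqrt (μ.real Set.univ) := by
  have h1 := l2norm_mono (f := f) (memLp_const B) (by simpa [abs_of_nonneg hB] using h)
  refine h1.trans (le_of_eq ?_)
  simp [l2norm, Real.sqrt_sq hB, mul_comm]

lemma integrable_mul_of_memLp (hf : MemLp f 2 μ) (hg : MemLp g 2 μ) :
    Integrable (fun v => f v * g v) μ := hf.integrable_mul hg

lemma abs_integral_mul_le (hf : MemLp f 2 μ) (hg : MemLp g 2 μ) :
    |∫ v, f v * g v ∂μ| ≤ l2norm μ f * l2norm μ g := by
  have h := integral_mul_norm_le_Lp_mul_Lq (μ := μ) (f := f) (g := g) (p := 2) (q := 2)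
    (by constructor <;> norm_num) (by simpa using hf) (by simpa using hg)
  have h2 : |∫ v, f v * g v ∂μ| ≤ ∫ v, ‖f v‖ * ‖g v‖ ∂μ := by
    refine (norm_integral_le_integral_norm (fun v => f v * g v)).trans (le_of_eq ?_)
    simp only [norm_mul]
  refine h2.trans (h.trans (le_of_eq ?_))
  simp only [l2norm, Real.sqrt_eq_rpow]
  norm_num

end

/-! ### Weighted projections on the span of a basis -/

section
variable {d k : ℕ} {μ : Measure (Cov d)} {b : Cov d → Fin k → ℝ} {w f g : Cov d → ℝ}

/-- The Gram matrix of `b` with respect to the measure with density `w`. -/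
def wgram (b : Cov d → Fin k → ℝ) (μ : Measure (Cov d)) (w : Cov d → ℝ) :
    Matrix (Fin k) (Fin k) ℝ :=
  Matrix.of fun i j => ∫ v, w v * (b v i * b v j) ∂μ

/-- The vector of inner products with the basis. -/
def coefs (b : Cov d → Fin k → ℝ) (μ : Measure (Cov d)) (f : Cov d → ℝ) : Fin k → ℝ :=
  fun i => ∫ v, b v i * f v ∂μ

/-- `f ↦ bᵀ Ω_w⁻¹ ∫ b f dμ`, where `Ω_w` is the Gram matrix with weight `w`. -/
def wproj (b : Cov d → Fin k → ℝ) (μ : Measure (Cov d)) (w : Cov d → ℝ) (f : Cov d → ℝ)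
    (v : Cov d) : ℝ :=
  b v ⬝ᵥ ((wgram b μ w)⁻¹.mulVec (coefs b μ f))

lemma memLp_dotProduct (hb : ∀ i, MemLp (fun v => b v i) 2 μ) (u : Fin k → ℝ) :
    MemLp (fun v => b v ⬝ᵥ u) 2 μ := by
  simp only [dotProduct]
  exact memLp_finsetSum _ fun i _ => (hb i).mul_const (u i)

lemma memLp_wproj (hb : ∀ i, MemLp (fun v => b v i) 2 μ) (w f : Cov d → ℝ) :
    MemLp (wproj b μ w f) 2 μ :=
  memLp_dotProduct hb _

lemma wgram_transpose (b : Cov d → Fin k → ℝ) (μ : Measure (Cov d)) (w : Cov d → ℝ) :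
    (wgram b μ w).transpose = wgram b μ w := by
  ext i j; simp [wgram, mul_comm (b _ i)]

lemma wgram_inv_transpose (b : Cov d → Fin k → ℝ) (μ : Measure (Cov d)) (w : Cov d → ℝ) :
    ((wgram b μ w)⁻¹).transpose = (wgram b μ w)⁻¹ := by
  rw [Matrix.transpose_nonsing_inv, wgram_transpose]

lemma memLp_weight_mul (hw : AEStronglyMeasurable w μ) {B : ℝ} (hB : ∀ᵐ v ∂μ, |w v| ≤ B)
    (hf : MemLp f 2 μ) : MemLp (fun v => w v * f v) 2 μ := by
  refine MemLp.of_le_mul hf (hw.mul hf.1) (c := B) ?_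
  filter_upwards [hB] with v hv
  rw [norm_mul]
  exact mul_le_mul_of_nonneg_right hv (norm_nonneg _)

lemma integral_dotProduct_mul (hb : ∀ i, MemLp (fun v => b v i) 2 μ) (hf : MemLp f 2 μ)
    (u : Fin k → ℝ) : ∫ v, (b v ⬝ᵥ u) * f v ∂μ = u ⬝ᵥ coefs b μ f := by
  simp only [dotProduct, Finset.sum_mul, coefs]
  rw [integral_finsetSum]
  · refine Finset.sum_congr rfl fun i _ => ?_
    rw [← integral_const_mul]
    exact integral_congr_ae (.of_forall fun v => by simp; ring)
  · intro i _
    exact ((hb i).mul_const (u i)).integrable_mul hf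

lemma coefs_weight_dotProduct (hb : ∀ i, MemLp (fun v => b v i) 2 μ)
    (hw : AEStronglyMeasurable w μ) {B : ℝ} (hB : ∀ᵐ v ∂μ, |w v| ≤ B) (u : Fin k → ℝ) :
    coefs b μ (fun v => w v * (b v ⬝ᵥ u)) = (wgram b μ w).mulVec u := by
  funext i
  simp only [coefs, Matrix.mulVec, dotProduct, wgram, Matrix.of_apply, Finset.mul_sum]
  rw [integral_finsetSum]
  · refine Finset.sum_congr rfl fun j _ => ?_
    rw [← integral_mul_const]
    exact integral_congr_ae (.of_forall fun v => by simp; ring)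
  · intro j _
    refine ((hb i).integrable_mul (memLp_weight_mul hw hB ((hb j).mul_const (u j)))).congr
      (.of_forall fun v => ?_)
    simp

lemma integral_weight_sq (hb : ∀ i, MemLp (fun v => b v i) 2 μ)
    (hw : AEStronglyMeasurable w μ) {B : ℝ} (hB : ∀ᵐ v ∂μ, |w v| ≤ B) (u : Fin k → ℝ) :
    ∫ v, w v * (b v ⬝ᵥ u) ^ 2 ∂μ = u ⬝ᵥ (wgram b μ w).mulVec u := by
  rw [← coefs_weight_dotProduct hb hw hB u, ← integral_dotProduct_mul hb
    (memLp_weight_mul hw hB (memLp_dotProduct hb u))]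
  exact integral_congr_ae (.of_forall fun v => by simp; ring)

lemma integrable_weight_sq (hb : ∀ i, MemLp (fun v => b v i) 2 μ)
    (hw : AEStronglyMeasurable w μ) {B : ℝ} (hB : ∀ᵐ v ∂μ, |w v| ≤ B) (u : Fin k → ℝ) :
    Integrable (fun v => w v * (b v ⬝ᵥ u) ^ 2) μ :=
  ((memLp_weight_mul hw hB (memLp_dotProduct hb u)).integrable_mul
    (memLp_dotProduct hb u)).congr (.of_forall fun v => by simp; ring)

lemma mul_l2norm_sq_le (hb : ∀ i, MemLp (fun v => b v i) 2 μ)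
    (hw : AEStronglyMeasurable w μ) {c B : ℝ} (hc : ∀ᵐ v ∂μ, c ≤ w v)
    (hB : ∀ᵐ v ∂μ, |w v| ≤ B) (u : Fin k → ℝ) :
    c * l2norm μ (fun v => b v ⬝ᵥ u) ^ 2 ≤ u ⬝ᵥ (wgram b μ w).mulVec u := by
  rw [l2norm_sq, ← integral_const_mul, ← integral_weight_sq hb hw hB u]
  refine integral_mono_ae ((memLp_dotProduct hb u).integrable_sq.const_mul c)
    (integrable_weight_sq hb hw hB u) ?_
  filter_upwards [hc] with v hv
  exact mul_le_mul_of_nonneg_right hv (sq_nonneg _)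

/-- If Ω_w u = 0 then c ∫ (bᵀu)² ≤ uᵀΩ_w u = 0, against positive definiteness of the unweighted Gram
matrix unless u = 0. -/
lemma isUnit_wgram (hb : ∀ i, MemLp (fun v => b v i) 2 μ)
    (hw : AEStronglyMeasurable w μ) {c B : ℝ} (hc0 : 0 < c) (hc : ∀ᵐ v ∂μ, c ≤ w v)
    (hB : ∀ᵐ v ∂μ, |w v| ≤ B)
    (h1 : ∀ u : Fin k → ℝ, u ≠ 0 → 0 < u ⬝ᵥ (wgram b μ fun _ => 1).mulVec u) :
    IsUnit (wgram b μ w) := by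
  rw [← Matrix.mulVec_injective_iff_isUnit]
  intro u u' huu'
  by_contra hne
  have h2 := h1 (u - u') (sub_ne_zero.2 hne)
  rw [← integral_weight_sq hb (B := 1) aestronglyMeasurable_const (by simp)] at h2
  have h3 := mul_l2norm_sq_le hb hw hc hB (u - u')
  rw [Matrix.mulVec_sub, huu', sub_self, dotProduct_zero, l2norm_sq] at h3
  simp only [one_mul] at h2
  nlinarith

/-- Since `wproj` weights the Gram matrix but not the inner product with `f`, it is not a
contraction; it loses c⁻¹. For u = Ω_w⁻¹∫ b f, c‖bᵀu‖² ≤ uᵀΩ_w u = ∫ (bᵀu) f ≤ ‖bᵀu‖ ‖f‖. -/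
lemma l2norm_wproj_le (hb : ∀ i, MemLp (fun v => b v i) 2 μ)
    (hw : AEStronglyMeasurable w μ) {c B : ℝ} (hc0 : 0 < c) (hc : ∀ᵐ v ∂μ, c ≤ w v)
    (hB : ∀ᵐ v ∂μ, |w v| ≤ B) (hu : IsUnit (wgram b μ w)) (hf : MemLp f 2 μ) :
    l2norm μ (wproj b μ w f) ≤ c⁻¹ * l2norm μ f := by
  set u := (wgram b μ w)⁻¹.mulVec (coefs b μ f) with hu_def
  have hdet := (Matrix.isUnit_iff_isUnit_det _).1 hu
  have h1 := mul_l2norm_sq_le hb hw hc hB u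
  have h2 : (wgram b μ w).mulVec u = coefs b μ f := by
    rw [hu_def, Matrix.mulVec_mulVec, Matrix.mul_nonsing_inv _ hdet, Matrix.one_mulVec]
  rw [h2, ← integral_dotProduct_mul hb hf] at h1
  have h3 := (le_abs_self _).trans (abs_integral_mul_le (memLp_dotProduct hb u) hf)
  have h4 : l2norm μ (wproj b μ w f) = l2norm μ (fun v => b v ⬝ᵥ u) := rfl
  rw [h4]
  have h5 := l2norm_nonneg μ (fun v => b v ⬝ᵥ u)
  have h6 := l2norm_nonneg μ f
  rcases h5.eq_or_lt with h0 | h0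
  · rw [← h0]; positivity
  · rw [inv_mul_eq_div, le_div_iff₀ hc0]
    have h7 : l2norm μ (fun v => b v ⬝ᵥ u) * (l2norm μ (fun v => b v ⬝ᵥ u) * c) ≤
        l2norm μ (fun v => b v ⬝ᵥ u) * l2norm μ f := by nlinarith
    exact le_of_mul_le_mul_left h7 h0

lemma coefs_add (hb : ∀ i, MemLp (fun v => b v i) 2 μ) (hf : MemLp f 2 μ) (hg : MemLp g 2 μ) :
    coefs b μ (fun v => f v + g v) = coefs b μ f + coefs b μ g := by
  funext i
  simp only [coefs, Pi.add_apply, mul_add]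
  exact integral_add ((hb i).integrable_mul hf) ((hb i).integrable_mul hg)

lemma wproj_add (hb : ∀ i, MemLp (fun v => b v i) 2 μ) (w : Cov d → ℝ) (hf : MemLp f 2 μ)
    (hg : MemLp g 2 μ) (v : Cov d) :
    wproj b μ w (fun v => f v + g v) v = wproj b μ w f v + wproj b μ w g v := by
  rw [wproj, coefs_add hb hf hg, Matrix.mulVec_add, dotProduct_add]; rfl

lemma wproj_const_mul (w f : Cov d → ℝ) (c : ℝ) (v : Cov d) :
    wproj b μ w (fun v => c * f v) v = c * wproj b μ w f v := by
  have : coefs b μ (fun v => c * f v) = c • coefs b μ f := by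
    funext i
    simp only [coefs, Pi.smul_apply, smul_eq_mul, ← integral_const_mul]
    exact integral_congr_ae (.of_forall fun v => by simp; ring)
  rw [wproj, this, Matrix.mulVec_smul, dotProduct_smul]; rfl

/-- The normal equations: with unit weight the residual is orthogonal to the basis. -/
lemma coefs_sub_wproj (hb : ∀ i, MemLp (fun v => b v i) 2 μ)
    (hu : IsUnit (wgram b μ fun _ => 1)) (hf : MemLp f 2 μ) :
    coefs b μ (fun v => f v - wproj b μ (fun _ => 1) f v) = 0 := by
  have hdet := (Matrix.isUnit_iff_isUnit_det _).1 hu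
  have h1 : coefs b μ (fun v => f v - wproj b μ (fun _ => 1) f v) =
      coefs b μ f - coefs b μ (wproj b μ (fun _ => 1) f) := by
    funext i
    simp only [coefs, Pi.sub_apply, mul_sub]
    exact integral_sub ((hb i).integrable_mul hf) ((hb i).integrable_mul (memLp_wproj hb _ f))
  have h2 := coefs_weight_dotProduct hb (w := fun _ => 1) (B := 1) aestronglyMeasurable_const
    (by simp) ((wgram b μ fun _ => 1)⁻¹.mulVec (coefs b μ f))
  simp only [one_mul] at h2
  rw [Matrix.mulVec_mulVec, Matrix.mul_nonsing_inv _ hdet, Matrix.one_mulVec] at h2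
  rw [h1, show wproj b μ (fun _ => 1) f = fun v => b v ⬝ᵥ
    ((wgram b μ fun _ => 1)⁻¹.mulVec (coefs b μ f)) from rfl, h2, sub_self]

lemma l2norm_sub_wproj_le (hb : ∀ i, MemLp (fun v => b v i) 2 μ)
    (hu : IsUnit (wgram b μ fun _ => 1)) (hf : MemLp f 2 μ) :
    l2norm μ (fun v => f v - wproj b μ (fun _ => 1) f v) ≤ 2 * l2norm μ f := by
  have h1 := l2norm_add_le hf ((memLp_wproj hb (fun _ => 1) f).const_mul (-1))
  rw [l2norm_const_mul] at h1
  have h2 := l2norm_wproj_le hb (w := fun _ => 1) (c := 1) (B := 1) aestronglyMeasurable_const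
    one_pos (by simp) (by simp) hu hf
  simp only [abs_neg, abs_one, one_mul, inv_one, neg_mul, ← sub_eq_add_neg] at h1 h2
  linarith

/-- The residual of `g` is orthogonal to the span, so `f` may be replaced by its own residual before
Cauchy-Schwarz. This makes the bias a product of two approximation errors. -/
lemma abs_integral_mul_sub_wproj_one_le (hb : ∀ i, MemLp (fun v => b v i) 2 μ)
    (hu : IsUnit (wgram b μ fun _ => 1)) (hf : MemLp f 2 μ) (hg : MemLp g 2 μ) :
    |∫ v, f v * (g v - wproj b μ (fun _ => 1) g v) ∂μ| ≤
      l2norm μ (fun v => f v - wproj b μ (fun _ => 1) f v) *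
        l2norm μ (fun v => g v - wproj b μ (fun _ => 1) g v) := by
  have hp : ∀ {f : Cov d → ℝ}, MemLp f 2 μ →
      MemLp (fun v => f v - wproj b μ (fun _ => 1) f v) 2 μ :=
    fun hf => hf.sub (memLp_wproj hb _ _)
  have h1 : ∫ v, f v * (g v - wproj b μ (fun _ => 1) g v) ∂μ =
      ∫ v, (f v - wproj b μ (fun _ => 1) f v) * (g v - wproj b μ (fun _ => 1) g v) ∂μ := by
    have h2 := integral_dotProduct_mul hb (hp hg)
      ((wgram b μ fun _ => 1)⁻¹.mulVec (coefs b μ f))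
    rw [coefs_sub_wproj hb hu hg, dotProduct_zero] at h2
    have h3 : ∫ v, (f v - wproj b μ (fun _ => 1) f v) * (g v - wproj b μ (fun _ => 1) g v) ∂μ =
        ∫ v, f v * (g v - wproj b μ (fun _ => 1) g v) ∂μ -
        ∫ v, wproj b μ (fun _ => 1) f v * (g v - wproj b μ (fun _ => 1) g v) ∂μ := by
      rw [← integral_sub (integrable_mul_of_memLp hf (hp hg))
        (integrable_mul_of_memLp (memLp_wproj hb _ f) (hp hg))]
      exact integral_congr_ae (.of_forall fun v => by simp; ring)
    rw [h3, show ∫ v, wproj b μ (fun _ => 1) f v * (g v - wproj b μ (fun _ => 1) g v) ∂μ = 0 from h2,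
      sub_zero]
  rw [h1]
  exact abs_integral_mul_le (hp hf) (hp hg)

/-- Write Πf = bᵀu with Ωu = ∫ b f. Then ∫ b (w - 1) bᵀu = Ω_w u - ∫ b f, and applying bᵀΩ_w⁻¹ gives
Πf - Π_w f. -/
lemma wproj_one_sub_wproj (hb : ∀ i, MemLp (fun v => b v i) 2 μ)
    (hw : AEStronglyMeasurable w μ) {B : ℝ} (hB : ∀ᵐ v ∂μ, |w v| ≤ B)
    (hu : IsUnit (wgram b μ fun _ => 1)) (huw : IsUnit (wgram b μ w)) (v : Cov d) :
    wproj b μ (fun _ => 1) f v - wproj b μ w f v =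
      wproj b μ w (fun v => (w v - 1) * wproj b μ (fun _ => 1) f v) v := by
  have hdet := (Matrix.isUnit_iff_isUnit_det _).1 hu
  have hdetw := (Matrix.isUnit_iff_isUnit_det _).1 huw
  set u := (wgram b μ fun _ => 1)⁻¹.mulVec (coefs b μ f) with hu_def
  have h1 : coefs b μ (fun v => (w v - 1) * wproj b μ (fun _ => 1) f v) =
      (wgram b μ w).mulVec u - coefs b μ f := by
    have e1 := coefs_weight_dotProduct hb hw hB u
    have e2 := coefs_weight_dotProduct hb (w := fun _ => 1) (B := 1) aestronglyMeasurable_const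
      (by simp) u
    have e3 : (wgram b μ fun _ => 1).mulVec u = coefs b μ f := by
      rw [hu_def, Matrix.mulVec_mulVec, Matrix.mul_nonsing_inv _ hdet, Matrix.one_mulVec]
    rw [e3] at e2
    rw [← e1, ← e2]
    funext i
    simp only [coefs, Pi.sub_apply]
    rw [← integral_sub
      (integrable_mul_of_memLp (hb i) (memLp_weight_mul hw hB (memLp_dotProduct hb u)))
      (integrable_mul_of_memLp (hb i) (by simpa using memLp_dotProduct hb u))]
    refine integral_congr_ae (.of_forall fun v => ?_)
    simp only [wproj, ← hu_def]
    ring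
  rw [wproj, wproj, wproj, h1, Matrix.mulVec_sub, Matrix.mulVec_mulVec,
    Matrix.nonsing_inv_mul _ hdetw, Matrix.one_mulVec, dotProduct_sub]

/-- The bias of a projection with respect to the wrong weight. -/
lemma abs_integral_mul_sub_wproj_le (hb : ∀ i, MemLp (fun v => b v i) 2 μ)
    (hw : AEStronglyMeasurable w μ) {c B e : ℝ} (hc0 : 0 < c) (hc : ∀ᵐ v ∂μ, c ≤ w v)
    (hB : ∀ᵐ v ∂μ, |w v| ≤ B) (he0 : 0 ≤ e) (he : ∀ᵐ v ∂μ, |w v - 1| ≤ e)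
    (hu : IsUnit (wgram b μ fun _ => 1)) (huw : IsUnit (wgram b μ w))
    (hf : MemLp f 2 μ) (hg : MemLp g 2 μ) :
    |∫ v, f v * (g v - wproj b μ w g v) ∂μ| ≤
      l2norm μ (fun v => f v - wproj b μ (fun _ => 1) f v) *
        l2norm μ (fun v => g v - wproj b μ (fun _ => 1) g v) +
      c⁻¹ * e * (l2norm μ f * l2norm μ g) := by
  set r : Cov d → ℝ := fun v => (w v - 1) * wproj b μ (fun _ => 1) g v with hr
  have hp := memLp_wproj hb (fun _ => 1) g
  have hrL : MemLp r 2 μ := memLp_weight_mul (hw.sub aestronglyMeasurable_const) he hp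
  -- Pass from Π_w to Π; the price is Π_w((w - 1) Πg), whose norm is at most c⁻¹ e ‖g‖.
  have h1 : ∫ v, f v * (g v - wproj b μ w g v) ∂μ =
      ∫ v, f v * (g v - wproj b μ (fun _ => 1) g v) ∂μ + ∫ v, f v * wproj b μ w r v ∂μ := by
    rw [← integral_add (integrable_mul_of_memLp (g := fun v => g v - wproj b μ (fun _ => 1) g v)
      hf (hg.sub hp)) (integrable_mul_of_memLp hf (memLp_wproj hb w r))]
    refine integral_congr_ae (.of_forall fun v => ?_)
    simp only [hr, ← wproj_one_sub_wproj hb hw hB hu huw v]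
    ring
  rw [h1]
  refine (abs_add_le _ _).trans (add_le_add (abs_integral_mul_sub_wproj_one_le hb hu hf hg) ?_)
  refine (abs_integral_mul_le hf (memLp_wproj hb w r)).trans ?_
  have h2 := l2norm_wproj_le hb hw hc0 hc hB huw hrL
  have h3 : l2norm μ r ≤ e * l2norm μ (wproj b μ (fun _ => 1) g) := by
    have := l2norm_mono (f := r) (hp.const_mul e) (by
      filter_upwards [he] with v hv
      simp only [hr, abs_mul, abs_of_nonneg he0]
      exact mul_le_mul_of_nonneg_right hv (abs_nonneg _))
    rwa [l2norm_const_mul, abs_of_nonneg he0] at this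
  have h4 := l2norm_wproj_le hb (w := fun _ => 1) (c := 1) (B := 1) aestronglyMeasurable_const
    one_pos (by simp) (by simp) hu hg
  rw [inv_one, one_mul] at h4
  have hf0 := l2norm_nonneg μ f
  calc l2norm μ f * l2norm μ (wproj b μ w r) ≤ l2norm μ f * (c⁻¹ * (e * l2norm μ g)) := by
        gcongr
        exact h2.trans (by gcongr; exact h3.trans (by gcongr))
    _ = _ := by ring

/-! ### The kernel of the weighted projection -/

/-- `b(v)ᵀ Ω_w⁻¹ b(u)`. -/
def wkernel (b : Cov d → Fin k → ℝ) (μ : Measure (Cov d)) (w : Cov d → ℝ) (v u : Cov d) : ℝ :=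
  b v ⬝ᵥ ((wgram b μ w)⁻¹.mulVec (b u))

lemma wkernel_comm (b : Cov d → Fin k → ℝ) (μ : Measure (Cov d)) (w : Cov d → ℝ) (v u : Cov d) :
    wkernel b μ w v u = wkernel b μ w u v := by
  rw [wkernel, wkernel, Matrix.dotProduct_mulVec, dotProduct_comm, ← Matrix.mulVec_transpose,
    wgram_inv_transpose]

lemma integral_wkernel_mul (hb : ∀ i, MemLp (fun v => b v i) 2 μ) (w : Cov d → ℝ)
    (hf : MemLp f 2 μ) (v : Cov d) : ∫ u, wkernel b μ w v u * f u ∂μ = wproj b μ w f v := by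
  have h := integral_dotProduct_mul hb hf ((wgram b μ w)⁻¹.mulVec (b v))
  have e : ∀ u, wkernel b μ w v u = b u ⬝ᵥ ((wgram b μ w)⁻¹.mulVec (b v)) := fun u => by
    rw [wkernel_comm]; rfl
  simp only [e, h]
  rw [wproj, Matrix.dotProduct_mulVec (b v), ← Matrix.mulVec_transpose, wgram_inv_transpose]

/-- As a function of `u` the kernel is bᵀ applied to the vector Ω_w⁻¹b(v), and the quadratic form of
Ω_w at that vector is the diagonal value of the kernel. -/
lemma integral_wkernel_sq_le (hb : ∀ i, MemLp (fun v => b v i) 2 μ)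
    (hw : AEStronglyMeasurable w μ) {c B : ℝ} (hc0 : 0 < c) (hc : ∀ᵐ v ∂μ, c ≤ w v)
    (hB : ∀ᵐ v ∂μ, |w v| ≤ B) (huw : IsUnit (wgram b μ w)) (v : Cov d) :
    ∫ u, wkernel b μ w v u ^ 2 ∂μ ≤ c⁻¹ * wkernel b μ w v v := by
  have hdetw := (Matrix.isUnit_iff_isUnit_det _).1 huw
  have h1 := mul_l2norm_sq_le hb hw hc hB ((wgram b μ w)⁻¹.mulVec (b v))
  have e : ∀ u, b u ⬝ᵥ ((wgram b μ w)⁻¹.mulVec (b v)) = wkernel b μ w v u := fun u => by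
    rw [wkernel_comm]; rfl
  rw [Matrix.mulVec_mulVec, Matrix.mul_nonsing_inv _ hdetw, Matrix.one_mulVec, dotProduct_comm,
    e, l2norm_sq] at h1
  simp only [e] at h1
  rwa [inv_mul_eq_div, le_div_iff₀ hc0, mul_comm]

lemma wkernel_self_nonneg (hb : ∀ i, MemLp (fun v => b v i) 2 μ)
    (hw : AEStronglyMeasurable w μ) {c B : ℝ} (hc0 : 0 < c) (hc : ∀ᵐ v ∂μ, c ≤ w v)
    (hB : ∀ᵐ v ∂μ, |w v| ≤ B) (huw : IsUnit (wgram b μ w)) (v : Cov d) :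
    0 ≤ wkernel b μ w v v := by
  have h := integral_wkernel_sq_le hb hw hc0 hc hB huw v
  have h0 : 0 ≤ ∫ u, wkernel b μ w v u ^ 2 ∂μ := integral_nonneg fun _ => sq_nonneg _
  have h1 := h0.trans h
  have h2 : 0 < c⁻¹ := inv_pos.2 hc0
  nlinarith [mul_pos hc0 h2, mul_inv_cancel₀ hc0.ne']

lemma wkernel_eq_sum (b : Cov d → Fin k → ℝ) (μ : Measure (Cov d)) (w : Cov d → ℝ) (v u : Cov d) :
    wkernel b μ w v u = ∑ i, ∑ j, (wgram b μ w)⁻¹ i j * (b v i * b u j) := by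
  simp only [wkernel, dotProduct, Matrix.mulVec, Finset.mul_sum]
  exact Finset.sum_congr rfl fun i _ => Finset.sum_congr rfl fun j _ => by ring

lemma integrable_wkernel_self (hb : ∀ i, MemLp (fun v => b v i) 2 μ) (w : Cov d → ℝ) :
    Integrable (fun v => wkernel b μ w v v) μ := by
  simp only [wkernel_eq_sum]
  exact integrable_finsetSum _ fun i _ => integrable_finsetSum _ fun j _ =>
    ((hb i).integrable_mul (hb j)).const_mul _

/-- Integrated against `w`, the diagonal gives tr(Ω_w⁻¹Ω_w) = k; then `c ≤ w` and nonnegativity of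
the diagonal remove the weight. -/
lemma integral_wkernel_self_le (hb : ∀ i, MemLp (fun v => b v i) 2 μ)
    (hw : AEStronglyMeasurable w μ) {c B : ℝ} (hc0 : 0 < c) (hc : ∀ᵐ v ∂μ, c ≤ w v)
    (hB : ∀ᵐ v ∂μ, |w v| ≤ B) (huw : IsUnit (wgram b μ w)) :
    ∫ v, wkernel b μ w v v ∂μ ≤ c⁻¹ * k := by
  have hdetw := (Matrix.isUnit_iff_isUnit_det _).1 huw
  have hi : ∀ i j, Integrable (fun v => w v * (b v i * b v j)) μ := fun i j =>
    ((memLp_weight_mul hw hB (hb i)).integrable_mul (hb j)).congr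
      (.of_forall fun v => by simp; ring)
  have e : ∀ v, w v * wkernel b μ w v v =
      ∑ i, ∑ j, (wgram b μ w)⁻¹ i j * (w v * (b v i * b v j)) := fun v => by
    rw [wkernel_eq_sum]
    simp only [Finset.mul_sum]
    exact Finset.sum_congr rfl fun i _ => Finset.sum_congr rfl fun j _ => by ring
  have hI : Integrable (fun v => w v * wkernel b μ w v v) μ := by
    simp only [e]
    exact integrable_finsetSum _ fun i _ => integrable_finsetSum _ fun j _ =>
      (hi i j).const_mul _
  have h1 : ∫ v, w v * wkernel b μ w v v ∂μ = k := by
    simp only [e]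
    have h0 : ∫ v, ∑ i, ∑ j, (wgram b μ w)⁻¹ i j * (w v * (b v i * b v j)) ∂μ =
        ∑ i, ∫ v, ∑ j, (wgram b μ w)⁻¹ i j * (w v * (b v i * b v j)) ∂μ :=
      integral_finsetSum _ fun i _ => integrable_finsetSum _ fun j _ => (hi i j).const_mul _
    rw [h0]
    have : ∀ i, ∫ v, ∑ j, (wgram b μ w)⁻¹ i j * (w v * (b v i * b v j)) ∂μ =
        ((wgram b μ w)⁻¹ * wgram b μ w) i i := fun i => by
      rw [Matrix.mul_apply]
      refine (integral_finsetSum _ fun j _ => (hi i j).const_mul _).trans ?_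
      refine Finset.sum_congr rfl fun j _ => ?_
      rw [integral_const_mul]
      congr 1
      simp [wgram, mul_comm (b _ i)]
    simp [this, Matrix.nonsing_inv_mul _ hdetw]
  have h2 : c * ∫ v, wkernel b μ w v v ∂μ ≤ k := by
    rw [← h1, ← integral_const_mul]
    refine integral_mono_ae ((integrable_wkernel_self hb w).const_mul c) hI ?_
    filter_upwards [hc] with v hv
    exact mul_le_mul_of_nonneg_right hv (wkernel_self_nonneg hb hw hc0 hc hB huw v)
  rw [inv_mul_eq_div, le_div_iff₀ hc0, mul_comm]
  exact h2

end

/-! ### Second moments of sample means and U-statistics -/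

lemma integrable_sub_fun {E : Type*} [MeasurableSpace E] {P : Measure E} {f g : E → ℝ}
    (hf : Integrable f P) (hg : Integrable g P) : Integrable (fun x => f x - g x) P := hf.sub hg

section
variable {E : Type*} [MeasurableSpace E] {P : Measure E} [IsProbabilityMeasure P] {n : ℕ}

/-- Fubini with coordinate `i` integrated first. No integrability is assumed, as the Bochner
integral of a non-integrable function is zero by convention. -/
lemma integral_pi_eq_zero (i : Fin n) (H : (Fin n → E) → ℝ)
    (h : ∀ᵐ z ∂(Measure.pi fun _ : Fin n => P), ∫ x, H (Function.update z i x) ∂P = 0) :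
    ∫ z, H z ∂(Measure.pi fun _ : Fin n => P) = 0 := by
  obtain ⟨n, rfl⟩ : ∃ m, n = m + 1 := ⟨n - 1, by have := i.pos; omega⟩
  have hmp := measurePreserving_piFinSuccAbove (fun _ : Fin (n + 1) => P) i
  have hmp' := hmp.symm
  by_cases hint : Integrable H (Measure.pi fun _ : Fin (n + 1) => P)
  swap
  · exact integral_undef hint
  have h1 := hmp'.integral_comp' (g := H)
  rw [← h1]
  have h2 : Integrable (fun q => H ((MeasurableEquiv.piFinSuccAbove (fun _ => E) i).symm q))
      (P.prod (Measure.pi fun _ : Fin n => P)) :=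
    (hmp'.integrable_comp_emb (MeasurableEquiv.measurableEmbedding _)).2 hint
  rw [integral_prod_symm _ h2]
  have h3 : ∀ᵐ q ∂(P.prod (Measure.pi fun _ : Fin n => P)),
      ∫ x, H (Function.update ((MeasurableEquiv.piFinSuccAbove (fun _ => E) i).symm q) i x) ∂P = 0 :=
    hmp'.quasiMeasurePreserving.ae h
  -- The inner integral overwrites coordinate `i`, so a single good value of that coordinate
  -- suffices to use the almost sure hypothesis.
  have h4 := Measure.ae_ae_of_ae_prod h3
  obtain ⟨x', hx'⟩ := h4.exists
  refine integral_eq_zero_of_ae ?_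
  filter_upwards [hx'] with y hy
  have e : ∀ x, Function.update
      ((MeasurableEquiv.piFinSuccAbove (fun _ => E) i).symm (x', y)) i x =
      (MeasurableEquiv.piFinSuccAbove (fun _ => E) i).symm (x, y) := fun x => by
    exact Fin.update_insertNth _ _ _ _
  simp only [e] at hy
  exact hy

lemma measurePreserving_eval_pair {i j : Fin n} (hij : i ≠ j) :
    MeasurePreserving (fun z : Fin n → E => (z i, z j)) (Measure.pi fun _ : Fin n => P)
      (P.prod P) := by
  refine ⟨by fun_prop, ?_⟩
  have hind : iIndepFun (fun (i : Fin n) (z : Fin n → E) => z i)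
      (Measure.pi fun _ : Fin n => P) :=
    iIndepFun_pi (X := fun _ x => x) fun _ => aemeasurable_id
  have h1 := (indepFun_iff_map_prod_eq_prod_map_map (measurable_pi_apply i).aemeasurable
    (measurable_pi_apply j).aemeasurable).1
    (hind.indepFun hij)
  rw [h1, (measurePreserving_eval (fun _ : Fin n => P) i).map_eq,
    (measurePreserving_eval (fun _ : Fin n => P) j).map_eq]

lemma integral_abs_le_sqrt {Ω : Type*} [MeasurableSpace Ω] {ν : Measure Ω}
    [IsProbabilityMeasure ν] {X : Ω → ℝ} (hX : MemLp X 2 ν) :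
    ∫ ω, |X ω| ∂ν ≤ Real.sqrt (∫ ω, X ω ^ 2 ∂ν) := by
  refine Real.le_sqrt_of_sq_le ?_
  have h1 := variance_nonneg |X| ν
  rw [variance_eq_sub hX.abs] at h1
  simp only [Pi.pow_apply, Pi.abs_apply, sq_abs] at h1
  linarith

lemma integral_sq_sum_eq {Ω ι : Type*} [MeasurableSpace Ω] {ν : Measure Ω} (S : Finset ι)
    {ξ : ι → Ω → ℝ} (h : ∀ p ∈ S, MemLp (ξ p) 2 ν) :
    ∫ ω, (∑ p ∈ S, ξ p ω) ^ 2 ∂ν = ∑ p ∈ S, ∑ q ∈ S, ∫ ω, ξ p ω * ξ q ω ∂ν := by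
  simp only [sq, Finset.sum_mul_sum]
  have hi : ∀ p ∈ S, ∀ q ∈ S, Integrable (fun ω => ξ p ω * ξ q ω) ν := fun p hp q hq =>
    (h p hp).integrable_mul (h q hq)
  rw [integral_finsetSum _ fun p hp => integrable_finsetSum _ (hi p hp)]
  exact Finset.sum_congr rfl fun p hp => integral_finsetSum _ (hi p hp)

lemma memLp_eval {f : E → ℝ} (hf : MemLp f 2 P) (i : Fin n) :
    MemLp (fun z : Fin n → E => f (z i)) 2 (Measure.pi fun _ : Fin n => P) :=
  hf.comp_measurePreserving (measurePreserving_eval (fun _ : Fin n => P) i)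

lemma integral_eval (f : E → ℝ) (hf : AEStronglyMeasurable f P) (i : Fin n) :
    ∫ z, f (z i) ∂(Measure.pi fun _ : Fin n => P) = ∫ x, f x ∂P := by
  have h := (measurePreserving_eval (fun _ : Fin n => P) i).map_eq
  conv_rhs => rw [← h]
  rw [integral_map (measurable_pi_apply i).aemeasurable (by rw [h]; exact hf)]

lemma integral_eval_pair {F : E × E → ℝ} (hF : AEStronglyMeasurable F (P.prod P)) {i j : Fin n}
    (hij : i ≠ j) : ∫ z, F (z i, z j) ∂(Measure.pi fun _ : Fin n => P) = ∫ q, F q ∂(P.prod P) := by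
  have h := (measurePreserving_eval_pair (P := P) hij).map_eq
  conv_rhs => rw [← h]
  rw [integral_map (by fun_prop) (by rw [h]; exact hF)]

/-- The `L₁` error of a sample mean. -/
lemma integral_abs_mean_sub_le {f : E → ℝ} (hf : MemLp f 2 P) (hn : 0 < n) :
    Integrable (fun z : Fin n → E => (1 / (n : ℝ)) * ∑ i, f (z i) - ∫ x, f x ∂P)
      (Measure.pi fun _ : Fin n => P) ∧
    ∫ z, |(1 / (n : ℝ)) * ∑ i, f (z i) - ∫ x, f x ∂P| ∂(Measure.pi fun _ : Fin n => P) ≤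
      Real.sqrt ((∫ x, f x ^ 2 ∂P) / n) := by
  set m := ∫ x, f x ∂P with hm
  have hn' : (n : ℝ) ≠ 0 := by positivity
  have hfm : MemLp (fun x => f x - m) 2 P := hf.sub (memLp_const m)
  have hL : ∀ i ∈ Finset.univ, MemLp (fun z : Fin n → E => f (z i) - m) 2
      (Measure.pi fun _ : Fin n => P) := fun i _ => memLp_eval hfm i
  have hsum : MemLp (fun z : Fin n → E => ∑ i, (f (z i) - m)) 2 (Measure.pi fun _ : Fin n => P) :=
    memLp_finsetSum _ hL
  have e : ∀ z : Fin n → E, (1 / (n : ℝ)) * ∑ i, f (z i) - m =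
      (1 / (n : ℝ)) * ∑ i, (f (z i) - m) := fun z => by
    rw [Finset.sum_sub_distrib]; simp; field_simp
  simp only [e]
  have hX := hsum.const_mul (1 / (n : ℝ))
  refine ⟨hX.integrable (by norm_num), (integral_abs_le_sqrt hX).trans (Real.sqrt_le_sqrt ?_)⟩
  simp only [mul_pow]
  rw [integral_const_mul, integral_sq_sum_eq _ hL]
  have hcenter : ∫ x, (f x - m) ∂P = 0 := by
    rw [integral_sub (hf.integrable (by norm_num)) (integrable_const m)]; simp [hm]
  -- The variance is at most the second moment; distinct observations are uncorrelated after
  -- centering.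
  have hvar : ∫ x, (f x - m) * (f x - m) ∂P ≤ ∫ x, f x ^ 2 ∂P := by
    have h1 : ∫ x, (f x - m) * (f x - m) ∂P = ∫ x, f x ^ 2 ∂P - m ^ 2 := by
      have h2 : ∫ x, (f x - m) * (f x - m) ∂P = ∫ x, (f x ^ 2 - (2 * m * f x - m ^ 2)) ∂P :=
        integral_congr_ae (.of_forall fun x => by simp; ring)
      have h3 := (hf.integrable (by norm_num)).const_mul (2 * m)
      rw [h2, integral_sub hf.integrable_sq (integrable_sub_fun h3 (integrable_const _)),
        integral_sub h3 (integrable_const _), integral_const_mul]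
      simp [← hm]; ring
    rw [h1]; linarith [sq_nonneg m]
  have hterm : ∀ p q : Fin n, ∫ z, (f (z p) - m) * (f (z q) - m)
      ∂(Measure.pi fun _ : Fin n => P) ≤ if p = q then ∫ x, f x ^ 2 ∂P else 0 := by
    intro p q
    split_ifs with hpq
    · subst hpq
      rw [integral_eval (fun x => (f x - m) * (f x - m)) (hfm.1.mul hfm.1) p]
      exact hvar
    · refine (integral_pi_eq_zero p _ (.of_forall fun z => ?_)).le
      simp only [Function.update_self, Function.update_of_ne (Ne.symm hpq)]
      rw [integral_mul_const, hcenter, zero_mul]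
  calc (1 / (n : ℝ)) ^ 2 * ∑ p : Fin n, ∑ q : Fin n, ∫ z, (f (z p) - m) * (f (z q) - m)
        ∂(Measure.pi fun _ : Fin n => P)
      ≤ (1 / (n : ℝ)) ^ 2 * ∑ p : Fin n, ∑ q : Fin n, if p = q then ∫ x, f x ^ 2 ∂P else 0 := by
        gcongr with p _ q _
        exact hterm p q
    _ = (∫ x, f x ^ 2 ∂P) / n := by
        simp; field_simp

/-- If two index pairs differ as unordered pairs, some index of the first is absent from the second.
Integrating that coordinate first annihilates the degenerate factor. -/
lemma integral_mul_eval_pair_eq_zero {F : E × E → ℝ}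
    (h1 : ∀ᵐ x ∂P, ∫ y, F (x, y) ∂P = 0) (h2 : ∀ᵐ y ∂P, ∫ x, F (x, y) ∂P = 0)
    {i j k l : Fin n} (hij : i ≠ j) (hne : ¬ (k = i ∧ l = j)) (hne' : ¬ (k = j ∧ l = i))
    (hkl : k ≠ l) :
    ∫ z, F (z i, z j) * F (z k, z l) ∂(Measure.pi fun _ : Fin n => P) = 0 := by
  have hev : ∀ j : Fin n, ∀ {p : E → Prop}, (∀ᵐ x ∂P, p x) →
      ∀ᵐ z ∂(Measure.pi fun _ : Fin n => P), p (z j) := fun j p hp =>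
    (measurePreserving_eval (fun _ : Fin n => P) j).quasiMeasurePreserving.ae hp
  by_cases hi : i = k ∨ i = l
  · have hj : j ≠ k ∧ j ≠ l := by
      rcases hi with rfl | rfl
      · exact ⟨hij.symm, fun h => hne ⟨rfl, h.symm⟩⟩
      · exact ⟨fun h => hne' ⟨h.symm, rfl⟩, hij.symm⟩
    refine integral_pi_eq_zero j _ ?_
    filter_upwards [hev i h1] with z hz
    simp only [Function.update_self, Function.update_of_ne hj.1.symm,
      Function.update_of_ne hj.2.symm, Function.update_of_ne hij]
    rw [integral_mul_const, hz, zero_mul]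
  · push Not at hi
    refine integral_pi_eq_zero i _ ?_
    filter_upwards [hev j h2] with z hz
    simp only [Function.update_self, Function.update_of_ne hi.1.symm,
      Function.update_of_ne hi.2.symm, Function.update_of_ne hij.symm]
    rw [integral_mul_const, hz, zero_mul]

/-- The second moment of a degenerate U-statistic. -/
lemma integral_sq_degenerate_le {F : E × E → ℝ} (hF : MemLp F 2 (P.prod P))
    (h1 : ∀ᵐ x ∂P, ∫ y, F (x, y) ∂P = 0) (h2 : ∀ᵐ y ∂P, ∫ x, F (x, y) ∂P = 0) :
    MemLp (fun z : Fin n → E => ∑ i, ∑ j ∈ Finset.univ.erase i, F (z i, z j)) 2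
      (Measure.pi fun _ : Fin n => P) ∧
    ∫ z : Fin n → E, (∑ i, ∑ j ∈ Finset.univ.erase i, F (z i, z j)) ^ 2
      ∂(Measure.pi fun _ : Fin n => P) ≤
      2 * (n * ((n : ℝ) - 1)) * ∫ q, F q ^ 2 ∂(P.prod P) := by
  set S : Finset (Σ _ : Fin n, Fin n) := Finset.univ.sigma fun i => Finset.univ.erase i
  have hS : ∀ p ∈ S, p.1 ≠ p.2 := fun p hp => by
    have := (Finset.mem_sigma.1 hp).2
    exact (Finset.ne_of_mem_erase this).symm
  have e : ∀ z : Fin n → E, ∑ i, ∑ j ∈ Finset.univ.erase i, F (z i, z j) =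
      ∑ p ∈ S, F (z p.1, z p.2) := fun z => by rw [Finset.sum_sigma]
  simp only [e]
  have hL : ∀ p ∈ S, MemLp (fun z : Fin n → E => F (z p.1, z p.2)) 2
      (Measure.pi fun _ : Fin n => P) := fun p hp =>
    hF.comp_measurePreserving (measurePreserving_eval_pair (hS p hp))
  refine ⟨memLp_finsetSum _ hL, ?_⟩
  rw [integral_sq_sum_eq _ hL]
  set V := ∫ q, F q ^ 2 ∂(P.prod P)
  have hV : 0 ≤ V := integral_nonneg fun _ => sq_nonneg _
  have hsq : ∀ p ∈ S, ∫ z, F (z p.1, z p.2) ^ 2 ∂(Measure.pi fun _ : Fin n => P) = V :=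
    fun p hp => integral_eval_pair (F := fun q => F q ^ 2) (hF.1.pow 2) (hS p hp)
  have hle : ∀ p ∈ S, ∀ q ∈ S,
      ∫ z, F (z p.1, z p.2) * F (z q.1, z q.2) ∂(Measure.pi fun _ : Fin n => P) ≤ V := by
    intro p hp q hq
    have h3 : ∫ z, F (z p.1, z p.2) * F (z q.1, z q.2) ∂(Measure.pi fun _ : Fin n => P) ≤
        ∫ z, ((1 / 2) * F (z p.1, z p.2) ^ 2 + (1 / 2) * F (z q.1, z q.2) ^ 2)
          ∂(Measure.pi fun _ : Fin n => P) := by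
      refine integral_mono ((hL p hp).integrable_mul (hL q hq))
        (((hL p hp).integrable_sq.const_mul _).add ((hL q hq).integrable_sq.const_mul _))
        fun z => ?_
      nlinarith [sq_nonneg (F (z p.1, z p.2) - F (z q.1, z q.2))]
    refine h3.trans (le_of_eq ?_)
    rw [integral_add ((hL p hp).integrable_sq.const_mul _) ((hL q hq).integrable_sq.const_mul _),
      integral_const_mul, integral_const_mul, hsq p hp, hsq q hq]
    ring
  -- An ordered pair correlates only with itself and with its swap, which gives the factor 2.
  have hrow : ∀ p ∈ S, ∑ q ∈ S,
      ∫ z, F (z p.1, z p.2) * F (z q.1, z q.2) ∂(Measure.pi fun _ : Fin n => P) ≤ 2 * V := by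
    intro p hp
    have h4 : ∀ q ∈ S,
        ∫ z, F (z p.1, z p.2) * F (z q.1, z q.2) ∂(Measure.pi fun _ : Fin n => P) ≤
        (if q = p then V else 0) + (if q = ⟨p.2, p.1⟩ then V else 0) := by
      intro q hq
      by_cases hqp : q = p
      · rw [if_pos hqp]
        have : 0 ≤ (if q = ⟨p.2, p.1⟩ then V else 0) := by split_ifs <;> simp [hV]
        linarith [hle p hp q hq]
      · by_cases hqp' : q = ⟨p.2, p.1⟩
        · rw [if_neg hqp, if_pos hqp', zero_add]
          exact hle p hp q hq
        · rw [if_neg hqp, if_neg hqp', zero_add]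
          refine (integral_mul_eval_pair_eq_zero h1 h2 (hS p hp) ?_ ?_ (hS q hq)).le
          · rintro ⟨h5, h6⟩
            exact hqp (Sigma.ext h5 (heq_of_eq h6))
          · rintro ⟨h5, h6⟩
            exact hqp' (Sigma.ext h5 (heq_of_eq h6))
    refine (Finset.sum_le_sum h4).trans ?_
    rw [Finset.sum_add_distrib, Finset.sum_ite_eq', Finset.sum_ite_eq']
    have h5 : ∀ r : Σ _ : Fin n, Fin n, (if r ∈ S then V else 0) ≤ V := fun r => by
      split_ifs <;> simp [hV]
    linarith [h5 p, h5 ⟨p.2, p.1⟩]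
  refine (Finset.sum_le_sum hrow).trans (le_of_eq ?_)
  rw [Finset.sum_const, nsmul_eq_mul, Finset.card_sigma]
  rcases Nat.eq_zero_or_pos n with rfl | hn
  · simp
  · simp [Finset.card_erase_of_mem, Nat.cast_sub (Nat.succ_le_of_lt hn)]; ring

/-- The `L₁` error of a second-order U-statistic, with `g₁` and `g₂` the two Hájek projections. -/
lemma integral_abs_uStat_sub_le {f : E × E → ℝ} (hf : MemLp f 2 (P.prod P)) {g₁ g₂ : E → ℝ}
    (hg₁ : MemLp g₁ 2 P) (hg₂ : MemLp g₂ 2 P) (h1 : ∀ᵐ x ∂P, ∫ y, f (x, y) ∂P = g₁ x)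
    (h2 : ∀ᵐ y ∂P, ∫ x, f (x, y) ∂P = g₂ y) {V₁ V₂ : ℝ} (hV₂ : ∫ q, f q ^ 2 ∂(P.prod P) ≤ V₂)
    (hV₁ : ∫ x, g₁ x ^ 2 ∂P ≤ V₁) (hV₁' : ∫ x, g₂ x ^ 2 ∂P ≤ V₁) (hn : 2 ≤ n) :
    Integrable (fun z : Fin n → E => (1 / ((n : ℝ) * ((n : ℝ) - 1))) *
      ∑ i, ∑ j ∈ Finset.univ.erase i, f (z i, z j) - ∫ x, g₁ x ∂P)
      (Measure.pi fun _ : Fin n => P) ∧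
    ∫ z : Fin n → E, |(1 / ((n : ℝ) * ((n : ℝ) - 1))) *
      ∑ i, ∑ j ∈ Finset.univ.erase i, f (z i, z j) - ∫ x, g₁ x ∂P|
      ∂(Measure.pi fun _ : Fin n => P) ≤ 4 * (Real.sqrt V₂ / n) + 9 * Real.sqrt (V₁ / n) := by
  set m := ∫ x, g₁ x ∂P with hm
  have hfI : Integrable f (P.prod P) := hf.integrable (by norm_num)
  have hm₂ : ∫ y, g₂ y ∂P = m := by
    rw [hm, ← integral_congr_ae h1, ← integral_congr_ae h2]
    exact integral_integral_swap (f := fun y x => f (x, y)) hfI.swap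
  have hn' : (2 : ℝ) ≤ n := by exact_mod_cast hn
  have hV₁0 : 0 ≤ V₁ := (integral_nonneg fun _ => sq_nonneg _).trans hV₁
  have hV₂0 : 0 ≤ V₂ := (integral_nonneg fun _ => sq_nonneg _).trans hV₂
  have hm2 : m ^ 2 ≤ V₁ := by
    have h := variance_nonneg g₁ P
    rw [variance_eq_sub hg₁] at h
    simp only [Pi.pow_apply] at h
    rw [← hm] at h
    linarith
  -- The degenerate part of Hoeffding's decomposition.
  set F : E × E → ℝ := fun q => f q - g₁ q.1 - g₂ q.2 + m with hF_def
  have hG₁ : MemLp (fun q : E × E => g₁ q.1) 2 (P.prod P) :=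
    hg₁.comp_measurePreserving measurePreserving_fst
  have hG₂ : MemLp (fun q : E × E => g₂ q.2) 2 (P.prod P) :=
    hg₂.comp_measurePreserving measurePreserving_snd
  have hF : MemLp F 2 (P.prod P) := ((hf.sub hG₁).sub hG₂).add (memLp_const m)
  have hF1 : ∀ᵐ x ∂P, ∫ y, F (x, y) ∂P = 0 := by
    filter_upwards [h1, hfI.prod_right_ae] with x hx hxi
    simp only [hF_def]
    have hi2 := hg₂.integrable (q := 2) (by norm_num)
    rw [integral_add (integrable_sub_fun (integrable_sub_fun hxi (integrable_const _)) hi2)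
      (integrable_const _), integral_sub (integrable_sub_fun hxi (integrable_const _)) hi2, integral_sub hxi (integrable_const _),
      hx, hm₂]
    simp
  have hF2 : ∀ᵐ y ∂P, ∫ x, F (x, y) ∂P = 0 := by
    filter_upwards [h2, hfI.prod_left_ae] with y hy hyi
    simp only [hF_def]
    have hi1 := hg₁.integrable (q := 2) (by norm_num)
    rw [integral_add (integrable_sub_fun (integrable_sub_fun hyi hi1) (integrable_const _))
      (integrable_const _), integral_sub (integrable_sub_fun hyi hi1) (integrable_const _), integral_sub hyi hi1, hy, ← hm]
    simp
  have hFV : ∫ q, F q ^ 2 ∂(P.prod P) ≤ 4 * (V₂ + 3 * V₁) := by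
    have h3 : ∫ q, F q ^ 2 ∂(P.prod P) ≤
        ∫ q, 4 * (f q ^ 2 + g₁ q.1 ^ 2 + g₂ q.2 ^ 2 + m ^ 2) ∂(P.prod P) := by
      refine integral_mono hF.integrable_sq ((((hf.integrable_sq.add hG₁.integrable_sq).add
        hG₂.integrable_sq).add (integrable_const _)).const_mul 4) fun q => ?_
      simp only [hF_def]
      nlinarith [sq_nonneg (f q + g₁ q.1), sq_nonneg (f q + g₂ q.2), sq_nonneg (f q - m),
        sq_nonneg (g₁ q.1 - g₂ q.2), sq_nonneg (g₁ q.1 + m), sq_nonneg (g₂ q.2 + m)]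
    have e1 : ∫ q : E × E, g₁ q.1 ^ 2 ∂(P.prod P) = ∫ x, g₁ x ^ 2 ∂P := by
      have := integral_prod_mul (μ := P) (ν := P) (fun x => g₁ x ^ 2) (fun _ => (1 : ℝ))
      simpa using this
    have e2 : ∫ q : E × E, g₂ q.2 ^ 2 ∂(P.prod P) = ∫ x, g₂ x ^ 2 ∂P := by
      have := integral_prod_mul (μ := P) (ν := P) (fun _ => (1 : ℝ)) (fun x => g₂ x ^ 2)
      simpa using this
    rw [integral_const_mul, integral_add ((hf.integrable_sq.fun_add hG₁.integrable_sq).fun_add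
      hG₂.integrable_sq) (integrable_const _), integral_add (hf.integrable_sq.fun_add
      hG₁.integrable_sq) hG₂.integrable_sq, integral_add hf.integrable_sq hG₁.integrable_sq,
      e1, e2] at h3
    simp only [integral_const, probReal_univ, one_smul] at h3
    linarith
  obtain ⟨hUL, hU2⟩ := integral_sq_degenerate_le (n := n) hF hF1 hF2
  obtain ⟨hA1, hA2⟩ := integral_abs_mean_sub_le (n := n) hg₁ (by omega)
  obtain ⟨hB1, hB2⟩ := integral_abs_mean_sub_le (n := n) hg₂ (by omega)
  rw [hm₂] at hB1 hB2
  rw [← hm] at hA1 hA2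
  set r : ℝ := 1 / ((n : ℝ) * ((n : ℝ) - 1)) with hr
  have hn1 : (0 : ℝ) < (n : ℝ) - 1 := by linarith
  have hn0 : (0 : ℝ) < n := by linarith
  have e : ∀ z : Fin n → E, r * ∑ i, ∑ j ∈ Finset.univ.erase i, f (z i, z j) - m =
      r * ∑ i, ∑ j ∈ Finset.univ.erase i, F (z i, z j) +
        (((1 / (n : ℝ)) * ∑ i, g₁ (z i) - m) + ((1 / (n : ℝ)) * ∑ i, g₂ (z i) - m)) := by
    intro z
    have hc : ((n - 1 : ℕ) : ℝ) = (n : ℝ) - 1 := by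
      rw [Nat.cast_sub (by omega)]; simp
    have s1 : ∑ i : Fin n, ∑ _j ∈ Finset.univ.erase i, g₁ (z i) =
        ((n : ℝ) - 1) * ∑ i, g₁ (z i) := by
      rw [Finset.mul_sum]
      refine Finset.sum_congr rfl fun i _ => ?_
      rw [Finset.sum_const, Finset.card_erase_of_mem (Finset.mem_univ i)]
      simp [hc]
    have s2 : ∑ i : Fin n, ∑ j ∈ Finset.univ.erase i, g₂ (z j) =
        ((n : ℝ) - 1) * ∑ i, g₂ (z i) := by
      have : ∀ i : Fin n, ∑ j ∈ Finset.univ.erase i, g₂ (z j) = ∑ j, g₂ (z j) - g₂ (z i) :=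
        fun i => by rw [Finset.sum_erase_eq_sub (Finset.mem_univ i)]
      simp only [this, Finset.sum_sub_distrib, Finset.sum_const, Finset.card_univ,
        Fintype.card_fin, nsmul_eq_mul]
      ring
    have s3 : ∑ i : Fin n, ∑ _j ∈ Finset.univ.erase i, m = n * ((n : ℝ) - 1) * m := by
      have : ∀ i : Fin n, ∑ _j ∈ Finset.univ.erase i, m = ((n : ℝ) - 1) * m := fun i => by
        rw [Finset.sum_const, Finset.card_erase_of_mem (Finset.mem_univ i)]
        simp [hc]
      simp only [this, Finset.sum_const, Finset.card_univ, Fintype.card_fin, nsmul_eq_mul]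
      ring
    simp only [hF_def, Finset.sum_add_distrib, Finset.sum_sub_distrib]
    rw [s1, s2, s3, hr]
    field_simp
    ring
  simp only [e]
  have hUI := (hUL.const_mul r).integrable (q := 2) (by norm_num)
  refine ⟨hUI.add (hA1.add hB1), ?_⟩
  have hdeg : ∫ z : Fin n → E, |r * ∑ i, ∑ j ∈ Finset.univ.erase i, F (z i, z j)|
      ∂(Measure.pi fun _ : Fin n => P) ≤ 4 * (Real.sqrt V₂ / n) + 7 * Real.sqrt (V₁ / n) := by
    refine (integral_abs_le_sqrt (hUL.const_mul r)).trans ?_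
    simp only [mul_pow]
    rw [integral_const_mul]
    have hq1 := Real.sqrt_nonneg V₂
    have hq2 := Real.sqrt_nonneg (V₁ / n)
    refine Real.sqrt_le_iff.2 ⟨by positivity, ?_⟩
    -- Here r = 1/(n(n-1)) ≤ 2/n² because n ≥ 2. The resulting 16 and 48 are at most 4² and 7²; the
    -- two linear parts raise 7 to the final 9.
    have h5 : r ^ 2 * ∫ z : Fin n → E, (∑ i, ∑ j ∈ Finset.univ.erase i, F (z i, z j)) ^ 2
        ∂(Measure.pi fun _ : Fin n => P) ≤ 16 * (V₂ / n ^ 2) + 48 * (V₁ / n) := by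
      calc _ ≤ r ^ 2 * (2 * (n * ((n : ℝ) - 1)) * (4 * (V₂ + 3 * V₁))) := by
            gcongr
            exact hU2.trans (by gcongr)
        _ = 8 * (V₂ + 3 * V₁) * r := by rw [hr]; field_simp; ring
        _ ≤ 8 * (V₂ + 3 * V₁) * (2 / (n : ℝ) ^ 2) := by
            gcongr
            rw [hr, div_le_div_iff₀ (by positivity) (by positivity)]
            nlinarith
        _ = 16 * (V₂ / n ^ 2) + 48 * (V₁ / n ^ 2) := by ring
        _ ≤ _ := by
            gcongr
            nlinarith
    refine h5.trans ?_
    have h6 : (Real.sqrt V₂ / n) ^ 2 = V₂ / n ^ 2 := by rw [div_pow, Real.sq_sqrt hV₂0]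
    have h7 : Real.sqrt (V₁ / n) ^ 2 = V₁ / n := Real.sq_sqrt (by positivity)
    have h8 : 0 ≤ (Real.sqrt V₂ / n) * Real.sqrt (V₁ / n) := by positivity
    have h9 : 0 ≤ V₁ / n := by positivity
    nlinarith
  have hA3 : Real.sqrt ((∫ x, g₁ x ^ 2 ∂P) / n) ≤ Real.sqrt (V₁ / n) := by gcongr
  have hB3 : Real.sqrt ((∫ x, g₂ x ^ 2 ∂P) / n) ≤ Real.sqrt (V₁ / n) := by gcongr
  calc _ ≤ ∫ z : Fin n → E, (|r * ∑ i, ∑ j ∈ Finset.univ.erase i, F (z i, z j)| +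
        (|(1 / (n : ℝ)) * ∑ i, g₁ (z i) - m| + |(1 / (n : ℝ)) * ∑ i, g₂ (z i) - m|))
        ∂(Measure.pi fun _ : Fin n => P) := by
        refine integral_mono (hUI.add (hA1.add hB1)).abs (hUI.abs.add (hA1.abs.add hB1.abs))
          fun z => ?_
        exact (abs_add_le _ _).trans (add_le_add le_rfl (abs_add_le _ _))
    _ ≤ _ := by
        rw [integral_add hUI.abs (hA1.abs.fun_add hB1.abs), integral_add hA1.abs hB1.abs]
        linarith

end

/-! ### Rates implied by the choice of the tuning parameters -/

/-- The bounds through which the tuning parameters enter the risk, for a target rate `R`. -/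
structure TuningRates (d : ℕ) (α β γ rmax C R : ℝ) (n : ℕ) (h : ℝ) (k : ℕ) : Prop where
  rate_pos : 0 < R
  h_pos : 0 < h
  h_le : h ≤ C
  k_pos : 0 < k
  smoothing : h ^ γ ≤ C * R
  variance_linear : 1 / (n * h ^ d) ≤ C * R ^ 2
  variance_quadratic : k / (n * h ^ d) ^ 2 ≤ C * R ^ 2
  bias : h ^ α * (k : ℝ) ^ (-(α / d)) * (h ^ β * (k : ℝ) ^ (-(β / d))) ≤ C * R
  high_order_pi : (k : ℝ) ^ (-(rmax / d)) ≤ C * (h ^ α * (k : ℝ) ^ (-(α / d)))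
  high_order_mu : (k : ℝ) ^ (-(rmax / d)) ≤ C * (h ^ β * (k : ℝ) ^ (-(β / d)))

lemma TuningRates.mono {d : ℕ} {α β γ rmax C C' R : ℝ} {n : ℕ} {h : ℝ} {k : ℕ}
    (H : TuningRates d α β γ rmax C R n h k) (hC : C ≤ C') :
    TuningRates d α β γ rmax C' R n h k := by
  have h1 := H.rate_pos
  have h2 := H.h_pos
  have h3 : (0 : ℝ) < k := by exact_mod_cast H.k_pos
  exact ⟨h1, h2, H.h_le.trans hC, H.k_pos, H.smoothing.trans (by gcongr),
    H.variance_linear.trans (by gcongr), H.variance_quadratic.trans (by gcongr),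
    H.bias.trans (by gcongr), H.high_order_pi.trans (by gcongr), H.high_order_mu.trans (by gcongr)⟩

/-- Split k^(-rmax/d) into k^(-α/d) and a surplus power of `k`. With `k` at least of order x^e and
`h` at least of order x^(-a), `ha` says that the surplus is dominated by h^α. -/
lemma high_order_le {d : ℕ} (hd : 0 < d) {a e α rmax c x h k : ℝ} (hα : 0 < α)
    (hr : α ≤ rmax) (hc : 0 < c) (hx : 1 ≤ x) (ha : a * α ≤ e * ((rmax - α) / d))
    (hh : c * x ^ (-a) ≤ h) (hk : c * x ^ e ≤ k) :
    k ^ (-(rmax / d)) ≤ (c ^ (-((rmax - α) / d)) * c ^ (-α)) * (h ^ α * k ^ (-(α / d))) := by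
  have hd' : (0 : ℝ) < d := by exact_mod_cast hd
  have hx0 : 0 < x := by linarith
  have hk0 : 0 < k := lt_of_lt_of_le (by positivity) hk
  have hh0 : 0 < h := lt_of_lt_of_le (by positivity) hh
  have hp : 0 ≤ (rmax - α) / d := div_nonneg (by linarith) hd'.le
  have h1 : k ^ (-(rmax / d)) = k ^ (-((rmax - α) / d)) * k ^ (-(α / d)) := by
    rw [← Real.rpow_add hk0]; congr 1; ring
  have h2 : k ^ (-((rmax - α) / d)) ≤ c ^ (-((rmax - α) / d)) * x ^ (-(e * ((rmax - α) / d))) := by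
    calc k ^ (-((rmax - α) / d)) ≤ (c * x ^ e) ^ (-((rmax - α) / d)) :=
          Real.rpow_le_rpow_of_nonpos (by positivity) hk (by linarith)
      _ = _ := by
          rw [Real.mul_rpow hc.le (by positivity), ← Real.rpow_mul hx0.le]; congr 2; ring
  have h3 : x ^ (-(e * ((rmax - α) / d))) ≤ c ^ (-α) * h ^ α := by
    calc x ^ (-(e * ((rmax - α) / d))) ≤ x ^ (-(a * α)) :=
          Real.rpow_le_rpow_of_exponent_le hx (by linarith)
      _ = c ^ (-α) * (c * x ^ (-a)) ^ α := by
          rw [Real.mul_rpow hc.le (by positivity), ← Real.rpow_mul hx0.le, ← mul_assoc,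
            ← Real.rpow_add hc]
          simp
      _ ≤ _ := by gcongr
  rw [h1]
  calc _ ≤ (c ^ (-((rmax - α) / d)) * (c ^ (-α) * h ^ α)) * k ^ (-(α / d)) := by
        gcongr
        exact h2.trans (by gcongr)
    _ = _ := by ring

/-- For h ≍ n^(-a), k ≍ n^e and target rate n^(-q), every requirement is an inequality between
exponents: `h1` is smoothing, `h2` linear variance, `h3` quadratic variance, `h4` bias, and `hr1`,
`hr2` the polynomial part of the approximation error. -/
lemma exists_tuningRates_of_powers {d : ℕ} (hd : 0 < d) {α β γ a e q rmax c M : ℝ} (hα : 0 < α)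
    (hβ : 0 < β) (hγ : 0 < γ) (ha : 0 < a) (hc : 0 < c) (hM : 0 < M)
    (h1 : q ≤ a * γ) (h2 : 2 * q ≤ 1 - a * d) (h3 : 2 * q ≤ 2 - 2 * (a * d) - e)
    (h4 : q ≤ (α + β) * a + (α + β) * e / d) (hrα : α ≤ rmax) (hrβ : β ≤ rmax)
    (hr1 : a * α ≤ e * ((rmax - α) / d)) (hr2 : a * β ≤ e * ((rmax - β) / d)) :
    ∃ C : ℝ, ∀ (n : ℕ), 2 ≤ n → ∀ (h : ℝ) (k : ℕ),
      c * (n : ℝ) ^ (-a) ≤ h → h ≤ M * (n : ℝ) ^ (-a) →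
      c * (n : ℝ) ^ e ≤ k → k ≤ M * (n : ℝ) ^ e →
      TuningRates d α β γ rmax C ((n : ℝ) ^ (-q)) n h k := by
  have hd' : (0 : ℝ) < d := by exact_mod_cast hd
  set C₁ := M ^ γ
  set C₂ := (c ^ d)⁻¹
  set C₃ := M * ((c ^ d)⁻¹) ^ 2
  set C₄ := M ^ α * c ^ (-(α / d)) * (M ^ β * c ^ (-(β / d)))
  set C₅ := c ^ (-((rmax - α) / d)) * c ^ (-α)
  set C₆ := c ^ (-((rmax - β) / d)) * c ^ (-β)
  have p1 : 0 ≤ C₁ := by positivity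
  have p2 : 0 ≤ C₂ := by positivity
  have p3 : 0 ≤ C₃ := by positivity
  have p4 : 0 ≤ C₄ := by positivity
  have p5 : 0 ≤ C₅ := by positivity
  have p6 : 0 ≤ C₆ := by positivity
  set C := M + C₁ + C₂ + C₃ + C₄ + C₅ + C₆ with hC
  refine ⟨C, fun n hn h k hh1 hh2 hk1 hk2 => ?_⟩
  have hx : (1 : ℝ) ≤ n := by exact_mod_cast (by omega : 1 ≤ n)
  set x : ℝ := (n : ℝ)
  have hx0 : 0 < x := by linarith
  have hk0 : (0 : ℝ) < k := lt_of_lt_of_le (by positivity) hk1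
  have hh0 : 0 < h := lt_of_lt_of_le (by positivity) hh1
  have hR : 0 < x ^ (-q) := by positivity
  have hR2 : (x ^ (-q)) ^ 2 = x ^ (-(2 * q)) := by
    rw [← Real.rpow_natCast, ← Real.rpow_mul hx0.le]; congr 1; push_cast; ring
  have hnh : c ^ d * x ^ (1 - a * d) ≤ x * h ^ d := by
    calc c ^ d * x ^ (1 - a * d) = x * (c * x ^ (-a)) ^ d := by
          rw [mul_pow, ← Real.rpow_natCast (x ^ (-a)), ← Real.rpow_mul hx0.le,
            show (1 - a * d) = 1 + -a * d by ring, Real.rpow_add hx0, Real.rpow_one]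
          ring
      _ ≤ _ := by gcongr
  have hinv : 1 / (x * h ^ d) ≤ C₂ * x ^ (-(1 - a * d)) := by
    rw [one_div, Real.rpow_neg hx0.le, ← mul_inv]
    exact inv_anti₀ (by positivity) hnh
  have hpow : ∀ r : ℝ, 0 < r → h ^ r * (k : ℝ) ^ (-(r / d)) ≤
      M ^ r * c ^ (-(r / d)) * x ^ (-(r * a + r * e / d)) := by
    intro r hr
    have e1 : h ^ r ≤ M ^ r * x ^ (-(r * a)) := by
      calc h ^ r ≤ (M * x ^ (-a)) ^ r := by gcongr
        _ = _ := by
          rw [Real.mul_rpow hM.le (by positivity), ← Real.rpow_mul hx0.le]; congr 2; ring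
    have e2 : (k : ℝ) ^ (-(r / d)) ≤ c ^ (-(r / d)) * x ^ (-(r * e / d)) := by
      calc (k : ℝ) ^ (-(r / d)) ≤ (c * x ^ e) ^ (-(r / d)) :=
            Real.rpow_le_rpow_of_nonpos (by positivity) hk1
              (by have : 0 < r / d := by positivity
                  linarith)
        _ = _ := by
          rw [Real.mul_rpow hc.le (by positivity), ← Real.rpow_mul hx0.le]; congr 2; ring
    calc _ ≤ (M ^ r * x ^ (-(r * a))) * (c ^ (-(r / d)) * x ^ (-(r * e / d))) := by gcongr
      _ = M ^ r * c ^ (-(r / d)) * (x ^ (-(r * a)) * x ^ (-(r * e / d))) := by ring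
      _ = _ := by rw [← Real.rpow_add hx0]; congr 2; ring
  refine ⟨hR, hh0, ?_, by exact_mod_cast hk0, ?_, ?_, ?_, ?_, ?_, ?_⟩
  · calc h ≤ M * x ^ (-a) := hh2
      _ ≤ M * 1 := by gcongr; exact Real.rpow_le_one_of_one_le_of_nonpos hx (by linarith)
      _ ≤ C := by rw [hC]; linarith
  · calc h ^ γ ≤ (M * x ^ (-a)) ^ γ := by gcongr
      _ = C₁ * x ^ (-(a * γ)) := by
        rw [Real.mul_rpow hM.le (by positivity), ← Real.rpow_mul hx0.le]; congr 2; ring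
      _ ≤ C * x ^ (-q) := by
        gcongr
        rw [hC]; linarith
  · calc 1 / (x * h ^ d) ≤ C₂ * x ^ (-(1 - a * d)) := hinv
      _ ≤ C * x ^ (-(2 * q)) := by
        gcongr
        rw [hC]; linarith
      _ = _ := by rw [hR2]
  · calc (k : ℝ) / (x * h ^ d) ^ 2 = k * (1 / (x * h ^ d)) ^ 2 := by ring
      _ ≤ (M * x ^ e) * (C₂ * x ^ (-(1 - a * d))) ^ 2 := by gcongr
      _ = C₃ * x ^ (-(2 - 2 * (a * d) - e)) := by
        have : x ^ (-(2 - 2 * (a * d) - e)) = x ^ e * (x ^ (-(1 - a * d))) ^ 2 := by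
          rw [← Real.rpow_natCast, ← Real.rpow_mul hx0.le, ← Real.rpow_add hx0]
          congr 1; push_cast; ring
        rw [this]; ring
      _ ≤ C * x ^ (-(2 * q)) := by
        gcongr
        rw [hC]; linarith
      _ = _ := by rw [hR2]
  · calc _ ≤ (M ^ α * c ^ (-(α / d)) * x ^ (-(α * a + α * e / d))) *
          (M ^ β * c ^ (-(β / d)) * x ^ (-(β * a + β * e / d))) := by
          exact mul_le_mul (hpow α hα) (hpow β hβ) (by positivity) (by positivity)
      _ = C₄ * x ^ (-((α + β) * a + (α + β) * e / d)) := by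
        have : x ^ (-((α + β) * a + (α + β) * e / d)) =
            x ^ (-(α * a + α * e / d)) * x ^ (-(β * a + β * e / d)) := by
          rw [← Real.rpow_add hx0]; congr 1; ring
        rw [this]; ring
      _ ≤ C * x ^ (-q) := by
        gcongr
        rw [hC]; linarith
  · refine (high_order_le hd hα hrα hc hx hr1 hh1 hk1).trans ?_
    gcongr
    change C₅ ≤ C
    rw [hC]; linarith
  · refine (high_order_le hd hβ hrβ hc hx hr2 hh1 hk1).trans ?_
    gcongr
    change C₆ ≤ C
    rw [hC]; linarith

/-- A bandwidth bounded below and at most of order n^(-a) forces `n` to be bounded. In that regime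
the approximation argument is unavailable, and constant bounds are already of the order of the rate.
-/
lemma exists_one_le_rate {a q M h₀ : ℝ} (ha : 0 < a) (hq : 0 < q) (hM : 0 < M) (hh₀ : 0 < h₀) :
    ∃ C : ℝ, 0 ≤ C ∧ ∀ (n : ℕ), 2 ≤ n → ∀ (h : ℝ), h ≤ M * (n : ℝ) ^ (-a) → h₀ ≤ h →
      1 ≤ C * (n : ℝ) ^ (-q) := by
  refine ⟨(M / h₀) ^ (q / a), by positivity, fun n hn h h1 h2 => ?_⟩
  have hx0 : (0 : ℝ) < n := by exact_mod_cast (by omega : 0 < n)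
  have h3 : h₀ / M ≤ (n : ℝ) ^ (-a) := by
    rw [div_le_iff₀ hM]; linarith
  have h4 : (h₀ / M) ^ (q / a) ≤ (n : ℝ) ^ (-q) := by
    calc (h₀ / M) ^ (q / a) ≤ ((n : ℝ) ^ (-a)) ^ (q / a) := by gcongr
      _ = _ := by rw [← Real.rpow_mul hx0.le]; congr 1; field_simp
  calc (1 : ℝ) = (M / h₀) ^ (q / a) * (h₀ / M) ^ (q / a) := by
        rw [← Real.mul_rpow (by positivity) (by positivity)]
        rw [div_mul_div_cancel₀ hh₀.ne', div_self hM.ne', Real.one_rpow]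
    _ ≤ _ := by gcongr

/-- The rate of convergence of the theorem. -/
def targetRate (d : ℕ) (s γ : ℝ) (n : ℕ) : ℝ :=
  if s < (d / 4) / (1 + d / (2 * γ)) then (n : ℝ) ^ (-1 / (1 + d / (2 * γ) + d / (4 * s)))
  else (n : ℝ) ^ (-1 / (2 + d / γ))

/-- The smoothness threshold is exactly where d/(4s) crosses 1 + d/(2γ), so the maximum in condition
(vi) encodes both cases. -/
lemma targetRate_eq (d : ℕ) (hd : 0 < d) {s γ : ℝ} (hs : 0 < s) (hγ : 0 < γ) (n : ℕ) :
    (n : ℝ) ^ (-1 / (1 + d / (2 * γ) + max (d / (4 * s)) (1 + d / (2 * γ)))) =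
      targetRate d s γ n := by
  have hd' : (0 : ℝ) < d := by exact_mod_cast hd
  have key : s < (d / 4) / (1 + d / (2 * γ)) ↔ 1 + d / (2 * γ) < d / (4 * s) := by
    rw [lt_div_iff₀ (by positivity), lt_div_iff₀ (by positivity), lt_div_iff₀ (by positivity)]
    constructor <;> intro h <;> linarith
  rw [targetRate]
  split_ifs with h
  · rw [max_eq_left (key.1 h).le]
  · rw [max_eq_right (not_lt.1 (mt key.2 h))]
    congr 2
    field_simp; ring

/-- In the low case the exponent inequalities for smoothing, quadratic variance and bias are
equalities, with slack in the linear variance. In the other case smoothing and both variances are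
equalities and the slack is in the bias. -/
lemma exists_tuningRates (d : ℕ) (hd : 0 < d) {α β γ s : ℝ} (hα : 0 < α) (hβ : 0 < β) (hγ : 0 < γ)
    (hs : s = (α + β) / 2) :
    ∃ rmax : ℝ, α ≤ rmax ∧ β ≤ rmax ∧ ∀ (c M : ℝ), 0 < c →
      (∃ C : ℝ, ∀ (n : ℕ), 2 ≤ n → ∀ (h : ℝ) (k : ℕ), TuningOK d s γ c M n h k →
        TuningRates d α β γ rmax C (targetRate d s γ n) n h k) ∧
      ∀ h₀ : ℝ, 0 < h₀ → ∃ C : ℝ, 0 ≤ C ∧ ∀ (n : ℕ), 2 ≤ n → ∀ (h : ℝ) (k : ℕ),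
        TuningOK d s γ c M n h k → h₀ ≤ h → 1 ≤ C * targetRate d s γ n := by
  have hd' : (0 : ℝ) < d := by exact_mod_cast hd
  have hs0 : 0 < s := by rw [hs]; linarith
  have hαβ : α + β = 2 * s := by rw [hs]; ring
  by_cases hcase : s < (d / 4) / (1 + d / (2 * γ))
  · have hrate : ∀ n, targetRate d s γ n = (n : ℝ) ^ (-(1 / (1 + d / (2 * γ) + d / (4 * s)))) :=
      fun n => by rw [targetRate, if_pos hcase]; congr 1; ring
    simp only [hrate]
    set D := 1 + d / (2 * γ) + d / (4 * s) with hD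
    have hD0 : 0 < D := by positivity
    have hlow : 1 + d / (2 * γ) < d / (4 * s) := by
      rw [lt_div_iff₀ (by positivity)] at hcase ⊢
      linarith
    have e1 : (d : ℝ) / (2 * γ) = d / γ / 2 := by field_simp
    have e2 : (d : ℝ) / (4 * s) = d / (2 * s) / 2 := by field_simp; ring
    have hnum : 0 < d / (2 * s) - d / γ := by rw [e1, e2] at hlow; linarith
    set a := (1 / γ) / D with ha
    set e := (d / (2 * s) - d / γ) / D with he
    have ha0 : 0 < a := by positivity
    have he0 : 0 < e := by positivity
    have haγ : a * γ = 1 / D := by rw [ha]; field_simp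
    have had : a * d = (d / γ) / D := by rw [ha]; field_simp
    have h1D : 1 = D / D := (div_self hD0.ne').symm
    -- Chosen so that rmax - r ≥ d a (α + β)/e for every r ≤ α + β; one value then serves both α and
    -- β.
    set rmax := α + β + d * (a * (α + β)) / e with hr
    have hrpos : 0 < d * (a * (α + β)) / e := by positivity
    have hr' : ∀ r, 0 < r → r ≤ α + β → r ≤ rmax ∧ a * r ≤ e * ((rmax - r) / d) := by
      intro r hr0 hr1
      refine ⟨by rw [hr]; linarith, ?_⟩
      have h5 : d * (a * (α + β)) / e ≤ rmax - r := by rw [hr]; linarith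
      calc a * r ≤ a * (α + β) := by gcongr
        _ = e * ((d * (a * (α + β)) / e) / d) := by field_simp
        _ ≤ _ := by gcongr
    obtain ⟨rα1, rα2⟩ := hr' α hα (by linarith)
    obtain ⟨rβ1, rβ2⟩ := hr' β hβ (by linarith)
    refine ⟨rmax, rα1, rβ1, fun c M hc => ?_⟩
    -- `M` is not assumed positive.
    set M' := max M 1 with hM'
    have hM'0 : 0 < M' := lt_of_lt_of_le one_pos (le_max_right _ _)
    have hup : ∀ (n : ℕ) (h : ℝ) (k : ℕ), TuningOK d s γ c M n h k →
        c * (n : ℝ) ^ (-a) ≤ h ∧ h ≤ M' * (n : ℝ) ^ (-a) ∧ c * (n : ℝ) ^ e ≤ k ∧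
          k ≤ M' * (n : ℝ) ^ e := by
      intro n h k ht
      obtain ⟨⟨t1, t2⟩, t3, t4⟩ := ht.low hcase
      have e3 : -(1 / γ) / D = -a := by rw [ha]; ring
      rw [← hD, e3] at t1 t2
      rw [← hD, ← he] at t3 t4
      exact ⟨t1, t2.trans (by gcongr; exact le_max_left _ _), t3,
        t4.trans (by gcongr; exact le_max_left _ _)⟩
    constructor
    · obtain ⟨C, hC⟩ := exists_tuningRates_of_powers hd (q := 1 / D) (e := e) hα hβ hγ ha0 hc hM'0
        haγ.ge (by
          rw [had]
          have : (2 : ℝ) * (1 / D) + (d / γ) / D ≤ 1 := by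
            rw [show (2 : ℝ) * (1 / D) + (d / γ) / D = (2 + d / γ) / D by ring,
              div_le_one hD0, hD, e1]
            rw [e1] at hlow; linarith
          linarith) (by
          rw [had, he]
          have : (2 : ℝ) * (1 / D) + 2 * ((d / γ) / D) + (d / (2 * s) - d / γ) / D = 2 := by
            rw [show (2 : ℝ) * (1 / D) + 2 * ((d / γ) / D) + (d / (2 * s) - d / γ) / D =
              (2 + d / γ + d / (2 * s)) / D by ring, div_eq_iff hD0.ne', hD, e1, e2]
            ring
          linarith) (by
          rw [hαβ]
          have : 2 * s * a + 2 * s * e / d = 1 / D := by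
            rw [ha, he]; field_simp; ring
          exact this.ge) rα1 rβ1 rα2 rβ2
      refine ⟨C, fun n hn h k ht => ?_⟩
      obtain ⟨t1, t2, t3, t4⟩ := hup n h k ht
      exact hC n hn h k t1 t2 t3 t4
    · intro h₀ hh₀
      obtain ⟨C, hC0, hC⟩ := exists_one_le_rate ha0 (q := 1 / D) (by positivity) hM'0 hh₀
      exact ⟨C, hC0, fun n hn h k ht hle => hC n hn h (hup n h k ht).2.1 hle⟩
  · have hq : -1 / (2 + d / γ) = -(γ / (2 * γ + d)) := by field_simp
    have hrate : ∀ n, targetRate d s γ n = (n : ℝ) ^ (-(γ / (2 * γ + d))) :=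
      fun n => by rw [targetRate, if_neg hcase, hq]
    simp only [hrate]
    have hcase' := not_lt.1 hcase
    set a := 1 / (2 * γ + d) with ha
    set e := 2 * γ / (2 * γ + d) with he
    have ha0 : 0 < a := by positivity
    have he0 : 0 < e := by positivity
    have hae : 1 - a * d = e := by rw [ha, he]; field_simp; ring
    set rmax := α + β + d * (a * (α + β)) / e with hr
    have hrpos : 0 < d * (a * (α + β)) / e := by positivity
    have hr' : ∀ r, 0 < r → r ≤ α + β → r ≤ rmax ∧ a * r ≤ e * ((rmax - r) / d) := by
      intro r hr0 hr1
      refine ⟨by rw [hr]; linarith, ?_⟩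
      have h5 : d * (a * (α + β)) / e ≤ rmax - r := by rw [hr]; linarith
      calc a * r ≤ a * (α + β) := by gcongr
        _ = e * ((d * (a * (α + β)) / e) / d) := by field_simp
        _ ≤ _ := by gcongr
    obtain ⟨rα1, rα2⟩ := hr' α hα (by linarith)
    obtain ⟨rβ1, rβ2⟩ := hr' β hβ (by linarith)
    refine ⟨rmax, rα1, rβ1, fun c M hc => ?_⟩
    set M₁ := max M 1 with hM₁
    have hM₁1 : 1 ≤ M₁ := le_max_right _ _
    have hM₁0 : 0 < M₁ := lt_of_lt_of_le one_pos hM₁1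
    -- Here `k` is tied to n h^d, so the factor allowed for `h` enters to the power `d` on top of
    -- the one allowed for `k`.
    set M' := M₁ ^ (d + 1) with hM'
    have hM'0 : 0 < M' := by positivity
    have hM₁M' : M₁ ≤ M' := le_self_pow₀ hM₁1 (by omega)
    set c' := min c (c ^ (d + 1)) with hc'
    have hc'0 : 0 < c' := lt_min hc (by positivity)
    have hup : ∀ (n : ℕ), 2 ≤ n → ∀ (h : ℝ) (k : ℕ), TuningOK d s γ c M n h k →
        c' * (n : ℝ) ^ (-a) ≤ h ∧ h ≤ M' * (n : ℝ) ^ (-a) ∧ c' * (n : ℝ) ^ e ≤ k ∧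
          k ≤ M' * (n : ℝ) ^ e := by
      intro n hn h k ht
      have hx0 : (0 : ℝ) < n := by exact_mod_cast (by omega : 0 < n)
      obtain ⟨⟨t1, t2⟩, t3, t4⟩ := ht.high hcase'
      have e3 : -1 / (2 * γ + d) = -a := by rw [ha]; ring
      rw [e3] at t1 t2
      have hh0 : 0 < h := lt_of_lt_of_le (by positivity) t1
      have hpow : ∀ r : ℝ, (n : ℝ) * (r * (n : ℝ) ^ (-a)) ^ d = r ^ d * (n : ℝ) ^ e := by
        intro r
        rw [mul_pow, ← Real.rpow_natCast ((n : ℝ) ^ (-a)), ← Real.rpow_mul hx0.le, ← hae,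
          show (1 - a * d) = 1 + -a * d by ring, Real.rpow_add hx0, Real.rpow_one]
        ring
      have t2' : h ≤ M₁ * (n : ℝ) ^ (-a) := t2.trans (by gcongr; exact le_max_left _ _)
      refine ⟨le_trans (by gcongr; exact min_le_left _ _) t1, t2'.trans (by gcongr), ?_, ?_⟩
      · refine le_trans ?_ t3
        calc c' * (n : ℝ) ^ e ≤ c ^ (d + 1) * (n : ℝ) ^ e := by gcongr; exact min_le_right _ _
          _ = c * ((n : ℝ) * (c * (n : ℝ) ^ (-a)) ^ d) := by rw [hpow]; ring
          _ ≤ _ := by gcongr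
      · refine t4.trans ?_
        calc M * (n * h ^ d) ≤ M₁ * (n * (M₁ * (n : ℝ) ^ (-a)) ^ d) := by
              gcongr
              exact le_max_left _ _
          _ = _ := by rw [hpow, hM']; ring
    constructor
    · obtain ⟨C, hC⟩ := exists_tuningRates_of_powers hd (q := γ / (2 * γ + d)) (e := e) hα hβ hγ
        ha0 hc'0 hM'0 (by rw [ha]; apply le_of_eq; ring) (by rw [hae, he]; apply le_of_eq; ring)
        (by
          have : a * d = 1 - e := by linarith
          rw [this, he]; apply le_of_eq; ring) (by
          rw [hαβ, ha, he]
          have h5 : 2 * s * (1 / (2 * γ + d)) + 2 * s * (2 * γ / (2 * γ + d)) / d = 2 * s / d := by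
            field_simp; ring
          rw [h5, div_le_div_iff₀ (by positivity) hd']
          rw [div_le_iff₀ (by positivity)] at hcase'
          have h6 : s * (1 + d / (2 * γ)) * (4 * γ) = s * (4 * γ + 2 * d) := by field_simp; ring
          nlinarith) rα1 rβ1 rα2 rβ2
      refine ⟨C, fun n hn h k ht => ?_⟩
      obtain ⟨t1, t2, t3, t4⟩ := hup n hn h k ht
      exact hC n hn h k t1 t2 t3 t4
    · intro h₀ hh₀
      obtain ⟨C, hC0, hC⟩ := exists_one_le_rate ha0 (q := γ / (2 * γ + d)) (by positivity) hM'0 hh₀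
      exact ⟨C, hC0, fun n hn h k ht hle => hC n hn h (hup n hn h k ht).2.1 hle⟩

/-! ### Localized sample means and U-statistics -/

section
variable {d k : ℕ} {E : Type*} [MeasurableSpace E] {P : Measure E} {μ : Measure (Cov d)}
  {V : E → Cov d} {K : E → ℝ} {κ₀ : ℝ}

/-- `μ` is the law of `V` under `P` weighted by the kernel `K`, a multiple of an indicator. -/
structure LocalSample (P : Measure E) (μ : Measure (Cov d)) (V : E → Cov d) (K : E → ℝ)
    (κ₀ : ℝ) : Prop where
  measurable_V : Measurable V
  measurable_K : Measurable K
  K_nonneg : ∀ z, 0 ≤ K z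
  K_sq : ∀ z, K z ^ 2 = κ₀ * K z
  κ₀_nonneg : 0 ≤ κ₀
  integrable : ∀ φ : Cov d → ℝ, Measurable φ → Integrable φ μ →
    Integrable (fun z => K z * φ (V z)) P
  integral : ∀ φ : Cov d → ℝ, Measurable φ → ∫ z, K z * φ (V z) ∂P = ∫ v, φ v ∂μ

namespace LocalSample

lemma abs_mul_sq_le {x a B : ℝ} (hx : 0 ≤ x) (h : x * |a| ≤ B * x) :
    x ^ 2 * a ^ 2 ≤ B ^ 2 * x ^ 2 := by
  have h1 : (x * |a|) ^ 2 ≤ (B * x) ^ 2 := pow_le_pow_left₀ (by positivity) h 2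
  rw [mul_pow, sq_abs, mul_pow] at h1
  exact h1

/-- Of the two factors `K`, one is kept to localize and the other becomes `κ₀`. With κ₀ = h^(-d)
this is the origin of the effective sample size n h^d. -/
lemma memLp_second_moment (S : LocalSample P μ V K κ₀) {X : E → ℝ} (hX : Measurable X) {B : ℝ}
    (hB : ∀ᵐ z ∂P, K z * |X z| ≤ B * K z) {φ : Cov d → ℝ} (hφm : Measurable φ)
    (hφ : MemLp φ 2 μ) :
    MemLp (fun z => K z * X z * φ (V z)) 2 P ∧
      ∫ z, (K z * X z * φ (V z)) ^ 2 ∂P ≤ B ^ 2 * κ₀ * ∫ v, φ v ^ 2 ∂μ := by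
  have hmeas : Measurable (fun z => K z * X z * φ (V z)) :=
    (S.measurable_K.mul hX).mul (hφm.comp S.measurable_V)
  have hφ2 : Measurable fun v => φ v ^ 2 := hφm.pow_const 2
  have hdom : Integrable (fun z => B ^ 2 * κ₀ * (K z * φ (V z) ^ 2)) P :=
    (S.integrable (fun v => φ v ^ 2) hφ2 hφ.integrable_sq).const_mul _
  have hle : ∀ᵐ z ∂P, (K z * X z * φ (V z)) ^ 2 ≤ B ^ 2 * κ₀ * (K z * φ (V z) ^ 2) := by
    filter_upwards [hB] with z hz
    have h1 := abs_mul_sq_le (S.K_nonneg z) hz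
    rw [S.K_sq] at h1
    calc (K z * X z * φ (V z)) ^ 2 = (K z ^ 2 * X z ^ 2) * φ (V z) ^ 2 := by ring
      _ ≤ (B ^ 2 * (κ₀ * K z)) * φ (V z) ^ 2 := by
        rw [S.K_sq]; exact mul_le_mul_of_nonneg_right h1 (sq_nonneg _)
      _ = _ := by ring
  have hint : Integrable (fun z => (K z * X z * φ (V z)) ^ 2) P := by
    refine hdom.mono (hmeas.pow_const 2).aestronglyMeasurable ?_
    filter_upwards [hle] with z hz
    rw [Real.norm_of_nonneg (sq_nonneg _)]
    exact hz.trans (le_abs_self _)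
  refine ⟨(memLp_two_iff_integrable_sq hmeas.aestronglyMeasurable).2 hint, ?_⟩
  refine (integral_mono_ae hint hdom hle).trans (le_of_eq ?_)
  rw [integral_const_mul, S.integral (fun v => φ v ^ 2) hφ2]

variable [IsProbabilityMeasure P] {b : Cov d → Fin k → ℝ} {w : Cov d → ℝ}

lemma measurable_dotProduct (hbm : Measurable b) (u : Fin k → ℝ) :
    Measurable fun v => b v ⬝ᵥ u := by
  simp only [dotProduct]
  exact Finset.measurable_fun_sum _ fun i _ => ((measurable_pi_apply i).comp hbm).mul_const _

lemma measurable_wkernel (hbm : Measurable b) (μ : Measure (Cov d)) (w : Cov d → ℝ) :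
    Measurable fun q : Cov d × Cov d => wkernel b μ w q.1 q.2 := by
  simp only [wkernel_eq_sum]
  refine Finset.measurable_fun_sum _ fun i _ => Finset.measurable_fun_sum _ fun j _ => ?_
  exact ((((measurable_pi_apply i).comp hbm).comp measurable_fst).mul
    (((measurable_pi_apply j).comp hbm).comp measurable_snd)).const_mul _

/-- Tonelli: integrating out one point leaves at most c⁻¹ times the diagonal of the kernel, whose
integral is at most c⁻¹ k. -/
lemma integrable_kernel_sq (S : LocalSample P μ V K κ₀) (hbm : Measurable b)
    (hb : ∀ i, MemLp (fun v => b v i) 2 μ)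
    (hw : AEStronglyMeasurable w μ) {c B : ℝ} (hc0 : 0 < c) (hc : ∀ᵐ v ∂μ, c ≤ w v)
    (hB : ∀ᵐ v ∂μ, |w v| ≤ B) (huw : IsUnit (wgram b μ w)) :
    Integrable (fun q : E × E => K q.1 * K q.2 * wkernel b μ w (V q.1) (V q.2) ^ 2) (P.prod P) ∧
    ∫ q : E × E, K q.1 * K q.2 * wkernel b μ w (V q.1) (V q.2) ^ 2 ∂(P.prod P) ≤
      c⁻¹ ^ 2 * k := by
  have hkm := measurable_wkernel hbm μ w
  have hmeas : Measurable (fun q : E × E => K q.1 * K q.2 * wkernel b μ w (V q.1) (V q.2) ^ 2) :=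
    ((S.measurable_K.comp measurable_fst).mul (S.measurable_K.comp measurable_snd)).mul
      ((hkm.comp ((S.measurable_V.comp measurable_fst).prodMk
        (S.measurable_V.comp measurable_snd))).pow_const 2)
  have hsec : ∀ v, Measurable fun u => wkernel b μ w v u ^ 2 := fun v =>
    (hkm.comp (measurable_const.prodMk measurable_id)).pow_const 2
  have hsecI : ∀ v, Integrable (fun u => wkernel b μ w v u ^ 2) μ := fun v => by
    simp only [wkernel_comm b μ w v]
    exact (memLp_dotProduct hb _).integrable_sq
  have hin : ∀ z, Integrable (fun y => K z * K y * wkernel b μ w (V z) (V y) ^ 2) P := fun z =>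
    ((S.integrable _ (hsec (V z)) (hsecI _)).const_mul (K z)).congr
      (.of_forall fun y => by simp; ring)
  have hinv : ∀ z, ∫ y, K z * K y * wkernel b μ w (V z) (V y) ^ 2 ∂P =
      K z * ∫ u, wkernel b μ w (V z) u ^ 2 ∂μ := fun z => by
    rw [← S.integral _ (hsec (V z)), ← integral_const_mul]
    exact integral_congr_ae (.of_forall fun y => by simp; ring)
  have hdiagm : Measurable fun v => wkernel b μ w v v := hkm.comp (measurable_id.prodMk measurable_id)
  have hdiag : Integrable (fun z => K z * (c⁻¹ * wkernel b μ w (V z) (V z))) P :=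
    S.integrable (fun v => c⁻¹ * wkernel b μ w v v) (hdiagm.const_mul _)
      ((integrable_wkernel_self hb w).const_mul _)
  have hle : ∀ z, K z * ∫ u, wkernel b μ w (V z) u ^ 2 ∂μ ≤
      K z * (c⁻¹ * wkernel b μ w (V z) (V z)) := fun z =>
    mul_le_mul_of_nonneg_left (integral_wkernel_sq_le hb hw hc0 hc hB huw _) (S.K_nonneg z)
  have hnn : ∀ z y, ‖K z * K y * wkernel b μ w (V z) (V y) ^ 2‖ =
      K z * K y * wkernel b μ w (V z) (V y) ^ 2 := fun z y =>
    Real.norm_of_nonneg (mul_nonneg (mul_nonneg (S.K_nonneg z) (S.K_nonneg y)) (sq_nonneg _))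
  have hnorm : Integrable (fun z => ∫ y, ‖K z * K y * wkernel b μ w (V z) (V y) ^ 2‖ ∂P) P := by
    refine hdiag.mono hmeas.aestronglyMeasurable.norm.integral_prod_right' (.of_forall fun z => ?_)
    simp only [hnn, hinv]
    rw [Real.norm_of_nonneg (mul_nonneg (S.K_nonneg z) (integral_nonneg fun _ => sq_nonneg _))]
    exact (hle z).trans (le_abs_self _)
  have hI : Integrable (fun q : E × E => K q.1 * K q.2 * wkernel b μ w (V q.1) (V q.2) ^ 2)
      (P.prod P) :=
    (integrable_prod_iff hmeas.aestronglyMeasurable).2 ⟨.of_forall hin, hnorm⟩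
  refine ⟨hI, ?_⟩
  rw [integral_prod _ hI]
  simp only [hnn] at hnorm
  refine (integral_mono hnorm hdiag fun z => ?_).trans ?_
  · simp only [hinv]; exact hle z
  · rw [S.integral (fun v => c⁻¹ * wkernel b μ w v v) (hdiagm.const_mul _), integral_const_mul, sq,
      mul_assoc]
    exact mul_le_mul_of_nonneg_left (integral_wkernel_self_le hb hw hc0 hc hB huw)
      (inv_pos.2 hc0).le

/-- The `L₁` norm of the difference between a localized sample mean and its second-order
U-statistic correction. -/
lemma integral_abs_mean_sub_uStat_le [IsFiniteMeasure μ] (S : LocalSample P μ V K κ₀)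
    (hbm : Measurable b)
    (hb : ∀ i, MemLp (fun v => b v i) 2 μ)
    (hw : AEStronglyMeasurable w μ) {c B : ℝ} (hc0 : 0 < c) (hc : ∀ᵐ v ∂μ, c ≤ w v)
    (hB : ∀ᵐ v ∂μ, |w v| ≤ B) (huw : IsUnit (wgram b μ w)) {X₁ X₂ : E → ℝ}
    (hX₁ : Measurable X₁) (hX₂ : Measurable X₂) {B₁ B₂ : ℝ} (hB₁0 : 0 ≤ B₁)
    (hB₁ : ∀ᵐ z ∂P, K z * |X₁ z| ≤ B₁ * K z) (hB₂ : ∀ᵐ z ∂P, K z * |X₂ z| ≤ B₂ * K z)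
    {ξ g : Cov d → ℝ} (hξ : MemLp ξ 2 μ) (hg : MemLp g 2 μ)
    (hmean₁ : ∀ φ : Cov d → ℝ, Measurable φ → Integrable φ μ →
      ∫ z, K z * φ (V z) * X₁ z ∂P = ∫ v, ξ v * φ v ∂μ)
    (hmean₂ : ∀ φ : Cov d → ℝ, Measurable φ → Integrable φ μ →
      ∫ z, K z * φ (V z) * X₂ z ∂P = ∫ v, g v * φ v ∂μ) {n : ℕ} (hn : 2 ≤ n) :
    Integrable (fun z : Fin n → E => (1 / (n : ℝ)) * ∑ i, K (z i) * X₁ (z i) * X₂ (z i) -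
      (1 / ((n : ℝ) * ((n : ℝ) - 1))) * ∑ i, ∑ j ∈ Finset.univ.erase i,
        (K (z i) * X₁ (z i)) * wkernel b μ w (V (z i)) (V (z j)) * (K (z j) * X₂ (z j)))
      (Measure.pi fun _ : Fin n => P) ∧
    ∫ z : Fin n → E, |(1 / (n : ℝ)) * ∑ i, K (z i) * X₁ (z i) * X₂ (z i) -
      (1 / ((n : ℝ) * ((n : ℝ) - 1))) * ∑ i, ∑ j ∈ Finset.univ.erase i,
        (K (z i) * X₁ (z i)) * wkernel b μ w (V (z i)) (V (z j)) * (K (z j) * X₂ (z j))|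
      ∂(Measure.pi fun _ : Fin n => P) ≤
      |∫ z, K z * X₁ z * X₂ z ∂P - ∫ v, ξ v * wproj b μ w g v ∂μ| +
        Real.sqrt ((B₁ * B₂) ^ 2 * κ₀ * μ.real Set.univ / n) +
        4 * (Real.sqrt ((B₁ * B₂) ^ 2 * κ₀ ^ 2 * (c⁻¹ ^ 2 * k)) / n) +
        9 * Real.sqrt (κ₀ * c⁻¹ ^ 2 * (B₁ ^ 2 * l2norm μ g ^ 2 + B₂ ^ 2 * l2norm μ ξ ^ 2) / n) := by
  have hkm := measurable_wkernel hbm μ w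
  -- the linear term
  have hlin := S.memLp_second_moment (hX₁.mul hX₂) (B := B₁ * B₂) (by
    filter_upwards [hB₁, hB₂] with z h1 h2
    rw [Pi.mul_apply, abs_mul]
    calc K z * (|X₁ z| * |X₂ z|) = (K z * |X₁ z|) * |X₂ z| := by ring
      _ ≤ (B₁ * K z) * |X₂ z| := by gcongr
      _ = B₁ * (K z * |X₂ z|) := by ring
      _ ≤ B₁ * (B₂ * K z) := by gcongr
      _ = _ := by ring) (φ := fun _ => 1) measurable_const (memLp_const 1)
  simp only [Pi.mul_apply, mul_one, ← mul_assoc, one_pow, integral_const, smul_eq_mul] at hlin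
  obtain ⟨hf1, hf1V⟩ := hlin
  -- the kernel of the U-statistic
  set f : E × E → ℝ := fun q =>
    (K q.1 * X₁ q.1) * wkernel b μ w (V q.1) (V q.2) * (K q.2 * X₂ q.2) with hf_def
  have hkV : Measurable fun q : E × E => wkernel b μ w (V q.1) (V q.2) :=
    hkm.comp ((S.measurable_V.comp measurable_fst).prodMk (S.measurable_V.comp measurable_snd))
  have hfm : Measurable f :=
    (((S.measurable_K.mul hX₁).comp measurable_fst).mul hkV).mul
      ((S.measurable_K.mul hX₂).comp measurable_snd)
  obtain ⟨hkI, hkle⟩ := S.integrable_kernel_sq hbm hb hw hc0 hc hB huw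
  -- Both kernels are squared here, so κ₀² appears; it becomes the h^(-2d) of the quadratic
  -- variance.
  have hfle : ∀ᵐ q ∂(P.prod P), f q ^ 2 ≤ (B₁ * B₂) ^ 2 * κ₀ ^ 2 *
      (K q.1 * K q.2 * wkernel b μ w (V q.1) (V q.2) ^ 2) := by
    have h1 := Measure.quasiMeasurePreserving_fst (μ := P) (ν := P) |>.ae hB₁
    have h2 := Measure.quasiMeasurePreserving_snd (μ := P) (ν := P) |>.ae hB₂
    filter_upwards [h1, h2] with q h3 h4
    have h5 := abs_mul_sq_le (S.K_nonneg q.1) h3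
    have h6 := abs_mul_sq_le (S.K_nonneg q.2) h4
    have h7 := mul_le_mul h5 h6 (by positivity) (by positivity)
    calc f q ^ 2 = (K q.1 ^ 2 * X₁ q.1 ^ 2 * (K q.2 ^ 2 * X₂ q.2 ^ 2)) *
          wkernel b μ w (V q.1) (V q.2) ^ 2 := by rw [hf_def]; ring
      _ ≤ (B₁ ^ 2 * K q.1 ^ 2 * (B₂ ^ 2 * K q.2 ^ 2)) * wkernel b μ w (V q.1) (V q.2) ^ 2 := by
          gcongr
      _ = _ := by rw [S.K_sq, S.K_sq]; ring
  have hdom := hkI.const_mul ((B₁ * B₂) ^ 2 * κ₀ ^ 2)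
  have hf2I : Integrable (fun q => f q ^ 2) (P.prod P) := by
    refine hdom.mono (hfm.pow_const 2).aestronglyMeasurable ?_
    filter_upwards [hfle] with q hq
    rw [Real.norm_of_nonneg (sq_nonneg _)]
    exact hq.trans (le_abs_self _)
  have hfL : MemLp f 2 (P.prod P) :=
    (memLp_two_iff_integrable_sq hfm.aestronglyMeasurable).2 hf2I
  have hfV : ∫ q, f q ^ 2 ∂(P.prod P) ≤ (B₁ * B₂) ^ 2 * κ₀ ^ 2 * (c⁻¹ ^ 2 * k) := by
    refine (integral_mono_ae hf2I hdom hfle).trans ?_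
    rw [integral_const_mul]
    exact mul_le_mul_of_nonneg_left hkle (by have := S.κ₀_nonneg; positivity)
  -- its Hájek projections
  have hpm : ∀ φ : Cov d → ℝ, Measurable (wproj b μ w φ) := fun φ => measurable_dotProduct hbm _
  obtain ⟨hg1L, hg1V⟩ := S.memLp_second_moment hX₁ hB₁ (hpm g) (memLp_wproj hb w g)
  obtain ⟨hg2L, hg2V⟩ := S.memLp_second_moment hX₂ hB₂ (hpm ξ) (memLp_wproj hb w ξ)
  have hsecm : ∀ v, Measurable fun u => wkernel b μ w v u := fun v =>
    hkm.comp (measurable_const.prodMk measurable_id)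
  have hsecI : ∀ v, Integrable (fun u => wkernel b μ w v u) μ := fun v => by
    simp only [wkernel_comm b μ w v]
    exact (memLp_dotProduct hb _).integrable (by norm_num)
  have hH1 : ∀ x, ∫ y, f (x, y) ∂P = K x * X₁ x * wproj b μ w g (V x) := fun x => by
    have h1 := hmean₂ _ (hsecm (V x)) (hsecI (V x))
    have h2 := integral_wkernel_mul hb w hg (V x)
    rw [← h2, ← integral_congr_ae (.of_forall fun u => mul_comm (g u) (wkernel b μ w (V x) u)),
      ← h1, ← integral_const_mul]
    exact integral_congr_ae (.of_forall fun y => by simp only [hf_def]; ring)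
  have hH2 : ∀ y, ∫ x, f (x, y) ∂P = K y * X₂ y * wproj b μ w ξ (V y) := fun y => by
    have h1 := hmean₁ _ (hsecm (V y)) (hsecI (V y))
    have h2 := integral_wkernel_mul hb w hξ (V y)
    rw [← h2, ← integral_congr_ae (.of_forall fun u => mul_comm (ξ u) (wkernel b μ w (V y) u)),
      ← h1, ← integral_const_mul]
    refine integral_congr_ae (.of_forall fun x => ?_)
    simp only [hf_def]
    rw [wkernel_comm b μ w (V x)]
    ring
  set V₁ := κ₀ * c⁻¹ ^ 2 * (B₁ ^ 2 * l2norm μ g ^ 2 + B₂ ^ 2 * l2norm μ ξ ^ 2)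
  have hκ := S.κ₀_nonneg
  have hproj : ∀ {φ : Cov d → ℝ}, MemLp φ 2 μ →
      ∫ v, wproj b μ w φ v ^ 2 ∂μ ≤ c⁻¹ ^ 2 * l2norm μ φ ^ 2 := fun hφ => by
    rw [← l2norm_sq, ← mul_pow]
    exact pow_le_pow_left₀ (l2norm_nonneg _ _) (l2norm_wproj_le hb hw hc0 hc hB huw hφ) 2
  have hV1 : ∫ z, (K z * X₁ z * wproj b μ w g (V z)) ^ 2 ∂P ≤ V₁ := by
    refine hg1V.trans ?_
    calc B₁ ^ 2 * κ₀ * ∫ v, wproj b μ w g v ^ 2 ∂μ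
        ≤ B₁ ^ 2 * κ₀ * (c⁻¹ ^ 2 * l2norm μ g ^ 2) := by gcongr; exact hproj hg
      _ ≤ B₁ ^ 2 * κ₀ * (c⁻¹ ^ 2 * l2norm μ g ^ 2) + B₂ ^ 2 * κ₀ * (c⁻¹ ^ 2 * l2norm μ ξ ^ 2) :=
        le_add_of_nonneg_right (by positivity)
      _ = V₁ := by ring
  have hV1' : ∫ z, (K z * X₂ z * wproj b μ w ξ (V z)) ^ 2 ∂P ≤ V₁ := by
    refine hg2V.trans ?_
    calc B₂ ^ 2 * κ₀ * ∫ v, wproj b μ w ξ v ^ 2 ∂μ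
        ≤ B₂ ^ 2 * κ₀ * (c⁻¹ ^ 2 * l2norm μ ξ ^ 2) := by gcongr; exact hproj hξ
      _ ≤ B₁ ^ 2 * κ₀ * (c⁻¹ ^ 2 * l2norm μ g ^ 2) + B₂ ^ 2 * κ₀ * (c⁻¹ ^ 2 * l2norm μ ξ ^ 2) :=
        le_add_of_nonneg_left (by positivity)
      _ = V₁ := by ring
  obtain ⟨hUI, hU⟩ := integral_abs_uStat_sub_le hfL hg1L hg2L (.of_forall hH1) (.of_forall hH2)
    hfV hV1 hV1' hn
  obtain ⟨hMI, hM⟩ := integral_abs_mean_sub_le (n := n) hf1 (by omega)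
  -- The mean of the U-statistic, from integrating the first Hájek projection.
  have hm : ∫ z, K z * X₁ z * wproj b μ w g (V z) ∂P = ∫ v, ξ v * wproj b μ w g v ∂μ := by
    rw [← hmean₁ _ (hpm g) ((memLp_wproj hb w g).integrable (by norm_num))]
    exact integral_congr_ae (.of_forall fun z => by simp only; ring)
  rw [hm] at hUI hU
  set m₁ := ∫ z, K z * X₁ z * X₂ z ∂P
  set m₂ := ∫ v, ξ v * wproj b μ w g v ∂μ
  have e : ∀ z : Fin n → E, (1 / (n : ℝ)) * ∑ i, K (z i) * X₁ (z i) * X₂ (z i) -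
      (1 / ((n : ℝ) * ((n : ℝ) - 1))) * ∑ i, ∑ j ∈ Finset.univ.erase i,
        (K (z i) * X₁ (z i)) * wkernel b μ w (V (z i)) (V (z j)) * (K (z j) * X₂ (z j)) =
      (m₁ - m₂) + (((1 / (n : ℝ)) * ∑ i, K (z i) * X₁ (z i) * X₂ (z i) - m₁) -
        ((1 / ((n : ℝ) * ((n : ℝ) - 1))) * ∑ i, ∑ j ∈ Finset.univ.erase i, f (z i, z j) - m₂)) :=
    fun z => by simp only [hf_def]; ring
  simp only [e]
  have hI := (integrable_const (μ := Measure.pi fun _ : Fin n => P) (m₁ - m₂)).fun_add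
    (integrable_sub_fun hMI hUI)
  refine ⟨hI, ?_⟩
  calc _ ≤ ∫ z : Fin n → E, (|m₁ - m₂| +
        (|(1 / (n : ℝ)) * ∑ i, K (z i) * X₁ (z i) * X₂ (z i) - m₁| +
        |(1 / ((n : ℝ) * ((n : ℝ) - 1))) * ∑ i, ∑ j ∈ Finset.univ.erase i, f (z i, z j) - m₂|))
        ∂(Measure.pi fun _ : Fin n => P) := by
        refine integral_mono hI.abs ((integrable_const _).add (hMI.abs.add hUI.abs)) fun z => ?_
        exact (abs_add_le _ _).trans (add_le_add le_rfl (abs_sub _ _))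
    _ ≤ _ := by
        rw [integral_add (integrable_const _) (hMI.abs.fun_add hUI.abs),
          integral_add hMI.abs hUI.abs]
        simp only [integral_const, probReal_univ, one_smul]
        have h8 : Real.sqrt ((∫ z, (K z * X₁ z * X₂ z) ^ 2 ∂P) / n) ≤
            Real.sqrt ((B₁ * B₂) ^ 2 * κ₀ * μ.real Set.univ / n) := by gcongr
        linarith

end LocalSample
end

/-! ### Localization of the law of the covariates -/

section
variable {d : ℕ} {P : Measure (Obs d)} {x₀ : Cov d} {h : ℝ}

lemma measurable_cov : Measurable (cov : Obs d → Cov d) := measurable_fst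

lemma measurable_trt : Measurable (trt : Obs d → ℝ) :=
  Measurable.ite (measurable_fst.comp measurable_snd (MeasurableSet.singleton true))
    measurable_const measurable_const

lemma measurable_out : Measurable (out : Obs d → ℝ) := measurable_snd.comp measurable_snd

lemma trt_mem (z : Obs d) : trt z = 0 ∨ trt z = 1 := by
  unfold trt; split_ifs <;> simp

lemma continuous_toUnit (x₀ : Cov d) (h : ℝ) : Continuous (toUnit x₀ h) := by
  unfold toUnit
  refine (PiLp.continuous_toLp 2 _).comp (continuous_pi fun j => ?_)
  fun_prop

lemma continuous_fromUnit (x₀ : Cov d) (h : ℝ) : Continuous (fromUnit x₀ h) := by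
  unfold fromUnit
  refine (PiLp.continuous_toLp 2 _).comp (continuous_pi fun j => ?_)
  fun_prop

lemma measurable_kern (x₀ : Cov d) (h : ℝ) : Measurable (kern x₀ h) := by
  have : kern x₀ h = (Metric.closedBall x₀ (h / 2)).indicator fun _ => 1 / h ^ d := rfl
  rw [this]
  exact measurable_const.indicator measurableSet_closedBall

lemma kern_of_mem {x : Cov d} (hx : x ∈ Metric.closedBall x₀ (h / 2)) :
    kern x₀ h x = 1 / h ^ d := Set.indicator_of_mem hx _

lemma kern_of_notMem {x : Cov d} (hx : x ∉ Metric.closedBall x₀ (h / 2)) :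
    kern x₀ h x = 0 := Set.indicator_of_notMem hx _

lemma locMeasure_map (P : Measure (Obs d)) (x₀ : Cov d) (h : ℝ) :
    locMeasure (P.map cov) x₀ h = ENNReal.ofReal (1 / h ^ d) •
      (P.restrict (cov ⁻¹' Metric.closedBall x₀ (h / 2))).map fun z => toUnit x₀ h (cov z) := by
  rw [locMeasure, Measure.restrict_map measurable_cov measurableSet_closedBall,
    Measure.map_map (continuous_toUnit x₀ h).measurable measurable_cov]
  rfl

instance isFiniteMeasure_locMeasure (F : Measure (Cov d)) [IsFiniteMeasure F] (x₀ : Cov d) (h : ℝ) :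
    IsFiniteMeasure (locMeasure F x₀ h) := by
  unfold locMeasure
  exact Measure.smul_finite _ ENNReal.ofReal_ne_top

lemma toUnit_mem_unitCube (hh : 0 < h) {x : Cov d} (hx : x ∈ Metric.closedBall x₀ (h / 2)) :
    toUnit x₀ h x ∈ unitCube d := by
  intro j
  have h1 : |x j - x₀ j| ≤ h / 2 := by
    have := PiLp.norm_apply_le (x - x₀) j
    rw [Metric.mem_closedBall, dist_eq_norm] at hx
    simpa using this.trans hx
  have h2 : |(x j - x₀ j) / h| ≤ 1 / 2 := by
    rw [abs_div, abs_of_pos hh, div_le_iff₀ hh]; linarith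
  rw [abs_le] at h2
  simp only [toUnit, Set.mem_Icc]
  constructor <;> linarith

lemma ae_locMeasure_iff {F : Measure (Cov d)} (hh : 0 < h) {p : Cov d → Prop}
    (hp : MeasurableSet {v | p v}) :
    (∀ᵐ v ∂locMeasure F x₀ h, p v) ↔
      ∀ᵐ x ∂F, x ∈ Metric.closedBall x₀ (h / 2) → p (toUnit x₀ h x) := by
  have h1 : ENNReal.ofReal (1 / h ^ d) ≠ 0 := by
    rw [ne_eq, ENNReal.ofReal_eq_zero, not_le]; positivity
  rw [locMeasure, Measure.ae_ennreal_smul_measure_iff h1,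
    ae_map_iff (continuous_toUnit x₀ h).aemeasurable hp,
    ae_restrict_iff' measurableSet_closedBall]

lemma ae_locMeasure {F : Measure (Cov d)} (hF : ∀ᵐ x ∂F, x ∈ unitCube d) (hh : 0 < h) :
    ∀ᵐ v ∂locMeasure F x₀ h, v ∈ unitCube d ∧ fromUnit x₀ h v ∈ unitCube d ∧
      ‖fromUnit x₀ h v - x₀‖ ≤ h / 2 := by
  have m1 := measurableSet_unitCube d
  have m2 : MeasurableSet {v : Cov d | fromUnit x₀ h v ∈ unitCube d} :=
    (continuous_fromUnit x₀ h).measurable m1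
  have m3 : MeasurableSet {v : Cov d | ‖fromUnit x₀ h v - x₀‖ ≤ h / 2} :=
    measurableSet_le ((continuous_fromUnit x₀ h).measurable.sub_const _).norm measurable_const
  refine (ae_locMeasure_iff hh (m1.inter (m2.inter m3))).2 ?_
  filter_upwards [hF] with x hx hxb
  refine ⟨toUnit_mem_unitCube hh hxb, ?_⟩
  rw [Set.mem_inter_iff, Set.mem_ofPred_eq, Set.mem_ofPred_eq, fromUnit_toUnit x₀ hh.ne']
  exact ⟨hx, by rwa [Metric.mem_closedBall, dist_eq_norm] at hxb⟩

lemma ae_locMeasure_mem_unitCube (F : Measure (Cov d)) (hh : 0 < h) :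
    ∀ᵐ v ∂locMeasure F x₀ h, v ∈ unitCube d :=
  (ae_locMeasure_iff hh (measurableSet_unitCube d)).2
    (.of_forall fun _ hx => toUnit_mem_unitCube hh hx)

lemma localSample (P : Measure (Obs d)) [IsProbabilityMeasure P] (hh : 0 < h) :
    LocalSample P (locMeasure (P.map cov) x₀ h) (fun z => toUnit x₀ h (cov z))
      (fun z => kern x₀ h (cov z)) (1 / h ^ d) := by
  have hV : Measurable fun z : Obs d => toUnit x₀ h (cov z) :=
    (continuous_toUnit x₀ h).measurable.comp measurable_cov
  have hball : MeasurableSet (cov ⁻¹' Metric.closedBall x₀ (h / 2) : Set (Obs d)) :=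
    measurable_cov measurableSet_closedBall
  have hk : ∀ (φ : Cov d → ℝ) (z : Obs d), kern x₀ h (cov z) * φ (toUnit x₀ h (cov z)) =
      (1 / h ^ d) * (cov ⁻¹' Metric.closedBall x₀ (h / 2)).indicator
        (fun z => φ (toUnit x₀ h (cov z))) z := by
    intro φ z
    by_cases hz : cov z ∈ Metric.closedBall x₀ (h / 2)
    · rw [kern_of_mem hz, Set.indicator_of_mem (Set.mem_preimage.2 hz)]
    · rw [kern_of_notMem hz, Set.indicator_of_notMem (by simpa using hz)]; simp
  refine ⟨hV, (measurable_kern x₀ h).comp measurable_cov, fun z => ?_, fun z => ?_, by positivity,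
    fun φ hφm hφ => ?_, fun φ hφm => ?_⟩
  · by_cases hz : cov z ∈ Metric.closedBall x₀ (h / 2)
    · rw [kern_of_mem hz]; positivity
    · rw [kern_of_notMem hz]
  · by_cases hz : cov z ∈ Metric.closedBall x₀ (h / 2)
    · rw [kern_of_mem hz]; ring
    · rw [kern_of_notMem hz]; ring
  · simp only [hk]
    refine Integrable.const_mul ?_ _
    rw [integrable_indicator_iff hball]
    rw [locMeasure_map] at hφ
    have h1 : ENNReal.ofReal (1 / h ^ d) ≠ 0 := by
      rw [ne_eq, ENNReal.ofReal_eq_zero, not_le]; positivity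
    rw [integrable_smul_measure h1 ENNReal.ofReal_ne_top] at hφ
    exact hφ.comp_measurable hV
  · simp only [hk]
    rw [integral_const_mul, integral_indicator hball, locMeasure_map, integral_smul_measure,
      integral_map hV.aemeasurable hφm.aestronglyMeasurable,
      ENNReal.toReal_ofReal (by positivity), smul_eq_mul]

/-! ### Conditional moments of the treatment and the outcome -/

variable {π μ₀ μ₁ : Cov d → ℝ}

lemma integrable_trt (P : Measure (Obs d)) [IsProbabilityMeasure P] : Integrable trt P :=
  Integrable.of_bound measurable_trt.aestronglyMeasurable 1
    (.of_forall fun z => by rcases trt_mem z with h | h <;> simp [h])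

lemma integrable_mul_trt {f : Obs d → ℝ} (hf : Integrable f P) :
    Integrable (fun z => f z * trt z) P :=
  hf.mul_bdd (c := 1) measurable_trt.aestronglyMeasurable
    (.of_forall fun z => by rcases trt_mem z with h | h <;> simp [h])

/-- The tower property given X: the known factor is pulled out of the conditional expectation of A.
-/
lemma IsModel.integral_mul_trt [IsProbabilityMeasure P] (hM : IsModel P π μ₀ μ₁) {u : Cov d → ℝ}
    (hu : Measurable u)
    (hi : Integrable (fun z => u (cov z)) P) :
    ∫ z, u (cov z) * trt z ∂P = ∫ z, u (cov z) * π (cov z) ∂P := by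
  have hle := (measurable_cov (d := d)).comap_le
  have hu' : StronglyMeasurable[MeasurableSpace.comap (cov : Obs d → Cov d)
      (inferInstance : MeasurableSpace (Cov d))]
      (fun z : Obs d => u (cov z)) :=
    (hu.comp (comap_measurable _)).stronglyMeasurable
  have h1 := condExp_mul_of_stronglyMeasurable_left (μ := P) (g := trt) hu'
    (integrable_mul_trt hi) (integrable_trt P)
  have h2 := integral_condExp hle (μ := P) (f := (fun z : Obs d => u (cov z)) * trt)
  rw [show ∫ z, u (cov z) * trt z ∂P = ∫ z, ((fun z : Obs d => u (cov z)) * trt : Obs d → ℝ) z ∂P from rfl,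
    ← h2]
  refine integral_congr_ae ?_
  filter_upwards [h1, hM.propensity] with z h3 h4
  rw [h3, Pi.mul_apply, h4]

/-- The tower property given (X, A), with the regression function written as μ₀ + A τ. -/
lemma IsModel.integral_mul_out [IsProbabilityMeasure P] (hM : IsModel P π μ₀ μ₁) {B : ℝ}
    (hY : ∀ᵐ z ∂P, |out z| ≤ B)
    {ψ : Cov d × ℝ → ℝ} (hψ : Measurable ψ) (hi : Integrable (fun z => ψ (cov z, trt z)) P) :
    ∫ z, ψ (cov z, trt z) * out z ∂P =
      ∫ z, ψ (cov z, trt z) * (μ₀ (cov z) + trt z * cate μ₀ μ₁ (cov z)) ∂P := by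
  have hle := (measurable_cov.prodMk (measurable_trt (d := d))).comap_le
  have hu' : StronglyMeasurable[MeasurableSpace.comap (fun z : Obs d => (cov z, trt z))
      (inferInstance : MeasurableSpace (Cov d × ℝ))] (fun z : Obs d => ψ (cov z, trt z)) :=
    (hψ.comp (comap_measurable _)).stronglyMeasurable
  have hout : Integrable out P := Integrable.of_bound measurable_out.aestronglyMeasurable B
    (by simpa using hY)
  have h1 := condExp_mul_of_stronglyMeasurable_left (μ := P) (g := out) hu'
    (hi.mul_bdd (c := B) measurable_out.aestronglyMeasurable (by simpa using hY)) hout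
  have h2 := integral_condExp hle (μ := P) (f := (fun z : Obs d => ψ (cov z, trt z)) * out)
  rw [show ∫ z, ψ (cov z, trt z) * out z ∂P =
    ∫ z, ((fun z : Obs d => ψ (cov z, trt z)) * out : Obs d → ℝ) z ∂P from rfl, ← h2]
  refine integral_congr_ae ?_
  filter_upwards [h1, hM.regression] with z h3 h4
  rw [h3, Pi.mul_apply, h4]
  congr 1
  by_cases hz : z.2.1 <;> simp [hz, trt, cate]

lemma integrable_mul_of_bound_unitCube (hX : ∀ᵐ z ∂P, cov z ∈ unitCube d) {f : Obs d → ℝ}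
    (hf : Integrable f P) {g : Cov d → ℝ} (hg : Measurable g) {B : ℝ}
    (hB : ∀ x ∈ unitCube d, |g x| ≤ B) : Integrable (fun z => f z * g (cov z)) P := by
  refine hf.mul_bdd (c := B) (hg.comp measurable_cov).aestronglyMeasurable ?_
  filter_upwards [hX] with z hz using hB _ hz

/-- Partialling out the treatment. -/
lemma IsModel.integral_mul_trt_sub [IsProbabilityMeasure P] (hM : IsModel P π μ₀ μ₁)
    {p u : Cov d → ℝ}
    (hu : Measurable u) (hp : Measurable p) {B : ℝ} (hpB : ∀ x ∈ unitCube d, |p x| ≤ B)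
    (hπB : ∀ x ∈ unitCube d, |π x| ≤ B)
    (hi : Integrable (fun z => u (cov z)) P) :
    ∫ z, u (cov z) * (trt z - p (cov z)) ∂P = ∫ z, u (cov z) * (π (cov z) - p (cov z)) ∂P := by
  have i1 := integrable_mul_of_bound_unitCube hM.cov_mem hi hp hpB
  have i2 := integrable_mul_of_bound_unitCube hM.cov_mem hi hM.measurable_pi hπB
  simp only [mul_sub]
  rw [integral_sub (integrable_mul_trt hi) i1, integral_sub i2 i1, hM.integral_mul_trt hu hi]

/-- Partialling out the outcome. -/
lemma IsModel.integral_mul_out_sub [IsProbabilityMeasure P] (hM : IsModel P π μ₀ μ₁)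
    {m T u : Cov d → ℝ}
    (hu : Measurable u) (hm : Measurable m) (hT : Measurable T) {B : ℝ}
    (hY : ∀ᵐ z ∂P, |out z| ≤ B)
    (hmB : ∀ x ∈ unitCube d, |m x| ≤ B) (hTB : ∀ x ∈ unitCube d, |T x| ≤ B)
    (hπB : ∀ x ∈ unitCube d, |π x| ≤ B) (hμB : ∀ x ∈ unitCube d, |μ₀ x| ≤ B)
    (hτB : ∀ x ∈ unitCube d, |cate μ₀ μ₁ x| ≤ B) (hi : Integrable (fun z => u (cov z)) P) :
    ∫ z, u (cov z) * (out z - m (cov z) - trt z * T (cov z)) ∂P =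
      ∫ z, u (cov z) * (μ₀ (cov z) - m (cov z) +
        π (cov z) * (cate μ₀ μ₁ (cov z) - T (cov z))) ∂P := by
  have hX := hM.cov_mem
  have hτm : Measurable (cate μ₀ μ₁) := hM.measurable_mu₁.sub hM.measurable_mu₀
  have iu : ∀ {g : Cov d → ℝ}, Measurable g → (∀ x ∈ unitCube d, |g x| ≤ B) →
      Integrable (fun z => u (cov z) * g (cov z)) P := fun hg hgB =>
    integrable_mul_of_bound_unitCube hX hi hg hgB
  have iY : Integrable (fun z => u (cov z) * out z) P :=
    hi.mul_bdd (c := B) measurable_out.aestronglyMeasurable (by simpa using hY)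
  have iπ : ∀ {g : Cov d → ℝ}, Measurable g → (∀ x ∈ unitCube d, |g x| ≤ B) →
      Integrable (fun z => (u (cov z) * g (cov z)) * π (cov z)) P := fun hg hgB =>
    integrable_mul_of_bound_unitCube hX (iu hg hgB) hM.measurable_pi hπB
  have e1 := hM.integral_mul_out hY (ψ := fun q => u q.1) (hu.comp measurable_fst) hi
  have e2 := hM.integral_mul_trt (u := fun x => u x * cate μ₀ μ₁ x) (hu.mul hτm) (iu hτm hτB)
  have e3 := hM.integral_mul_trt (u := fun x => u x * T x) (hu.mul hT) (iu hT hTB)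
  have s1 : ∫ z, u (cov z) * (out z - m (cov z) - trt z * T (cov z)) ∂P =
      ∫ z, u (cov z) * out z ∂P - ∫ z, u (cov z) * m (cov z) ∂P -
        ∫ z, u (cov z) * T (cov z) * trt z ∂P := by
    rw [← integral_sub iY (iu hm hmB), ← integral_sub (integrable_sub_fun iY (iu hm hmB))
      (integrable_mul_trt (iu hT hTB))]
    exact integral_congr_ae (.of_forall fun z => by simp only; ring)
  have s2 : ∫ z, u (cov z) * (μ₀ (cov z) + trt z * cate μ₀ μ₁ (cov z)) ∂P =
      ∫ z, u (cov z) * μ₀ (cov z) ∂P + ∫ z, u (cov z) * cate μ₀ μ₁ (cov z) * trt z ∂P := by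
    rw [← integral_add (iu hM.measurable_mu₀ hμB) (integrable_mul_trt (iu hτm hτB))]
    exact integral_congr_ae (.of_forall fun z => by simp only; ring)
  rw [s1, e1, s2, e2, e3]
  rw [← integral_add (iu hM.measurable_mu₀ hμB) (iπ hτm hτB),
    ← integral_sub ((iu hM.measurable_mu₀ hμB).fun_add (iπ hτm hτB)) (iu hm hmB),
    ← integral_sub (integrable_sub_fun ((iu hM.measurable_mu₀ hμB).fun_add (iπ hτm hτB))
      (iu hm hmB)) (iπ hT hTB)]
  exact integral_congr_ae (.of_forall fun z => by simp only; ring)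

/-- The mean of the product of the two residuals. -/
lemma IsModel.integral_mul_residuals [IsProbabilityMeasure P] (hM : IsModel P π μ₀ μ₁)
    {p m T u : Cov d → ℝ}
    (hu : Measurable u) (hp : Measurable p) (hm : Measurable m) (hT : Measurable T) {B : ℝ}
    (hY : ∀ᵐ z ∂P, |out z| ≤ B) (hpB : ∀ x ∈ unitCube d, |p x| ≤ B)
    (hmB : ∀ x ∈ unitCube d, |m x| ≤ B) (hTB : ∀ x ∈ unitCube d, |T x| ≤ B)
    (hπB : ∀ x ∈ unitCube d, |π x| ≤ B) (hμB : ∀ x ∈ unitCube d, |μ₀ x| ≤ B)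
    (hτB : ∀ x ∈ unitCube d, |cate μ₀ μ₁ x| ≤ B) (hi : Integrable (fun z => u (cov z)) P) :
    ∫ z, u (cov z) * (trt z - p (cov z)) * (out z - m (cov z) - trt z * T (cov z)) ∂P =
      ∫ z, u (cov z) * ((π (cov z) - p (cov z)) * (μ₀ (cov z) - m (cov z) +
        π (cov z) * (cate μ₀ μ₁ (cov z) - T (cov z))) +
        π (cov z) * (1 - π (cov z)) * (cate μ₀ μ₁ (cov z) - T (cov z))) ∂P := by
  have hX := hM.cov_mem
  have hμm := hM.measurable_mu₀
  have hτm : Measurable (cate μ₀ μ₁) := hM.measurable_mu₁.sub hM.measurable_mu₀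
  have iu : ∀ {g : Cov d → ℝ}, Measurable g → (∀ x ∈ unitCube d, |g x| ≤ B) →
      Integrable (fun z => u (cov z) * g (cov z)) P := fun hg hgB =>
    integrable_mul_of_bound_unitCube hX hi hg hgB
  have iW : Integrable (fun z => u (cov z) * (trt z - p (cov z))) P :=
    ((integrable_mul_trt hi).sub (iu hp hpB)).congr (.of_forall fun z => by simp; ring)
  have e1 := hM.integral_mul_out hY (ψ := fun q => u q.1 * (q.2 - p q.1))
    ((hu.comp measurable_fst).mul (measurable_snd.sub (hp.comp measurable_fst))) iW
  have iWY : Integrable (fun z => u (cov z) * (trt z - p (cov z)) * out z) P :=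
    iW.mul_bdd (c := B) measurable_out.aestronglyMeasurable (by simpa using hY)
  have iWg : ∀ {g : Cov d → ℝ}, Measurable g → (∀ x ∈ unitCube d, |g x| ≤ B) →
      Integrable (fun z => u (cov z) * (trt z - p (cov z)) * g (cov z)) P := fun hg hgB =>
    integrable_mul_of_bound_unitCube hX iW hg hgB
  have iWgA : ∀ {g : Cov d → ℝ}, Measurable g → (∀ x ∈ unitCube d, |g x| ≤ B) →
      Integrable (fun z => u (cov z) * (trt z - p (cov z)) * g (cov z) * trt z) P :=
    fun hg hgB => integrable_mul_trt (iWg hg hgB)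
  have s1 : ∫ z, u (cov z) * (trt z - p (cov z)) * (out z - m (cov z) - trt z * T (cov z)) ∂P =
      ∫ z, u (cov z) * (trt z - p (cov z)) * (μ₀ (cov z) + trt z * cate μ₀ μ₁ (cov z)) ∂P -
      ∫ z, u (cov z) * (trt z - p (cov z)) * (m (cov z) + trt z * T (cov z)) ∂P := by
    have i1 : Integrable (fun z => u (cov z) * (trt z - p (cov z)) *
        (m (cov z) + trt z * T (cov z))) P :=
      ((iWg hm hmB).add (iWgA hT hTB)).congr (.of_forall fun z => by simp; ring)
    rw [← e1, ← integral_sub iWY i1]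
    exact integral_congr_ae (.of_forall fun z => by simp only; ring)
  have iq : ∀ {g q : Cov d → ℝ}, Measurable g → (∀ x ∈ unitCube d, |g x| ≤ B) →
      Measurable q → (∀ x ∈ unitCube d, |q x| ≤ B) →
      Integrable (fun z => u (cov z) * g (cov z) * q (cov z)) P := fun hg hgB hq hqB =>
    integrable_mul_of_bound_unitCube hX (iu hg hgB) hq hqB
  -- for `g` a function of the covariates, the two means that are needed
  have key : ∀ {g G : Cov d → ℝ}, Measurable g → (∀ x ∈ unitCube d, |g x| ≤ B) →
      Measurable G → (∀ x ∈ unitCube d, |G x| ≤ B) →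
      ∫ z, u (cov z) * (trt z - p (cov z)) * (g (cov z) + trt z * G (cov z)) ∂P =
      ∫ z, u (cov z) * ((π (cov z) - p (cov z)) * g (cov z) +
        π (cov z) * (1 - p (cov z)) * G (cov z)) ∂P := by
    intro g G hg hgB hG hGB
    -- Since A² = A, the product is affine in A and its mean needs only the propensity score.
    have h1 : ∀ z : Obs d, u (cov z) * (trt z - p (cov z)) * (g (cov z) + trt z * G (cov z)) =
        (u (cov z) * g (cov z) + u (cov z) * G (cov z) - u (cov z) * G (cov z) * p (cov z)) *
          trt z - u (cov z) * g (cov z) * p (cov z) := fun z => by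
      rcases trt_mem z with h | h <;> rw [h] <;> ring
    have h2 : ∀ z : Obs d, u (cov z) * ((π (cov z) - p (cov z)) * g (cov z) +
        π (cov z) * (1 - p (cov z)) * G (cov z)) =
        (u (cov z) * g (cov z) + u (cov z) * G (cov z) - u (cov z) * G (cov z) * p (cov z)) *
          π (cov z) - u (cov z) * g (cov z) * p (cov z) := fun z => by ring
    have i1 : Integrable (fun z => u (cov z) * g (cov z) + u (cov z) * G (cov z) -
        u (cov z) * G (cov z) * p (cov z)) P :=
      ((iu hg hgB).add (iu hG hGB)).sub (iq hG hGB hp hpB)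
    simp only [h1, h2]
    rw [integral_sub (integrable_mul_trt i1) (iq hg hgB hp hpB),
      integral_sub (integrable_mul_of_bound_unitCube hX i1 hM.measurable_pi hπB)
        (iq hg hgB hp hpB),
      hM.integral_mul_trt (u := fun x => u x * g x + u x * G x - u x * G x * p x)
        (((hu.mul hg).add (hu.mul hG)).sub ((hu.mul hG).mul hp)) i1]
  have ik : ∀ {g G : Cov d → ℝ}, Measurable g → (∀ x ∈ unitCube d, |g x| ≤ B) →
      Measurable G → (∀ x ∈ unitCube d, |G x| ≤ B) →
      Integrable (fun z => u (cov z) * ((π (cov z) - p (cov z)) * g (cov z) +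
        π (cov z) * (1 - p (cov z)) * G (cov z))) P := by
    intro g G hg hgB hG hGB
    have i1 := iq hg hgB hM.measurable_pi hπB
    have i2 := iq hg hgB hp hpB
    have i3 := iq hG hGB hM.measurable_pi hπB
    have i4 := integrable_mul_of_bound_unitCube hX i3 hp hpB
    exact ((i1.sub i2).add (i3.sub i4)).congr (.of_forall fun z => by simp; ring)
  -- The stated form follows from π (1 - p) = π (π - p) + π (1 - π): the product of the conditional
  -- means plus the conditional variance of A times τ - T.
  rw [s1, key hμm hμB hτm hτB, key hm hmB hT hTB,
    ← integral_sub (ik hμm hμB hτm hτB) (ik hm hmB hT hTB)]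
  exact integral_congr_ae (.of_forall fun z => by simp only; ring)

end

/-! ### Consequences of eigenvalue bounds -/

section
variable {ι : Type*} [Fintype ι] {Q : Matrix ι ι ℝ} {c M : ℝ}

/-- The spectrum of Q - c is that of Q shifted by -c, so this symmetric matrix is positive
semidefinite. -/
lemma EigBounded.le_dotProduct [DecidableEq ι] (hQ : Q.transpose = Q) (h : EigBounded c M Q)
    (u : ι → ℝ) :
    c * (u ⬝ᵥ u) ≤ u ⬝ᵥ Q.mulVec u := by
  have hH : (Q - c • (1 : Matrix ι ι ℝ)).IsHermitian := by
    rw [Matrix.IsHermitian, Matrix.conjTranspose_eq_transpose_of_trivial]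
    simp [hQ]
  have hP : (Q - c • (1 : Matrix ι ι ℝ)).PosSemidef := by
    rw [hH.posSemidef_iff_eigenvalues_nonneg]
    intro i
    have h1 := hH.eigenvalues_mem_spectrum_real i
    have h2 : hH.eigenvalues i + c ∈ spectrum ℝ Q := by
      generalize hH.eigenvalues i = e at h1
      rw [← Algebra.algebraMap_eq_smul_one, ← spectrum.sub_singleton_eq] at h1
      obtain ⟨t, ht, c', hc', he⟩ := h1
      rw [Set.mem_singleton_iff] at hc'
      have he' : t = e + c := by
        have : t - c' = e := he
        linarith
      rwa [← he']
    have := (h _ h2).1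
    simp only [Pi.zero_apply]; linarith
  have h3 := hP.dotProduct_mulVec_nonneg u
  simp only [star_trivial, Matrix.sub_mulVec, Matrix.smul_mulVec, Matrix.one_mulVec,
    dotProduct_sub, dotProduct_smul, smul_eq_mul] at h3
  linarith

lemma EigBounded.dotProduct_le [DecidableEq ι] (hQ : Q.transpose = Q) (h : EigBounded c M Q)
    (u : ι → ℝ) :
    u ⬝ᵥ Q.mulVec u ≤ M * (u ⬝ᵥ u) := by
  have hH : (M • (1 : Matrix ι ι ℝ) - Q).IsHermitian := by
    rw [Matrix.IsHermitian, Matrix.conjTranspose_eq_transpose_of_trivial]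
    simp [hQ]
  have hP : (M • (1 : Matrix ι ι ℝ) - Q).PosSemidef := by
    rw [hH.posSemidef_iff_eigenvalues_nonneg]
    intro i
    have h1 := hH.eigenvalues_mem_spectrum_real i
    have h2 : M - hH.eigenvalues i ∈ spectrum ℝ Q := by
      generalize hH.eigenvalues i = e at h1
      rw [← Algebra.algebraMap_eq_smul_one, ← spectrum.singleton_sub_eq] at h1
      obtain ⟨c', hc', t, ht, he⟩ := h1
      rw [Set.mem_singleton_iff] at hc'
      have he' : t = M - e := by
        have : c' - t = e := he
        linarith
      rwa [← he']
    have := (h _ h2).2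
    simp only [Pi.zero_apply]; linarith
  have h3 := hP.dotProduct_mulVec_nonneg u
  simp only [star_trivial, Matrix.sub_mulVec, Matrix.smul_mulVec, Matrix.one_mulVec,
    dotProduct_sub, dotProduct_smul, smul_eq_mul] at h3
  linarith

lemma dotProduct_self_eq_norm_sq (u : ι → ℝ) : u ⬝ᵥ u = ‖WithLp.toLp 2 u‖ ^ 2 := by
  rw [EuclideanSpace.norm_eq, Real.sq_sqrt (Finset.sum_nonneg fun _ _ => sq_nonneg _)]
  simp [dotProduct, sq]

lemma abs_dotProduct_le_norm (u v : ι → ℝ) :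
    |u ⬝ᵥ v| ≤ ‖WithLp.toLp 2 u‖ * ‖WithLp.toLp 2 v‖ := by
  have h := abs_real_inner_le_norm (WithLp.toLp 2 u) (WithLp.toLp 2 v)
  rw [EuclideanSpace.inner_eq_star_dotProduct] at h
  simpa [dotProduct_comm] using h

lemma norm_mulVec_le_opNorm [DecidableEq ι] (Q : Matrix ι ι ℝ) (u : ι → ℝ) :
    ‖WithLp.toLp 2 (Q.mulVec u)‖ ≤ opNorm Q * ‖WithLp.toLp 2 u‖ := by
  have h := (Matrix.toEuclideanCLM (𝕜 := ℝ) Q).le_opNorm (WithLp.toLp 2 u)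
  rwa [Matrix.toEuclideanCLM_toLp] at h

lemma opNorm_add_le [DecidableEq ι] (Q R : Matrix ι ι ℝ) : opNorm
    (Q + R) ≤ opNorm Q + opNorm R := by
  unfold opNorm
  rw [map_add]
  exact norm_add_le _ _

lemma norm_toLp_le_sum (u : ι → ℝ) : ‖WithLp.toLp 2 u‖ ≤ ∑ i, |u i| := by
  rw [EuclideanSpace.norm_eq]
  refine Real.sqrt_le_iff.2 ⟨Finset.sum_nonneg fun _ _ => abs_nonneg _, ?_⟩
  simp only [Real.norm_eq_abs]
  exact Finset.sum_sq_le_sq_sum_of_nonneg fun i _ => abs_nonneg _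

/-- Coercivity: c‖y‖² ≤ yᵀQy ≤ ‖y‖ ‖Qy‖, which also gives invertibility. -/
lemma EigBounded.opNorm_inv_le [DecidableEq ι] (hQ : Q.transpose = Q) (hc : 0 < c)
    (h : EigBounded c M Q) :
    opNorm Q⁻¹ ≤ c⁻¹ := by
  have hu : IsUnit Q := by
    rw [← Matrix.mulVec_injective_iff_isUnit]
    intro u v huv
    have h1 := h.le_dotProduct hQ (u - v)
    rw [Matrix.mulVec_sub, huv, sub_self, dotProduct_zero, dotProduct_self_eq_norm_sq] at h1
    have h2 : ‖WithLp.toLp 2 (u - v)‖ = 0 := by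
      have := norm_nonneg (WithLp.toLp 2 (u - v))
      by_contra hne
      have : 0 < ‖WithLp.toLp 2 (u - v)‖ := lt_of_le_of_ne this (Ne.symm hne)
      have : 0 < c * ‖WithLp.toLp 2 (u - v)‖ ^ 2 := by positivity
      linarith
    have h3 := norm_eq_zero.1 h2
    have h4 : u - v = 0 := congrArg WithLp.ofLp h3
    exact sub_eq_zero.1 h4
  have hdet := (Matrix.isUnit_iff_isUnit_det _).1 hu
  refine ContinuousLinearMap.opNorm_le_bound _ (inv_pos.2 hc).le fun x => ?_
  obtain ⟨u, rfl⟩ : ∃ u : ι → ℝ, x = WithLp.toLp 2 u := ⟨x, rfl⟩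
  rw [Matrix.toEuclideanCLM_toLp]
  set y := Q⁻¹.mulVec u with hy
  have hQy : Q.mulVec y = u := by
    rw [hy, Matrix.mulVec_mulVec, Matrix.mul_nonsing_inv _ hdet, Matrix.one_mulVec]
  have h1 := h.le_dotProduct hQ y
  rw [hQy, dotProduct_self_eq_norm_sq] at h1
  have h2 := (le_abs_self _).trans (abs_dotProduct_le_norm y u)
  have h5 := norm_nonneg (WithLp.toLp 2 y)
  rcases h5.eq_or_lt with h0 | h0
  · rw [← h0]; positivity
  · rw [inv_mul_eq_div, le_div_iff₀ hc]
    have h7 : ‖WithLp.toLp 2 y‖ * (‖WithLp.toLp 2 y‖ * c) ≤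
        ‖WithLp.toLp 2 y‖ * ‖WithLp.toLp 2 u‖ := by nlinarith
    exact le_of_mul_le_mul_left h7 h0

end

/-! ### The basis and its Hölder approximation properties -/

section
variable {d k : ℕ} {μ : Measure (Cov d)} {b : Cov d → Fin k → ℝ}

lemma gram_eq_wgram (hμ : ∀ᵐ v ∂μ, v ∈ unitCube d) (b : Cov d → Fin k → ℝ) :
    gram b μ = wgram b μ fun _ => 1 := by
  ext i j
  simp [gram, wgram, Measure.restrict_eq_self_of_ae_mem hμ]

lemma proj_eq_wproj (hμ : ∀ᵐ v ∂μ, v ∈ unitCube d) (b : Cov d → Fin k → ℝ) (g : Cov d → ℝ)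
    (v : Cov d) : proj b μ g v = wproj b μ (fun _ => 1) g v := by
  rw [proj, wproj, gram_eq_wgram hμ, Measure.restrict_eq_self_of_ae_mem hμ]
  rfl

/-- Square integrability of `b` is not assumed. If it failed for some bᵢ, the Bochner integral
defining the diagonal Gram entry would be zero, whereas the eigenvalue bound makes that entry at
least c. -/
lemma memLp_basis {c M : ℝ} (hμ : ∀ᵐ v ∂μ, v ∈ unitCube d) (hb : Measurable b) (hc : 0 < c)
    (hG : EigBounded c M (gram b μ)) (i : Fin k) : MemLp (fun v => b v i) 2 μ := by
  rw [gram_eq_wgram hμ] at hG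
  have h1 := hG.le_dotProduct (wgram_transpose _ _ _) (Pi.single i 1)
  simp only [Matrix.mulVec_single_one, single_one_dotProduct, Matrix.col_apply, Pi.single_eq_same,
    mul_one] at h1
  have hbi : Measurable fun v => b v i := (measurable_pi_apply i).comp hb
  refine (memLp_two_iff_integrable_sq hbi.aestronglyMeasurable).2 ?_
  by_contra hni
  have h2 : wgram b μ (fun _ => 1) i i = 0 := by
    simp only [wgram, Matrix.of_apply, one_mul]
    exact integral_undef fun h => hni (h.congr (.of_forall fun v => by simp [sq]))
  rw [h2] at h1
  linarith

lemma pos_wgram {c M : ℝ} (hμ : ∀ᵐ v ∂μ, v ∈ unitCube d) (hc : 0 < c)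
    (hG : EigBounded c M (gram b μ)) (u : Fin k → ℝ) (hu : u ≠ 0) :
    0 < u ⬝ᵥ (wgram b μ fun _ => 1).mulVec u := by
  rw [gram_eq_wgram hμ] at hG
  have h1 := hG.le_dotProduct (wgram_transpose _ _ _) u
  have h2 : 0 < u ⬝ᵥ u := by
    rw [dotProduct_self_eq_norm_sq]
    have : 0 < ‖WithLp.toLp 2 u‖ := norm_pos_iff.2 (by simpa using hu)
    positivity
  have : 0 < c * (u ⬝ᵥ u) := by positivity
  linarith

lemma memLp_of_bound_unitCube [IsFiniteMeasure μ] (hμ : ∀ᵐ v ∂μ, v ∈ unitCube d) {f : Cov d → ℝ}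
    (hf : Measurable f) {B : ℝ} (hB : ∀ v ∈ unitCube d, |f v| ≤ B) : MemLp f 2 μ := by
  refine MemLp.of_bound hf.aestronglyMeasurable B ?_
  filter_upwards [hμ] with v hv using hB v hv

/-- Homogeneity: divide by `K` to reach Hölder constant 1, apply the hypothesis, and multiply back.
-/
lemma HolderApprox.l2norm_le (hμ : ∀ᵐ v ∂μ, v ∈ unitCube d) {rmax : ℝ} {A : ℝ → ℝ}
    (hA : HolderApprox b μ rmax A) {r K : ℝ} (hr : 0 < r) (hr' : r ≤ rmax) (hK : 0 < K)
    {f : Cov d → ℝ} (hf : HolderRec (r - sfloor r) K (sfloor r) f) :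
    l2norm μ (fun v => f v - wproj b μ (fun _ => 1) f v) ≤ K * (|A r| * (k : ℝ) ^ (-(r / d))) := by
  have h1 : IsHolder r 1 (fun v => K⁻¹ * f v) := by
    refine HolderRec.isHolder hr ((hf.const_mul K⁻¹).mono (le_of_eq ?_))
    rw [abs_of_pos (inv_pos.2 hK), inv_mul_cancel₀ hK.ne']
  have h2 := hA r hr hr' _ h1
  have h3 : ∀ v, f v - wproj b μ (fun _ => 1) f v =
      K * (K⁻¹ * f v - proj b μ (fun v => K⁻¹ * f v) v) := fun v => by
    rw [proj_eq_wproj hμ, wproj_const_mul]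
    field_simp
  simp only [h3]
  rw [l2norm_const_mul, abs_of_pos hK]
  refine mul_le_mul_of_nonneg_left (h2.trans ?_) hK.le
  exact mul_le_mul_of_nonneg_right (le_abs_self _) (by positivity)

/-- Approximation of a rescaled Hölder function times a smooth weight. -/
lemma exists_l2norm_sub_wproj_le {α rmax : ℝ} (hα : 0 < α) (hr : α ≤ rmax) {q : Cov d → ℝ}
    (hq : AllHolder q) (hqm : Measurable q) (L H : ℝ) (A : ℝ → ℝ) :
    ∃ C : ℝ, 0 ≤ C ∧ ∀ (k : ℕ) (b : Cov d → Fin k → ℝ) (μ : Measure (Cov d)) [IsFiniteMeasure μ]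
      (x₀ : Cov d) (h : ℝ) (f : Cov d → ℝ), (∀ᵐ v ∂μ, v ∈ unitCube d) →
      (∀ i, MemLp (fun v => b v i) 2 μ) → HolderApprox b μ rmax A → 0 < h → h ≤ H →
      x₀ ∈ unitCube d → Set.MapsTo (fromUnit x₀ h) (unitCube d) (unitCube d) →
      Measurable f → IsHolder α L f →
      l2norm μ (fun v => q v * f (fromUnit x₀ h v) -
        wproj b μ (fun _ => 1) (fun v => q v * f (fromUnit x₀ h v)) v) ≤
        C * (h ^ α * (k : ℝ) ^ (-(α / d)) + (k : ℝ) ^ (-(rmax / d))) := by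
  have hrm : 0 < rmax := hα.trans_le hr
  have hs0 : 0 < α - sfloor α := by linarith [sfloor_lt hα]
  have hs1 : α - sfloor α ≤ 1 := by linarith [le_sfloor_add_one hα]
  have ht0 : 0 < rmax - sfloor rmax := by linarith [sfloor_lt hrm]
  have ht1 : rmax - sfloor rmax ≤ 1 := by linarith [le_sfloor_add_one hrm]
  obtain ⟨Kq, hKq⟩ := hq (sfloor α) _ hs0 hs1
  obtain ⟨Kq', hKq'⟩ := hq (sfloor rmax) _ ht0 ht1
  obtain ⟨D, hD, hmul⟩ := HolderRec.exists_mul d hs0 hs1 (sfloor α)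
  obtain ⟨D', hD', hmul'⟩ := HolderRec.exists_mul d ht0 ht1 (sfloor rmax)
  obtain ⟨C₁, hC₁, hrem⟩ := HolderRec.exists_scaled_remainder d hs0 (sfloor α)
  obtain ⟨C₂, hC₂, hpol⟩ := HolderRec.exists_scaled_taylorPoly d (s := α - sfloor α)
    (H := max H 0) ht0 ht1 (le_max_right _ _) (sfloor rmax) (sfloor α)
  -- The added 1 makes the Hölder constants positive, as the normalization in
  -- `HolderApprox.l2norm_le` requires.
  set E₁ := D * (Kq * (C₁ * |L|)) + 1
  set E₂ := D' * (Kq' * (C₂ * |L|)) + 1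
  have hE₁ : 0 < E₁ := by have := hKq.nonneg; positivity
  have hE₂ : 0 < E₂ := by have := hKq'.nonneg; positivity
  refine ⟨E₁ * |A α| + E₂ * |A rmax|, by positivity,
    fun k b μ _ x₀ h f hμ hb hA h0 hH hx₀ hm hfm hf => ?_⟩
  have hfr := hf.holderRec.mono (le_abs_self L)
  set T : Cov d → ℝ := fun v => taylorPoly x₀ (sfloor α) f (fromUnit x₀ h v) with hT
  have h1 := hmul _ _ _ _ hKq (hrem _ h x₀ f h0 hx₀ hm hfr)
  have h2 := hmul' _ _ _ _ hKq' (hpol _ h x₀ f h0 (hH.trans (le_max_left _ _)) hx₀ hfr)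
  have hα' : (sfloor α : ℝ) + (α - sfloor α) = α := by ring
  rw [hα'] at h1
  have h1' := h1.mono (L := E₁ * h ^ α) (by
    have : 0 ≤ h ^ α := by positivity
    have e : D * (Kq * (C₁ * |L| * h ^ α)) = D * (Kq * (C₁ * |L|)) * h ^ α := by ring
    rw [e, add_mul]; linarith)
  have h2' := h2.mono (L := E₂) (by linarith)
  have hA1 := hA.l2norm_le hμ hα hr (by positivity) h1'
  have hA2 := hA.l2norm_le hμ hrm le_rfl hE₂ h2'
  have hTm : Measurable T := ((continuous_taylorPoly x₀ (sfloor α) f).comp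
    (continuous_fromUnit x₀ h)).measurable
  have hfum : Measurable fun v => f (fromUnit x₀ h v) :=
    hfm.comp (continuous_fromUnit x₀ h).measurable
  have L1 : MemLp (fun v => q v * (f (fromUnit x₀ h v) - T v)) 2 μ :=
    memLp_of_bound_unitCube hμ (hqm.mul (hfum.sub hTm)) h1.bound
  have L2 : MemLp (fun v => q v * T v) 2 μ :=
    memLp_of_bound_unitCube hμ (hqm.mul hTm) h2.bound
  -- Taylor remainder plus Taylor polynomial: the former is approximated at smoothness α with
  -- constant of order h^α, the latter at the highest order rmax with bounded constant.
  have e0 : (fun v => q v * f (fromUnit x₀ h v)) =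
      fun v => q v * (f (fromUnit x₀ h v) - T v) + q v * T v := by funext v; ring
  have e1 : (fun v => q v * f (fromUnit x₀ h v) -
        wproj b μ (fun _ => 1) (fun v => q v * f (fromUnit x₀ h v)) v) =
      fun v => (q v * (f (fromUnit x₀ h v) - T v) -
        wproj b μ (fun _ => 1) (fun v => q v * (f (fromUnit x₀ h v) - T v)) v) +
        (q v * T v - wproj b μ (fun _ => 1) (fun v => q v * T v) v) := by
    funext v
    rw [e0, wproj_add hb _ L1 L2]
    ring
  rw [e1]
  have hk : (0 : ℝ) ≤ k := Nat.cast_nonneg k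
  refine (l2norm_add_le (L1.sub (memLp_wproj hb _ _)) (L2.sub (memLp_wproj hb _ _))).trans ?_
  refine (add_le_add hA1 hA2).trans ?_
  have p1 : 0 ≤ E₁ * |A α| * (k : ℝ) ^ (-(rmax / d)) := by positivity
  have p2 : 0 ≤ E₂ * |A rmax| * (h ^ α * (k : ℝ) ^ (-(α / d))) := by positivity
  nlinarith

end

/-! ### The localized law of the covariates and its estimate -/

section
variable {d : ℕ}

/-- Hölder approximation concerns functions on the whole cube, so a rescaled function must be
controlled on all of it, not only on the ball carrying F*. For x₀ in the open cube this holds once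
`h` is small. -/
lemma exists_mapsTo_fromUnit {x₀ : Cov d} (hx₀ : ∀ j, x₀ j ∈ Set.Ioo (0 : ℝ) 1) :
    ∃ h₀ : ℝ, 0 < h₀ ∧ ∀ h, 0 < h → h ≤ h₀ →
      Set.MapsTo (fromUnit x₀ h) (unitCube d) (unitCube d) := by
  have h1 : ∀ j, ∀ᶠ δ in nhdsWithin (0 : ℝ) (Set.Ioi 0), δ < min (x₀ j) (1 - x₀ j) := fun j =>
    Filter.Eventually.filter_mono nhdsWithin_le_nhds
      (eventually_lt_nhds (lt_min (hx₀ j).1 (by linarith [(hx₀ j).2])))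
  obtain ⟨δ, hδ, hδ0⟩ := ((Filter.eventually_all.2 h1).and self_mem_nhdsWithin).exists
  refine ⟨δ, hδ0, fun h hh0 hh v hv j => ?_⟩
  have h2 := lt_min_iff.1 (hδ j)
  have h3 := hv j
  have e : fromUnit x₀ h v j = x₀ j + h * (v j - 1 / 2) := rfl
  rw [e, Set.mem_Icc]
  rw [Set.mem_Icc] at h3
  constructor <;> nlinarith

lemma measurable_rho (N : ℕ) (i : MIdx d N) : Measurable fun v : Cov d => rho N v i := by
  unfold rho legendre
  fun_prop

lemma popQ_eq_integral {N : ℕ} {P : Measure (Obs d)} [IsProbabilityMeasure P] {π : Cov d → ℝ}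
    (hπ : Measurable π) {x₀ : Cov d} {h : ℝ} (hh : 0 < h) (i j : MIdx d N) :
    popQ N (P.map cov) π x₀ h i j = ∫ v, rho N v i * (π (fromUnit x₀ h v) *
      (1 - π (fromUnit x₀ h v))) * rho N v j ∂(locMeasure (P.map cov) x₀ h) := by
  have hr : ∀ i : MIdx d N, Measurable fun v : Cov d => rho N v i := measurable_rho N
  have hf := (continuous_fromUnit x₀ h).measurable
  have hm : Measurable fun v => rho N v i * (π (fromUnit x₀ h v) *
      (1 - π (fromUnit x₀ h v))) * rho N v j :=
    ((hr i).mul ((hπ.comp hf).mul ((hπ.comp hf).const_sub 1))).mul (hr j)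
  have ht := (continuous_toUnit x₀ h).measurable
  rw [← (localSample P hh).integral _ hm]
  rw [popQ, Matrix.of_apply, integral_map measurable_cov.aemeasurable]
  · refine integral_congr_ae (.of_forall fun z => ?_)
    simp only [rhoh, fromUnit_toUnit x₀ hh.ne']
    ring
  · exact (((((hr i).comp ht).mul (measurable_kern x₀ h)).mul (hπ.mul (hπ.const_sub 1))).mul
      ((hr j).comp ht)).aestronglyMeasurable

lemma popQ_transpose (N : ℕ) (F : Measure (Cov d)) (π : Cov d → ℝ) (x₀ : Cov d) (h : ℝ) :
    (popQ N F π x₀ h).transpose = popQ N F π x₀ h := by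
  ext i j
  simp only [popQ, Matrix.transpose_apply, Matrix.of_apply]
  exact integral_congr_ae (.of_forall fun x => by simp only; ring)

/-- The multi-index of the constant polynomial. -/
def MIdx.zero (d N : ℕ) : MIdx d N := ⟨fun _ => 0, by simp⟩

lemma rho_zero (N : ℕ) (v : Cov d) : rho N v (MIdx.zero d N) = 1 := by
  simp [rho, MIdx.zero, legendre]

/-- The diagonal entry of Q at the constant polynomial is ∫ π(1 - π) dF*, which is at most M and at
least ε² times the total mass of F*. -/
lemma measureReal_locMeasure_le {N : ℕ} {P : Measure (Obs d)} [IsProbabilityMeasure P]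
    {π : Cov d → ℝ} (hπ : Measurable π) (hX : ∀ᵐ z ∂P, cov z ∈ unitCube d) {ε c M : ℝ}
    (hε : 0 < ε) (hπε : ∀ x ∈ unitCube d, ε ≤ π x ∧ π x ≤ 1 - ε) {x₀ : Cov d} {h : ℝ}
    (hh : 0 < h) (hQ : EigBounded c M (popQ N (P.map cov) π x₀ h)) :
    (locMeasure (P.map cov) x₀ h).real Set.univ ≤ M / ε ^ 2 := by
  have h1 := hQ.dotProduct_le (popQ_transpose _ _ _ _ _) (Pi.single (MIdx.zero d N) 1)
  simp only [Matrix.mulVec_single_one, single_one_dotProduct, Matrix.col_apply, Pi.single_eq_same,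
    mul_one] at h1
  rw [popQ_eq_integral hπ hh] at h1
  simp only [rho_zero, one_mul, mul_one] at h1
  have hF : ∀ᵐ x ∂(P.map cov), x ∈ unitCube d :=
    (ae_map_iff measurable_cov.aemeasurable (measurableSet_unitCube d)).2 hX
  set μ := locMeasure (P.map cov) x₀ h
  have : IsProbabilityMeasure (P.map (cov : Obs d → Cov d)) :=
    Measure.isProbabilityMeasure_map measurable_cov.aemeasurable
  have hfm : Measurable fun v => π (fromUnit x₀ h v) * (1 - π (fromUnit x₀ h v)) := by
    have := hπ.comp (continuous_fromUnit x₀ h).measurable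
    exact this.mul (this.const_sub 1)
  have hb : ∀ᵐ v ∂μ, ε ^ 2 ≤ π (fromUnit x₀ h v) * (1 - π (fromUnit x₀ h v)) ∧
      π (fromUnit x₀ h v) * (1 - π (fromUnit x₀ h v)) ≤ 1 := by
    filter_upwards [ae_locMeasure hF hh] with v hv
    obtain ⟨h2, h3⟩ := hπε _ hv.2.1
    constructor <;> nlinarith
  have hi : Integrable (fun v => π (fromUnit x₀ h v) * (1 - π (fromUnit x₀ h v))) μ := by
    refine Integrable.of_bound hfm.aestronglyMeasurable 1 ?_
    filter_upwards [hb] with v hv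
    rw [Real.norm_of_nonneg ((sq_nonneg ε).trans hv.1)]
    exact hv.2
  have h2 : ∫ _, ε ^ 2 ∂μ ≤ ∫ v, π (fromUnit x₀ h v) * (1 - π (fromUnit x₀ h v)) ∂μ :=
    integral_mono_ae (integrable_const _) hi (hb.mono fun v hv => hv.1)
  rw [integral_const, smul_eq_mul] at h2
  rw [le_div_iff₀ (by positivity)]
  linarith

/-! ### The estimated law as a weight on the true one -/

/-- The density of the estimated localized law. -/
def locDensity (F Fh : Measure (Cov d)) (x₀ : Cov d) (h : ℝ) (v : Cov d) : ℝ :=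
  ((locMeasure Fh x₀ h).rnDeriv (locMeasure F x₀ h) v).toReal

lemma measurable_locDensity (F Fh : Measure (Cov d)) (x₀ : Cov d) (h : ℝ) :
    Measurable (locDensity F Fh x₀ h) :=
  (Measure.measurable_rnDeriv _ _).ennreal_toReal

section
variable {α β γ L c M : ℝ} {n : ℕ} {F : Measure (Cov d)} {π μ₀ : Cov d → ℝ} {x₀ : Cov d} {h : ℝ}
  {p m : Cov d → ℝ} {Fh : Measure (Cov d)}

lemma NuisanceOK.locDensity_bounds (H : NuisanceOK α β γ L c M n F π μ₀ x₀ h p m Fh) :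
    ∀ᵐ v ∂locMeasure F x₀ h, c ≤ locDensity F Fh x₀ h v ∧ |locDensity F Fh x₀ h v| ≤ |M| := by
  filter_upwards [H.density] with v hv
  have hfin : (locMeasure Fh x₀ h).rnDeriv (locMeasure F x₀ h) v ≠ ⊤ :=
    (hv.2.trans_lt ENNReal.ofReal_lt_top).ne
  refine ⟨(ENNReal.ofReal_le_iff_le_toReal hfin).1 hv.1, ?_⟩
  rw [locDensity, abs_of_nonneg ENNReal.toReal_nonneg]
  refine (ENNReal.toReal_mono ENNReal.ofReal_ne_top hv.2).trans ?_
  rw [ENNReal.toReal_ofReal']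
  exact max_le (le_abs_self M) (abs_nonneg M)

/-- `covErr` is a real number obtained from an essential supremum and would be zero if the supremum
were infinite. The density bounds exclude this. -/
lemma NuisanceOK.abs_locDensity_sub_one_le (H : NuisanceOK α β γ L c M n F π μ₀ x₀ h p m Fh) :
    ∀ᵐ v ∂locMeasure F x₀ h, |locDensity F Fh x₀ h v - 1| ≤ covErr F Fh x₀ h := by
  have hfin : eLpNorm (fun v => locDensity F Fh x₀ h v - 1) ⊤ (locMeasure F x₀ h) ≠ ⊤ := by
    refine (eLpNormEssSup_lt_top_of_ae_bound (C := |M| + 1) ?_).ne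
    filter_upwards [H.locDensity_bounds] with v hv
    rw [Real.norm_eq_abs]
    refine (abs_sub _ _).trans ?_
    rw [abs_one]
    linarith [hv.2]
  filter_upwards [ae_le_eLpNormEssSup (μ := locMeasure F x₀ h)
    (f := fun v => locDensity F Fh x₀ h v - 1)] with v hv
  rw [← eLpNorm_exponent_top] at hv
  have := ENNReal.toReal_mono hfin hv
  rwa [toReal_enorm, Real.norm_eq_abs] at this

/-- Absolute continuity turns the integral against F̂* into a weighted integral against F*, so Ω̂ is
the Ω_w to which the projection lemmas apply. -/
lemma gram_eq_wgram_locDensity [IsFiniteMeasure F] [IsFiniteMeasure Fh] (hh : 0 < h)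
    (H : locMeasure Fh x₀ h ≪ locMeasure F x₀ h) {k : ℕ} (b : Cov d → Fin k → ℝ) :
    gram b (locMeasure Fh x₀ h) = wgram b (locMeasure F x₀ h) (locDensity F Fh x₀ h) := by
  have := isFiniteMeasure_locMeasure F x₀ h
  have := Measure.haveLebesgueDecomposition_of_sigmaFinite (locMeasure Fh x₀ h) (locMeasure F x₀ h)
  ext i j
  rw [gram, wgram, Matrix.of_apply, Matrix.of_apply,
    Measure.restrict_eq_self_of_ae_mem (ae_locMeasure_mem_unitCube Fh hh),
    ← integral_rnDeriv_smul H]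
  rfl

lemma kern_mul_projKernel [IsFiniteMeasure F] [IsFiniteMeasure Fh] (hh : 0 < h)
    (H : locMeasure Fh x₀ h ≪ locMeasure F x₀ h) {k : ℕ} (b : Cov d → Fin k → ℝ) (x y : Cov d) :
    kern x₀ h x * projKernel b Fh x₀ h x y * kern x₀ h y =
      kern x₀ h x * wkernel b (locMeasure F x₀ h) (locDensity F Fh x₀ h) (toUnit x₀ h x)
        (toUnit x₀ h y) * kern x₀ h y := by
  by_cases hx : x ∈ Metric.closedBall x₀ (h / 2)
  · by_cases hy : y ∈ Metric.closedBall x₀ (h / 2)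
    · rw [projKernel, wkernel, gram_eq_wgram_locDensity hh H, locBasis, locBasis,
        Set.indicator_of_mem hx, Set.indicator_of_mem hy]
    · simp [kern_of_notMem hy]
  · simp [kern_of_notMem hx]

end

/-! ### The estimating equation -/

section
variable {n : ℕ}

lemma sampleMean_sum {ι : Type*} [Fintype ι] (Z : Fin n → Obs d) (f : ι → Obs d → ℝ) (θ : ι → ℝ) :
    ∑ j, sampleMean Z (f j) * θ j = sampleMean Z fun z => ∑ j, f j z * θ j := by
  simp only [sampleMean, mul_assoc, Finset.sum_mul, ← Finset.mul_sum]
  rw [Finset.sum_comm]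

lemma uStat_sum {ι : Type*} [Fintype ι] (Z : Fin n → Obs d) (f : ι → Obs d → Obs d → ℝ)
    (θ : ι → ℝ) :
    ∑ j, uStat Z (f j) * θ j = uStat Z fun z y => ∑ j, f j z y * θ j := by
  simp only [uStat, mul_assoc, Finset.sum_mul, ← Finset.mul_sum]
  congr 1
  rw [Finset.sum_comm]
  refine Finset.sum_congr rfl fun i _ => ?_
  rw [Finset.sum_comm]

/-- The estimating equation `R̂ - Q̂ θ`, as a localized mean minus a U-statistic. -/
lemma estR_sub_estQ_mulVec {F Fh : Measure (Cov d)} [IsFiniteMeasure F] [IsFiniteMeasure Fh]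
    {N k : ℕ} {x₀ : Cov d} {h : ℝ} (hh : 0 < h)
    (H : locMeasure Fh x₀ h ≪ locMeasure F x₀ h) (b : Cov d → Fin k → ℝ) (p m : Cov d → ℝ)
    {T : Cov d → ℝ} {θ : MIdx d N → ℝ} (hθ : ∀ x, T x = rhoh N x₀ h x ⬝ᵥ θ) (i : MIdx d N)
    (Z : Fin n → Obs d) :
    estR N p m Fh b x₀ h Z i - ((estQ N p Fh b x₀ h Z).mulVec θ) i =
      (1 / (n : ℝ)) * ∑ a, kern x₀ h (cov (Z a)) *
          (rho N (toUnit x₀ h (cov (Z a))) i * (trt (Z a) - p (cov (Z a)))) *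
          (out (Z a) - m (cov (Z a)) - trt (Z a) * T (cov (Z a))) -
      (1 / ((n : ℝ) * ((n : ℝ) - 1))) * ∑ a, ∑ a' ∈ Finset.univ.erase a,
        (kern x₀ h (cov (Z a)) *
          (rho N (toUnit x₀ h (cov (Z a))) i * (trt (Z a) - p (cov (Z a))))) *
        wkernel b (locMeasure F x₀ h) (locDensity F Fh x₀ h) (toUnit x₀ h (cov (Z a)))
          (toUnit x₀ h (cov (Z a'))) *
        (kern x₀ h (cov (Z a')) *
          (out (Z a') - m (cov (Z a')) - trt (Z a') * T (cov (Z a')))) := by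
  -- Contracting the second index of Q̂ with θ turns ρ_hᵀθ into `T`, so Q̂θ has the form of R̂ with
  -- A T in place of Y - μ̂₀.
  have e1 : ((estQ N p Fh b x₀ h Z).mulVec θ) i =
      sampleMean Z (fun z => rhoh N x₀ h (cov z) i * kern x₀ h (cov z) * phiA1 p z * T (cov z)) +
      uStat Z (fun z₁ z₂ => rhoh N x₀ h (cov z₁) i * kern x₀ h (cov z₁) *
        phiA2 p Fh b x₀ h z₁ z₂ * kern x₀ h (cov z₂) * T (cov z₂)) := by
    simp only [Matrix.mulVec, dotProduct, estQ, Matrix.of_apply, add_mul, Finset.sum_add_distrib]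
    rw [sampleMean_sum, uStat_sum]
    simp only [hθ, dotProduct, Finset.mul_sum, mul_assoc]
  rw [e1, estR]
  have e2 : ∀ A B C D : ℝ, A + B - (C + D) = (A - C) - (D - B) := fun A B C D => by ring
  rw [e2]
  congr 1
  · simp only [sampleMean, ← mul_sub, ← Finset.sum_sub_distrib]
    congr 1
    refine Finset.sum_congr rfl fun a _ => ?_
    simp only [phiA1, phiY1, rhoh]
    ring
  · simp only [uStat, ← mul_sub, ← Finset.sum_sub_distrib]
    congr 1
    refine Finset.sum_congr rfl fun a _ => Finset.sum_congr rfl fun a' _ => ?_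
    have e3 := kern_mul_projKernel hh H b (cov (Z a)) (cov (Z a'))
    simp only [phiA2, phiY2, rhoh]
    linear_combination (rho N (toUnit x₀ h (cov (Z a))) i * (trt (Z a) - p (cov (Z a))) *
      (out (Z a') - m (cov (Z a')) - trt (Z a') * T (cov (Z a')))) * e3

end

end

/-! ### The bias -/

section
variable {d : ℕ}

lemma IsHolder.mono {r L L' : ℝ} (hr : 0 < r) {g : Cov d → ℝ} (h : IsHolder r L g)
    (hL : L ≤ L') : IsHolder r L' g :=
  HolderRec.isHolder hr (h.holderRec.mono hL)

lemma IsHolder.abs_le {r L : ℝ} {g : Cov d → ℝ} (h : IsHolder r L g) :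
    ∀ x ∈ unitCube d, |g x| ≤ L := h.holderRec.bound

lemma IsHolder.neg {r L : ℝ} (hr : 0 < r) {g : Cov d → ℝ} (h : IsHolder r L g) :
    IsHolder r L fun x => -g x := by
  have := h.holderRec.const_mul (-1)
  simp only [abs_neg, abs_one, one_mul, neg_mul] at this
  exact HolderRec.isHolder hr this

/-- The bias of the U-statistic correction of the product of the residuals. -/
lemma exists_bias_le {α β γ rmax : ℝ} (hα : 0 < α) (hβ : 0 < β)
    (hrα : α ≤ rmax) (hrβ : β ≤ rmax) {q : Cov d → ℝ} (hq : AllHolder q) (hqm : Measurable q)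
    {L c M M₀ C₀ D h₀ : ℝ} (hL : 0 ≤ L) (hc : 0 < c) (hM : 0 ≤ M) (hC₀ : 0 ≤ C₀)
    (hD : 0 ≤ D) (A : ℝ → ℝ) {x₀ : Cov d} (hx₀ : x₀ ∈ unitCube d)
    (hmaps : ∀ h, 0 < h → h ≤ h₀ → Set.MapsTo (fromUnit x₀ h) (unitCube d) (unitCube d)) :
    ∃ C : ℝ, 0 ≤ C ∧ ∀ (n k : ℕ) (h R : ℝ), TuningRates d α β γ rmax C₀ R n h k →
      (h₀ ≤ h → 1 ≤ C₀ * R) → ∀ (b : Cov d → Fin k → ℝ) (μ : Measure (Cov d)) [IsFiniteMeasure μ],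
      (∀ᵐ v ∂μ, v ∈ unitCube d ∧ fromUnit x₀ h v ∈ unitCube d) → μ.real Set.univ ≤ M₀ →
      (∀ i, MemLp (fun v => b v i) 2 μ) → HolderApprox b μ rmax A →
      IsUnit (wgram b μ fun _ => 1) →
      ∀ (w : Cov d → ℝ) (B e : ℝ), IsUnit (wgram b μ w) → AEStronglyMeasurable w μ →
      (∀ᵐ v ∂μ, c ≤ w v) → (∀ᵐ v ∂μ, |w v| ≤ B) → 0 ≤ e → (∀ᵐ v ∂μ, |w v - 1| ≤ e) →
      ∀ (f₁ f₂ r : Cov d → ℝ), Measurable f₁ → IsHolder α L f₁ → Measurable f₂ →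
      IsHolder β L f₂ → Measurable r → (∀ᵐ v ∂μ, |r v| ≤ D * h ^ γ) →
      e * (l2norm μ (fun v => f₁ (fromUnit x₀ h v)) *
        (l2norm μ (fun v => f₂ (fromUnit x₀ h v)) + h ^ γ)) ≤ M * R →
      |∫ v, (q v * f₁ (fromUnit x₀ h v)) * ((f₂ (fromUnit x₀ h v) + r v) -
        wproj b μ w (fun v => f₂ (fromUnit x₀ h v) + r v) v) ∂μ| ≤ C * R := by
  obtain ⟨Bq, hBq0, hBq⟩ := hq.exists_bound
  obtain ⟨C₁, hC₁, H₁⟩ := exists_l2norm_sub_wproj_le hα hrα hq hqm L C₀ A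
  obtain ⟨C₂, hC₂, H₂⟩ := exists_l2norm_sub_wproj_le hβ hrβ (AllHolder.const 1)
    measurable_const L C₀ A
  set S := Real.sqrt M₀
  have hS : 0 ≤ S := Real.sqrt_nonneg _
  -- In order: the product of approximation errors for `h ≤ h₀`, its crude bound for `h ≥ h₀`, the
  -- Taylor remainder `r`, and the error of the weight.
  refine ⟨C₁ * C₂ * (1 + C₀) ^ 2 * C₀ + 4 * Bq * L ^ 2 * S ^ 2 * C₀ +
    (2 * (Bq * L * S)) * (2 * (D * C₀ * S)) + c⁻¹ * Bq * (1 + D * S) * M, by positivity, ?_⟩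
  intro n k h R ht hlarge b μ _ hμ hmass hb hA hu w B e huw hw hcw hBw he0 he f₁ f₂ r hf₁m hf₁ hf₂m
    hf₂ hrm hr hacc
  have hR := ht.rate_pos
  have hh := ht.h_pos
  have hkp : (0 : ℝ) < k := by exact_mod_cast ht.k_pos
  have hγ0 : 0 ≤ h ^ γ := by positivity
  have hfu := (continuous_fromUnit x₀ h).measurable
  have hmassS : Real.sqrt (μ.real Set.univ) ≤ S := Real.sqrt_le_sqrt hmass
  set ξ : Cov d → ℝ := fun v => q v * f₁ (fromUnit x₀ h v) with hξ
  set φ : Cov d → ℝ := fun v => f₂ (fromUnit x₀ h v) with hφ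
  set ψ : Cov d → ℝ := fun v => f₁ (fromUnit x₀ h v) with hψ
  have bψ : ∀ᵐ v ∂μ, |ψ v| ≤ L := by
    filter_upwards [hμ] with v hv using hf₁.abs_le _ hv.2
  have bφ : ∀ᵐ v ∂μ, |φ v| ≤ L := by
    filter_upwards [hμ] with v hv using hf₂.abs_le _ hv.2
  have bξψ : ∀ᵐ v ∂μ, |ξ v| ≤ |Bq * ψ v| := by
    filter_upwards [hμ] with v hv
    rw [hξ, abs_mul, abs_mul, abs_of_nonneg hBq0]
    exact mul_le_mul_of_nonneg_right (hBq v hv.1) (abs_nonneg _)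
  have bξ : ∀ᵐ v ∂μ, |ξ v| ≤ Bq * L := by
    filter_upwards [bξψ, bψ] with v h1 h2
    refine h1.trans ?_
    rw [abs_mul, abs_of_nonneg hBq0]
    exact mul_le_mul_of_nonneg_left h2 hBq0
  have hψm : Measurable ψ := hf₁m.comp hfu
  have hφm : Measurable φ := hf₂m.comp hfu
  have hξm : Measurable ξ := hqm.mul hψm
  have Lψ : MemLp ψ 2 μ := MemLp.of_bound hψm.aestronglyMeasurable L bψ
  have Lφ : MemLp φ 2 μ := MemLp.of_bound hφm.aestronglyMeasurable L bφ
  have Lξ : MemLp ξ 2 μ := MemLp.of_bound hξm.aestronglyMeasurable _ bξ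
  have Lr : MemLp r 2 μ := MemLp.of_bound hrm.aestronglyMeasurable _ hr
  have Lg : MemLp (fun v => φ v + r v) 2 μ := Lφ.add Lr
  have nξ : l2norm μ ξ ≤ Bq * L * S :=
    (l2norm_le_of_bound (by positivity) bξ).trans (by gcongr)
  have nφ : l2norm μ φ ≤ L * S := (l2norm_le_of_bound hL bφ).trans (by gcongr)
  have nr : l2norm μ r ≤ D * h ^ γ * S :=
    (l2norm_le_of_bound (by positivity) hr).trans (by gcongr)
  have nξψ : l2norm μ ξ ≤ Bq * l2norm μ ψ := by
    have := l2norm_mono (Lψ.const_mul Bq) bξψ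
    rwa [l2norm_const_mul, abs_of_nonneg hBq0] at this
  have ng : l2norm μ (fun v => φ v + r v) ≤ (1 + D * S) * (l2norm μ φ + h ^ γ) := by
    refine (l2norm_add_le Lφ Lr).trans ?_
    have h1 := l2norm_nonneg μ φ
    have h2 : 0 ≤ D * S * l2norm μ φ := by positivity
    nlinarith
  set a := l2norm μ (fun v => ξ v - wproj b μ (fun _ => 1) ξ v)
  set a₂ := l2norm μ (fun v => φ v - wproj b μ (fun _ => 1) φ v)
  have ha0 : 0 ≤ a := l2norm_nonneg _ _
  have ha₂0 : 0 ≤ a₂ := l2norm_nonneg _ _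
  have ha : a ≤ 2 * (Bq * L * S) := (l2norm_sub_wproj_le hb hu Lξ).trans (by linarith)
  have ha₂ : a₂ ≤ 2 * (L * S) := (l2norm_sub_wproj_le hb hu Lφ).trans (by linarith)
  have hμ' : ∀ᵐ v ∂μ, v ∈ unitCube d := hμ.mono fun v hv => hv.1
  have k1 : a * a₂ ≤ (C₁ * C₂ * (1 + C₀) ^ 2 * C₀ + 4 * Bq * L ^ 2 * S ^ 2 * C₀) * R := by
    rcases le_total h h₀ with hsm | hlg
    · have h1 := H₁ k b μ x₀ h f₁ hμ' hb hA hh ht.h_le hx₀ (hmaps h hh hsm) hf₁m hf₁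
      have h2 := H₂ k b μ x₀ h f₂ hμ' hb hA hh ht.h_le hx₀ (hmaps h hh hsm) hf₂m hf₂
      simp only [one_mul] at h2
      have t1 := ht.high_order_pi
      have t2 := ht.high_order_mu
      have t3 := ht.bias
      set u := h ^ α * (k : ℝ) ^ (-(α / d))
      set u₂ := h ^ β * (k : ℝ) ^ (-(β / d))
      have hu0 : 0 ≤ u := by positivity
      have hu₂0 : 0 ≤ u₂ := by positivity
      have h1' : a ≤ C₁ * ((1 + C₀) * u) := h1.trans (by gcongr; linarith)
      have h2' : a₂ ≤ C₂ * ((1 + C₀) * u₂) := h2.trans (by gcongr; linarith)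
      calc a * a₂ ≤ (C₁ * ((1 + C₀) * u)) * (C₂ * ((1 + C₀) * u₂)) := by gcongr
        _ = C₁ * C₂ * (1 + C₀) ^ 2 * (u * u₂) := by ring
        _ ≤ C₁ * C₂ * (1 + C₀) ^ 2 * (C₀ * R) := by gcongr
        _ ≤ C₁ * C₂ * (1 + C₀) ^ 2 * (C₀ * R) + 4 * Bq * L ^ 2 * S ^ 2 * C₀ * R :=
          le_add_of_nonneg_right (by positivity)
        _ = _ := by ring
    · have h1 := hlarge hlg
      calc a * a₂ ≤ (2 * (Bq * L * S)) * (2 * (L * S)) := by gcongr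
        _ = 4 * Bq * L ^ 2 * S ^ 2 * 1 := by ring
        _ ≤ 4 * Bq * L ^ 2 * S ^ 2 * (C₀ * R) := by gcongr
        _ ≤ 4 * Bq * L ^ 2 * S ^ 2 * (C₀ * R) + C₁ * C₂ * (1 + C₀) ^ 2 * C₀ * R :=
          le_add_of_nonneg_right (by positivity)
        _ = _ := by ring
  -- Only the size of `r` is used, not its smoothness: the residual of `r` is at most 2‖r‖, already
  -- of order h^γ.
  have k2 : l2norm μ (fun v => (φ v + r v) - wproj b μ (fun _ => 1) (fun v => φ v + r v) v) ≤
      a₂ + 2 * (D * C₀ * S) * R := by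
    have e1 : (fun v => (φ v + r v) - wproj b μ (fun _ => 1) (fun v => φ v + r v) v) =
        fun v => (φ v - wproj b μ (fun _ => 1) φ v) + (r v - wproj b μ (fun _ => 1) r v) := by
      funext v
      rw [wproj_add hb _ Lφ Lr]
      ring
    rw [e1]
    refine (l2norm_add_le (Lφ.sub (memLp_wproj hb _ _)) (Lr.sub (memLp_wproj hb _ _))).trans ?_
    refine add_le_add le_rfl ((l2norm_sub_wproj_le hb hu Lr).trans ?_)
    have h1 : D * h ^ γ * S ≤ D * (C₀ * R) * S := by
      have := ht.smoothing
      gcongr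
    calc 2 * l2norm μ r ≤ 2 * (D * (C₀ * R) * S) := by linarith
      _ = _ := by ring
  -- The accuracy condition enters here; its summand h^γ accounts for the Taylor remainder in the
  -- second factor.
  have k3 : c⁻¹ * e * (l2norm μ ξ * l2norm μ (fun v => φ v + r v)) ≤
      c⁻¹ * Bq * (1 + D * S) * M * R := by
    have h1 := l2norm_nonneg μ (fun v => φ v + r v)
    have h2 := l2norm_nonneg μ ψ
    calc c⁻¹ * e * (l2norm μ ξ * l2norm μ (fun v => φ v + r v))
        ≤ c⁻¹ * e * ((Bq * l2norm μ ψ) * ((1 + D * S) * (l2norm μ φ + h ^ γ))) := by gcongr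
      _ = c⁻¹ * Bq * (1 + D * S) * (e * (l2norm μ ψ * (l2norm μ φ + h ^ γ))) := by ring
      _ ≤ c⁻¹ * Bq * (1 + D * S) * (M * R) := by gcongr
      _ = _ := by ring
  refine (abs_integral_mul_sub_wproj_le hb hw hc hcw hBw he0 he hu huw Lξ Lg).trans ?_
  have k4 : a * l2norm μ (fun v => (φ v + r v) - wproj b μ (fun _ => 1) (fun v => φ v + r v) v) ≤
      a * a₂ + (2 * (Bq * L * S)) * (2 * (D * C₀ * S) * R) := by
    calc _ ≤ a * (a₂ + 2 * (D * C₀ * S) * R) := by gcongr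
      _ = a * a₂ + a * (2 * (D * C₀ * S) * R) := by ring
      _ ≤ _ := by gcongr
  linarith

end

/-! ### Localized moments of the residuals -/

section
variable {d : ℕ} {P : Measure (Obs d)} {x₀ : Cov d} {h : ℝ} {π μ₀ μ₁ : Cov d → ℝ}

lemma integral_kern_mul [IsProbabilityMeasure P] (hh : 0 < h) {φ f : Cov d → ℝ}
    (hφ : Measurable φ) (hf : Measurable f) :
    ∫ z, kern x₀ h (cov z) * φ (toUnit x₀ h (cov z)) * f (cov z) ∂P =
      ∫ v, φ v * f (fromUnit x₀ h v) ∂locMeasure (P.map cov) x₀ h := by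
  rw [← (localSample P hh).integral (fun v => φ v * f (fromUnit x₀ h v))
    (hφ.mul (hf.comp (continuous_fromUnit x₀ h).measurable))]
  refine integral_congr_ae (.of_forall fun z => ?_)
  simp only [fromUnit_toUnit x₀ hh.ne', mul_assoc]

lemma measurable_kern_mul {φ : Cov d → ℝ} (hφ : Measurable φ) :
    Measurable fun x => kern x₀ h x * φ (toUnit x₀ h x) :=
  (measurable_kern x₀ h).mul (hφ.comp (continuous_toUnit x₀ h).measurable)

/-- Identifies ξ = q (π - p) as the localized conditional mean of the first residual, as
`LocalSample.integral_abs_mean_sub_uStat_le` requires. -/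
lemma integral_kern_mul_treatment_residual [IsProbabilityMeasure P] (hM : IsModel P π μ₀ μ₁)
    (hh : 0 < h) {p q : Cov d → ℝ} (hq : Measurable q) {Bq : ℝ}
    (hqB : ∀ v ∈ unitCube d, |q v| ≤ Bq) (hp : Measurable p) {B : ℝ}
    (hpB : ∀ x ∈ unitCube d, |p x| ≤ B) (hπB : ∀ x ∈ unitCube d, |π x| ≤ B)
    {φ : Cov d → ℝ} (hφ : Measurable φ) (hφi : Integrable φ (locMeasure (P.map cov) x₀ h)) :
    ∫ z, kern x₀ h (cov z) * φ (toUnit x₀ h (cov z)) *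
        (q (toUnit x₀ h (cov z)) * (trt z - p (cov z))) ∂P =
      ∫ v, (q v * (π (fromUnit x₀ h v) - p (fromUnit x₀ h v))) * φ v
        ∂locMeasure (P.map cov) x₀ h := by
  have hi : Integrable (fun v => φ v * q v) (locMeasure (P.map cov) x₀ h) := by
    refine hφi.mul_bdd (c := Bq) hq.aestronglyMeasurable ?_
    filter_upwards [ae_locMeasure_mem_unitCube (P.map cov) hh] with v hv using hqB v hv
  have h1 := hM.integral_mul_trt_sub (measurable_kern_mul (x₀ := x₀) (h := h) (hφ.mul hq)) hp hpB
    hπB ((localSample P hh).integrable _ (hφ.mul hq) hi)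
  replace h1 := h1.trans (integral_kern_mul hh (hφ.mul hq) (hM.measurable_pi.sub hp))
  refine (Eq.trans ?_ h1).trans ?_
  · refine integral_congr_ae (.of_forall fun z => ?_)
    simp only [Pi.mul_apply]; ring
  · refine integral_congr_ae (.of_forall fun v => ?_)
    simp only [Pi.mul_apply, Pi.sub_apply]; ring

lemma IsModel.measurable_cate (hM : IsModel P π μ₀ μ₁) : Measurable (cate μ₀ μ₁) :=
  hM.measurable_mu₁.sub hM.measurable_mu₀

lemma integral_kern_mul_outcome_residual [IsProbabilityMeasure P] (hM : IsModel P π μ₀ μ₁)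
    (hh : 0 < h) {m T : Cov d → ℝ} (hm : Measurable m) (hT : Measurable T) {B : ℝ}
    (hY : ∀ᵐ z ∂P, |out z| ≤ B) (hmB : ∀ x ∈ unitCube d, |m x| ≤ B)
    (hTB : ∀ x ∈ unitCube d, |T x| ≤ B) (hπB : ∀ x ∈ unitCube d, |π x| ≤ B)
    (hμB : ∀ x ∈ unitCube d, |μ₀ x| ≤ B) (hτB : ∀ x ∈ unitCube d, |cate μ₀ μ₁ x| ≤ B)
    {φ : Cov d → ℝ} (hφ : Measurable φ) (hφi : Integrable φ (locMeasure (P.map cov) x₀ h)) :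
    ∫ z, kern x₀ h (cov z) * φ (toUnit x₀ h (cov z)) *
        (out z - m (cov z) - trt z * T (cov z)) ∂P =
      ∫ v, ((μ₀ (fromUnit x₀ h v) - m (fromUnit x₀ h v)) + π (fromUnit x₀ h v) *
        (cate μ₀ μ₁ (fromUnit x₀ h v) - T (fromUnit x₀ h v))) * φ v
        ∂locMeasure (P.map cov) x₀ h := by
  have h1 := hM.integral_mul_out_sub (measurable_kern_mul (x₀ := x₀) (h := h) hφ) hm hT hY hmB hTB
    hπB hμB hτB ((localSample P hh).integrable _ hφ hφi)
  replace h1 := h1.trans (integral_kern_mul hh hφ ((hM.measurable_mu₀.sub hm).add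
    (hM.measurable_pi.mul (hM.measurable_cate.sub hT))))
  refine h1.trans (integral_congr_ae (.of_forall fun v => ?_))
  simp only [Pi.mul_apply, Pi.sub_apply, Pi.add_apply]; ring

lemma integral_kern_mul_residuals [IsProbabilityMeasure P] (hM : IsModel P π μ₀ μ₁)
    (hh : 0 < h) {p m T q : Cov d → ℝ} (hq : Measurable q) {Bq : ℝ}
    (hqB : ∀ v ∈ unitCube d, |q v| ≤ Bq) (hp : Measurable p) (hm : Measurable m)
    (hT : Measurable T) {B : ℝ} (hY : ∀ᵐ z ∂P, |out z| ≤ B) (hpB : ∀ x ∈ unitCube d, |p x| ≤ B)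
    (hmB : ∀ x ∈ unitCube d, |m x| ≤ B)
    (hTB : ∀ x ∈ unitCube d, |T x| ≤ B) (hπB : ∀ x ∈ unitCube d, |π x| ≤ B)
    (hμB : ∀ x ∈ unitCube d, |μ₀ x| ≤ B) (hτB : ∀ x ∈ unitCube d, |cate μ₀ μ₁ x| ≤ B) :
    ∫ z, kern x₀ h (cov z) * (q (toUnit x₀ h (cov z)) * (trt z - p (cov z))) *
        (out z - m (cov z) - trt z * T (cov z)) ∂P =
      ∫ v, q v * ((π (fromUnit x₀ h v) - p (fromUnit x₀ h v)) *
        ((μ₀ (fromUnit x₀ h v) - m (fromUnit x₀ h v)) + π (fromUnit x₀ h v) *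
          (cate μ₀ μ₁ (fromUnit x₀ h v) - T (fromUnit x₀ h v))) +
        π (fromUnit x₀ h v) * (1 - π (fromUnit x₀ h v)) *
          (cate μ₀ μ₁ (fromUnit x₀ h v) - T (fromUnit x₀ h v)))
        ∂locMeasure (P.map cov) x₀ h := by
  have := isFiniteMeasure_locMeasure (P.map cov) x₀ h
  have hi : Integrable q (locMeasure (P.map cov) x₀ h) := by
    refine Integrable.of_bound hq.aestronglyMeasurable Bq ?_
    filter_upwards [ae_locMeasure_mem_unitCube (P.map cov) hh] with v hv using hqB v hv
  have h1 := hM.integral_mul_residuals (measurable_kern_mul (x₀ := x₀) (h := h) hq) hp hm hT hY hpB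
    hmB hTB hπB hμB hτB ((localSample P hh).integrable _ hq hi)
  have hr := hM.measurable_cate.sub hT
  have hπ := hM.measurable_pi
  replace h1 := h1.trans (integral_kern_mul hh hq (((hπ.sub hp).mul ((hM.measurable_mu₀.sub hm).add
    (hπ.mul hr))).add ((hπ.mul (hπ.const_sub 1)).mul hr)))
  refine (Eq.trans ?_ h1).trans ?_
  · refine integral_congr_ae (.of_forall fun z => ?_)
    simp only; ring
  · refine integral_congr_ae (.of_forall fun v => ?_)
    simp only [Pi.mul_apply, Pi.sub_apply, Pi.add_apply]

/-- Off the ball the kernel vanishes, so `X` has to be bounded only where the scaled covariate lies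
in the cube; there the polynomials ρ are bounded. -/
lemma kern_mul_abs_le (hX : ∀ᵐ z ∂P, cov z ∈ unitCube d) (hh : 0 < h) {X : Obs d → ℝ} {B : ℝ}
    (hB : ∀ᵐ z ∂P, cov z ∈ unitCube d → toUnit x₀ h (cov z) ∈ unitCube d → |X z| ≤ B) :
    ∀ᵐ z ∂P, kern x₀ h (cov z) * |X z| ≤ B * kern x₀ h (cov z) := by
  filter_upwards [hX, hB] with z h1 h2
  by_cases hz : cov z ∈ Metric.closedBall x₀ (h / 2)
  · have h3 := h2 h1 (toUnit_mem_unitCube hh hz)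
    rw [mul_comm B]
    refine mul_le_mul_of_nonneg_left h3 ?_
    rw [kern_of_mem hz]; positivity
  · simp [kern_of_notMem hz]

/-! ### The error of the estimating equation -/

/-- With κ = 1/H, the first and third radicands are controlled by 1/(N H) and the middle term is the
root of a multiple of k/(N H)²; all are O(R²). -/
lemma variance_terms_le {B₁ B₂ M₀ C₀ R c G X κ N k H m : ℝ} (hM₀ : 0 ≤ M₀)
    (hR : 0 ≤ R) (hN : 0 < N) (hH : 0 < H) (hκ : κ = 1 / H)
    (hm : m ≤ M₀) (h1 : 1 / (N * H) ≤ C₀ * R ^ 2)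
    (h2 : k / (N * H) ^ 2 ≤ C₀ * R ^ 2) (hG : G ^ 2 ≤ B₂ ^ 2 * M₀) (hX : X ^ 2 ≤ B₁ ^ 2 * M₀) :
    Real.sqrt ((B₁ * B₂) ^ 2 * κ * m / N) +
      4 * (Real.sqrt ((B₁ * B₂) ^ 2 * κ ^ 2 * (c⁻¹ ^ 2 * k)) / N) +
      9 * Real.sqrt (κ * c⁻¹ ^ 2 * (B₁ ^ 2 * G ^ 2 + B₂ ^ 2 * X ^ 2) / N) ≤
    (Real.sqrt ((B₁ * B₂) ^ 2 * M₀ * C₀) + 4 * Real.sqrt ((B₁ * B₂) ^ 2 * c⁻¹ ^ 2 * C₀) +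
      9 * Real.sqrt (c⁻¹ ^ 2 * (2 * (B₁ * B₂) ^ 2 * M₀) * C₀)) * R := by
  have key : ∀ a b : ℝ, a ≤ b * R ^ 2 → Real.sqrt a ≤ Real.sqrt b * R := fun a b hab => by
    calc Real.sqrt a ≤ Real.sqrt (b * R ^ 2) := Real.sqrt_le_sqrt hab
      _ = _ := by rw [Real.sqrt_mul' _ (sq_nonneg R), Real.sqrt_sq hR]
  have hκ0 : 0 < κ := by rw [hκ]; positivity
  have e1 : κ / N = 1 / (N * H) := by rw [hκ]; field_simp
  have t1 := key ((B₁ * B₂) ^ 2 * κ * m / N) ((B₁ * B₂) ^ 2 * M₀ * C₀) (by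
    calc (B₁ * B₂) ^ 2 * κ * m / N ≤ (B₁ * B₂) ^ 2 * κ * M₀ / N := by gcongr
      _ = (B₁ * B₂) ^ 2 * M₀ * (κ / N) := by ring
      _ ≤ (B₁ * B₂) ^ 2 * M₀ * (C₀ * R ^ 2) := by rw [e1]; gcongr
      _ = _ := by ring)
  have t2 := key ((B₁ * B₂) ^ 2 * c⁻¹ ^ 2 * (k / (N * H) ^ 2)) ((B₁ * B₂) ^ 2 * c⁻¹ ^ 2 * C₀) (by
    calc _ ≤ (B₁ * B₂) ^ 2 * c⁻¹ ^ 2 * (C₀ * R ^ 2) := by gcongr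
      _ = _ := by ring)
  have e2 : Real.sqrt ((B₁ * B₂) ^ 2 * κ ^ 2 * (c⁻¹ ^ 2 * k)) / N =
      Real.sqrt ((B₁ * B₂) ^ 2 * c⁻¹ ^ 2 * (k / (N * H) ^ 2)) := by
    rw [← Real.sqrt_sq hN.le, ← Real.sqrt_div' _ (sq_nonneg N), Real.sqrt_sq hN.le, hκ]
    congr 1
    field_simp
  have t3 := key (κ * c⁻¹ ^ 2 * (B₁ ^ 2 * G ^ 2 + B₂ ^ 2 * X ^ 2) / N)
    (c⁻¹ ^ 2 * (2 * (B₁ * B₂) ^ 2 * M₀) * C₀) (by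
    calc κ * c⁻¹ ^ 2 * (B₁ ^ 2 * G ^ 2 + B₂ ^ 2 * X ^ 2) / N
        ≤ κ * c⁻¹ ^ 2 * (B₁ ^ 2 * (B₂ ^ 2 * M₀) + B₂ ^ 2 * (B₁ ^ 2 * M₀)) / N := by gcongr
      _ = c⁻¹ ^ 2 * (2 * (B₁ * B₂) ^ 2 * M₀) * (κ / N) := by ring
      _ ≤ c⁻¹ ^ 2 * (2 * (B₁ * B₂) ^ 2 * M₀) * (C₀ * R ^ 2) := by rw [e1]; gcongr
      _ = _ := by ring)
  rw [e2]
  linarith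

end

section
variable {d : ℕ}

set_option maxHeartbeats 1000000 in
/-- The bound on the mean absolute error of the estimating equation at the Taylor coefficients. -/
lemma exists_integral_abs_error_le {α β γ rmax : ℝ} (hα : 0 < α) (hβ : 0 < β) (hγ : 0 < γ)
    (hrα : α ≤ rmax) (hrβ : β ≤ rmax) (i : MIdx d (sfloor γ)) {ε c C₀ h₀ : ℝ} (L M : ℝ)
    (hε : 0 < ε) (hc : 0 < c) (hC₀ : 0 ≤ C₀) (A : ℝ → ℝ) {x₀ : Cov d} (hx₀ : x₀ ∈ unitCube d)
    (hmaps : ∀ h, 0 < h → h ≤ h₀ → Set.MapsTo (fromUnit x₀ h) (unitCube d) (unitCube d)) :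
    ∃ C : ℝ, 0 ≤ C ∧ ∀ (n : ℕ), 2 ≤ n → ∀ (P : Measure (Obs d)) [IsProbabilityMeasure P]
      (π μ₀ μ₁ : Cov d → ℝ), IsModel P π μ₀ μ₁ → (∀ᵐ z ∂P, out z ^ 2 ≤ M) → IsHolder α L π →
      (∀ x ∈ unitCube d, ε ≤ π x ∧ π x ≤ 1 - ε) → IsHolder β L μ₀ → IsHolder γ L (cate μ₀ μ₁) →
      ∀ (h R : ℝ) (k : ℕ), TuningRates d α β γ rmax C₀ R n h k → (h₀ ≤ h → 1 ≤ C₀ * R) →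
      ∀ (b : Cov d → Fin k → ℝ), Measurable b →
      HolderApprox b (locMeasure (P.map cov) x₀ h) rmax A →
      EigBounded c M (popQ (sfloor γ) (P.map cov) π x₀ h) →
      EigBounded c M (gram b (locMeasure (P.map cov) x₀ h)) →
      ∀ (p m : Cov d → ℝ), Measurable p → Measurable m →
      ∀ (Fh : Measure (Cov d)) [IsFiniteMeasure Fh],
      NuisanceOK α β γ L c M n (P.map cov) π μ₀ x₀ h p m Fh →
      (n : ℝ) ^ (-1 / (1 + d / (2 * γ) + max (d / (4 * ((α + β) / 2))) (1 + d / (2 * γ)))) = R →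
      ∀ (θ : MIdx d (sfloor γ) → ℝ),
      (∀ x, taylorPoly x₀ (sfloor γ) (cate μ₀ μ₁) x = rhoh (sfloor γ) x₀ h x ⬝ᵥ θ) →
      Integrable (fun Z : Fin n → Obs d => estR (sfloor γ) p m Fh b x₀ h Z i -
        ((estQ (sfloor γ) p Fh b x₀ h Z).mulVec θ) i) (Measure.pi fun _ : Fin n => P) ∧
      ∫ Z : Fin n → Obs d, |estR (sfloor γ) p m Fh b x₀ h Z i -
        ((estQ (sfloor γ) p Fh b x₀ h Z).mulVec θ) i| ∂(Measure.pi fun _ : Fin n => P) ≤ C * R := by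
  obtain ⟨Bq, hBq0, hBq⟩ := (AllHolder.rho (sfloor γ) i).exists_bound
  set M₀ := |M| / ε ^ 2
  set D := (d : ℝ) ^ sfloor γ * |L|
  -- A common bound on the cube: 1 for π, √|M| for Y and the estimates, |L| for μ₀ and τ, and the
  -- last group for `T`, bounded as τ plus its Taylor remainder.
  set B := 1 + Real.sqrt |M| + |L| + (|L| + D * Real.sqrt d ^ γ)
  have hB1 : 1 ≤ B := by
    have : 0 ≤ Real.sqrt |M| + |L| + (|L| + D * Real.sqrt d ^ γ) := by positivity
    simp only [B]; linarith
  have hBM : Real.sqrt |M| ≤ B := by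
    have : 0 ≤ 1 + |L| + (|L| + D * Real.sqrt d ^ γ) := by positivity
    simp only [B]; linarith
  have hBL : |L| ≤ B := by
    have : 0 ≤ 1 + Real.sqrt |M| + (|L| + D * Real.sqrt d ^ γ) := by positivity
    simp only [B]; linarith
  have hBT : |L| + D * Real.sqrt d ^ γ ≤ B := by
    have : 0 ≤ 1 + Real.sqrt |M| + |L| := by positivity
    simp only [B]; linarith
  have hM₀ : 0 ≤ M₀ := by positivity
  obtain ⟨Cb, hCb, Hb⟩ := exists_bias_le (γ := γ) hα hβ hrα hrβ (AllHolder.rho (sfloor γ) i)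
    (measurable_rho (sfloor γ) i) (abs_nonneg L) hc (abs_nonneg M) hC₀ (by positivity : 0 ≤ D) (M₀ := M₀) A
    hx₀ hmaps
  set B₁ := Bq * (2 * B)
  set B₂ := 4 * B
  refine ⟨Cb + Bq * D * M₀ * C₀ + (Real.sqrt ((B₁ * B₂) ^ 2 * M₀ * C₀) +
    4 * Real.sqrt ((B₁ * B₂) ^ 2 * c⁻¹ ^ 2 * C₀) +
      9 * Real.sqrt (c⁻¹ ^ 2 * (2 * (B₁ * B₂) ^ 2 * M₀) * C₀)), by positivity, ?_⟩
  intro n hn P _ π μ₀ μ₁ hM hY hπ hπε hμ hτ h R k ht hlarge b hbm hA hQ hG p m hp hm Fh _ hN' hRn θ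
    hθ
  have hh := ht.h_pos
  have hR := ht.rate_pos
  have : IsProbabilityMeasure (P.map (cov : Obs d → Cov d)) :=
    Measure.isProbabilityMeasure_map measurable_cov.aemeasurable
  set F := P.map (cov : Obs d → Cov d)
  set μ := locMeasure F x₀ h
  have : IsFiniteMeasure μ := isFiniteMeasure_locMeasure F x₀ h
  have hF : ∀ᵐ x ∂F, x ∈ unitCube d :=
    (ae_map_iff measurable_cov.aemeasurable (measurableSet_unitCube d)).2 hM.cov_mem
  have hloc := ae_locMeasure (x₀ := x₀) hF hh
  have hcube : ∀ᵐ v ∂μ, v ∈ unitCube d := hloc.mono fun v hv => hv.1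
  set τ := cate μ₀ μ₁
  set T := taylorPoly x₀ (sfloor γ) τ
  set q : Cov d → ℝ := fun v => rho (sfloor γ) v i
  set w := locDensity F Fh x₀ h
  have hTm : Measurable T := (continuous_taylorPoly x₀ (sfloor γ) τ).measurable
  have hqm : Measurable q := measurable_rho (sfloor γ) i
  have hfu := (continuous_fromUnit x₀ h).measurable
  -- bounds on the cube
  have hMle : M ≤ |M| := le_abs_self M
  have hsq : ∀ {a : ℝ}, a ^ 2 ≤ M → |a| ≤ B := fun ha =>
    (Real.abs_le_sqrt (ha.trans hMle)).trans hBM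
  have hLle : ∀ {a : ℝ}, |a| ≤ L → |a| ≤ B := fun ha => ha.trans ((le_abs_self L).trans hBL)
  have yB : ∀ᵐ z ∂P, |out z| ≤ B := hY.mono fun z hz => hsq hz
  have pB : ∀ x ∈ unitCube d, |p x| ≤ B := fun x hx => hsq (hN'.bound_pi x hx)
  have mB : ∀ x ∈ unitCube d, |m x| ≤ B := fun x hx => hsq (hN'.bound_mu x hx)
  have π1 : ∀ x ∈ unitCube d, |π x| ≤ 1 := fun x hx => by
    obtain ⟨h1, h2⟩ := hπε x hx
    rw [abs_of_pos (by linarith)]; linarith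
  have πB : ∀ x ∈ unitCube d, |π x| ≤ B := fun x hx => (π1 x hx).trans hB1
  have μB : ∀ x ∈ unitCube d, |μ₀ x| ≤ B := fun x hx => hLle (hμ.abs_le x hx)
  have τB : ∀ x ∈ unitCube d, |τ x| ≤ B := fun x hx => hLle (hτ.abs_le x hx)
  have hrem : ∀ x ∈ unitCube d, |τ x - T x| ≤ D * ‖x - x₀‖ ^ γ := fun x hx => by
    have h1 := (hτ.holderRec.mono (le_abs_self L)).taylor_remainder
      (by linarith [sfloor_lt hγ]) hx₀ hx
    rwa [show ((sfloor γ : ℕ) : ℝ) + (γ - sfloor γ) = γ by ring] at h1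
  have TB : ∀ x ∈ unitCube d, |T x| ≤ B := fun x hx => by
    have h1 := hrem x hx
    have h2 : ‖x - x₀‖ ^ γ ≤ Real.sqrt d ^ γ :=
      Real.rpow_le_rpow (norm_nonneg _) (norm_sub_le_of_mem_unitCube hx hx₀) hγ.le
    have h3 := (hτ.abs_le x hx).trans (le_abs_self L)
    have h4 : D * ‖x - x₀‖ ^ γ ≤ D * Real.sqrt d ^ γ := by gcongr
    have h5 := abs_sub_abs_le_abs_sub (T x) (τ x)
    rw [abs_sub_comm] at h5
    linarith
  have rB : ∀ᵐ v ∂μ, |τ (fromUnit x₀ h v) - T (fromUnit x₀ h v)| ≤ D * h ^ γ := by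
    filter_upwards [hloc] with v hv
    refine (hrem _ hv.2.1).trans ?_
    have : ‖fromUnit x₀ h v - x₀‖ ^ γ ≤ h ^ γ :=
      Real.rpow_le_rpow (norm_nonneg _) (hv.2.2.trans (by linarith)) hγ.le
    gcongr
  have hmass : μ.real Set.univ ≤ M₀ :=
    (measureReal_locMeasure_le hM.measurable_pi hM.cov_mem hε hπε hh hQ).trans
      (by simp only [M₀]; gcongr)
  -- the basis and the weight
  have hbL : ∀ j, MemLp (fun v => b v j) 2 μ := memLp_basis hcube hbm hc hG
  have hpos := pos_wgram hcube hc hG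
  have hwm : AEStronglyMeasurable w μ := (measurable_locDensity F Fh x₀ h).aestronglyMeasurable
  have hwc : ∀ᵐ v ∂μ, c ≤ w v := hN'.locDensity_bounds.mono fun v hv => hv.1
  have hwB : ∀ᵐ v ∂μ, |w v| ≤ |M| := hN'.locDensity_bounds.mono fun v hv => hv.2
  have huw : IsUnit (wgram b μ w) := isUnit_wgram hbL hwm hc hwc hwB hpos
  have hu1 : IsUnit (wgram b μ fun _ => 1) :=
    isUnit_wgram hbL (c := 1) (B := 1) aestronglyMeasurable_const one_pos (by simp) (by simp) hpos
  -- the projections of the residuals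
  set f₁ : Cov d → ℝ := fun x => π x - p x
  set f₂ : Cov d → ℝ := fun x => μ₀ x - m x
  set r : Cov d → ℝ := fun v => π (fromUnit x₀ h v) * (τ (fromUnit x₀ h v) - T (fromUnit x₀ h v))
  have hπm := hM.measurable_pi
  have hτm : Measurable τ := hM.measurable_cate
  have hf₁m : Measurable f₁ := hπm.sub hp
  have hf₂m : Measurable f₂ := hM.measurable_mu₀.sub hm
  have hτTm : Measurable fun v => τ (fromUnit x₀ h v) - T (fromUnit x₀ h v) :=
    (hτm.comp hfu).sub (hTm.comp hfu)
  have hrm : Measurable r := (hπm.comp hfu).mul hτTm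
  have hf₁ : IsHolder α |L| f₁ := by
    have := (hN'.smooth_pi.mono hα (le_abs_self L)).neg hα
    simpa only [neg_sub] using this
  have hf₂ : IsHolder β |L| f₂ := by
    have := (hN'.smooth_mu.mono hβ (le_abs_self L)).neg hβ
    simpa only [neg_sub] using this
  have hr : ∀ᵐ v ∂μ, |r v| ≤ D * h ^ γ := by
    filter_upwards [hloc, rB] with v hv h1
    rw [abs_mul]
    exact (mul_le_of_le_one_left (abs_nonneg _) (π1 _ hv.2.1)).trans h1
  have n₁ : l2norm μ (fun v => f₁ (fromUnit x₀ h v)) = locNorm F x₀ h fun x => p x - π x := by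
    simp only [locNorm, l2norm, f₁]
    congr 2; funext v; ring
  have n₂ : l2norm μ (fun v => f₂ (fromUnit x₀ h v)) = locNorm F x₀ h fun x => m x - μ₀ x := by
    simp only [locNorm, l2norm, f₂]
    congr 2; funext v; ring
  have hacc : covErr F Fh x₀ h * (l2norm μ (fun v => f₁ (fromUnit x₀ h v)) *
      (l2norm μ (fun v => f₂ (fromUnit x₀ h v)) + h ^ γ)) ≤ |M| * R := by
    rw [n₁, n₂]
    refine hN'.cov_accuracy.trans ?_
    rw [hRn]
    gcongr
  have hbias := Hb n k h R ht hlarge b μ (hloc.mono fun v hv => ⟨hv.1, hv.2.1⟩) hmass hbL hA hu1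
    w |M| (covErr F Fh x₀ h) huw hwm hwc hwB ENNReal.toReal_nonneg hN'.abs_locDensity_sub_one_le
    f₁ f₂ r hf₁m hf₁ hf₂m hf₂ hrm hr hacc
  set ξ : Cov d → ℝ := fun v => q v * f₁ (fromUnit x₀ h v) with hξ
  set g : Cov d → ℝ := fun v => f₂ (fromUnit x₀ h v) + r v with hg
  have bξ : ∀ᵐ v ∂μ, |ξ v| ≤ B₁ := by
    filter_upwards [hloc] with v hv
    rw [hξ, abs_mul]
    have h1 : |f₁ (fromUnit x₀ h v)| ≤ 2 * B :=
      (abs_sub _ _).trans (by linarith [πB _ hv.2.1, pB _ hv.2.1])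
    exact mul_le_mul (hBq v hv.1) h1 (abs_nonneg _) hBq0
  have bg : ∀ᵐ v ∂μ, |g v| ≤ B₂ := by
    filter_upwards [hloc] with v hv
    have h1 : |f₂ (fromUnit x₀ h v)| ≤ 2 * B :=
      (abs_sub _ _).trans (by linarith [μB _ hv.2.1, mB _ hv.2.1])
    have h2 : |r v| ≤ 2 * B := by
      simp only [r]
      rw [abs_mul]
      exact (mul_le_of_le_one_left (abs_nonneg _) (π1 _ hv.2.1)).trans
        ((abs_sub _ _).trans (by linarith [τB _ hv.2.1, TB _ hv.2.1]))
    exact (abs_add_le _ _).trans (by simp only [B₂]; linarith)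
  have hξm : Measurable ξ := hqm.mul (hf₁m.comp hfu)
  have hgm : Measurable g := (hf₂m.comp hfu).add hrm
  have Lξ : MemLp ξ 2 μ := MemLp.of_bound hξm.aestronglyMeasurable _ bξ
  have Lg : MemLp g 2 μ := MemLp.of_bound hgm.aestronglyMeasurable _ bg
  have hB₁0 : 0 ≤ B₁ := by positivity
  have hB₂0 : 0 ≤ B₂ := by positivity
  have sqb : ∀ {f : Cov d → ℝ} {K : ℝ}, 0 ≤ K → (∀ᵐ v ∂μ, |f v| ≤ K) →
      l2norm μ f ^ 2 ≤ K ^ 2 * M₀ := fun {f K} hK hf => by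
    have h1 := pow_le_pow_left₀ (l2norm_nonneg μ f) (l2norm_le_of_bound hK hf) 2
    rw [mul_pow, Real.sq_sqrt measureReal_nonneg] at h1
    exact h1.trans (by gcongr)
  -- the mean of the estimating equation
  have hmean := integral_kern_mul_residuals (x₀ := x₀) hM hh hqm hBq hp hm hTm yB pB mB TB πB μB τB
  have hrest : |∫ v, q v * (π (fromUnit x₀ h v) * (1 - π (fromUnit x₀ h v)) *
      (τ (fromUnit x₀ h v) - T (fromUnit x₀ h v))) ∂μ| ≤ Bq * D * M₀ * C₀ * R := by
    have h1 : ∀ᵐ v ∂μ, ‖q v * (π (fromUnit x₀ h v) * (1 - π (fromUnit x₀ h v)) *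
        (τ (fromUnit x₀ h v) - T (fromUnit x₀ h v)))‖ ≤ Bq * (D * h ^ γ) := by
      filter_upwards [hloc, rB] with v hv h2
      rw [Real.norm_eq_abs, abs_mul, abs_mul]
      refine mul_le_mul (hBq v hv.1) ((mul_le_of_le_one_left (abs_nonneg _) ?_).trans h2)
        (by positivity) hBq0
      obtain ⟨h3, h4⟩ := hπε _ hv.2.1
      rw [abs_of_nonneg (by nlinarith)]
      nlinarith
    refine (norm_integral_le_of_norm_le_const h1).trans ?_
    have h2 := ht.smoothing
    calc Bq * (D * h ^ γ) * μ.real Set.univ ≤ Bq * (D * (C₀ * R)) * M₀ := by gcongr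
      _ = _ := by ring
  have hI1 : Integrable (fun v => ξ v * g v) μ := integrable_mul_of_memLp Lξ Lg
  have hI2 : Integrable (fun v => ξ v * wproj b μ w g v) μ :=
    integrable_mul_of_memLp Lξ (memLp_wproj hbL w g)
  have hI3 : Integrable (fun v => q v * (π (fromUnit x₀ h v) * (1 - π (fromUnit x₀ h v)) *
      (τ (fromUnit x₀ h v) - T (fromUnit x₀ h v)))) μ := by
    refine Integrable.of_bound (hqm.mul (((hπm.comp hfu).mul ((hπm.comp hfu).const_sub 1)).mul
      hτTm)).aestronglyMeasurable (Bq * (1 * (2 * B))) ?_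
    filter_upwards [hloc] with v hv
    rw [Real.norm_eq_abs, abs_mul, abs_mul]
    obtain ⟨h3, h4⟩ := hπε _ hv.2.1
    have h5 : |π (fromUnit x₀ h v) * (1 - π (fromUnit x₀ h v))| ≤ 1 := by
      rw [abs_of_nonneg (by nlinarith)]
      nlinarith
    have h6 : |τ (fromUnit x₀ h v) - T (fromUnit x₀ h v)| ≤ 2 * B :=
      (abs_sub _ _).trans (by linarith [τB _ hv.2.1, TB _ hv.2.1])
    exact mul_le_mul (hBq v hv.1) (mul_le_mul h5 h6 (abs_nonneg _) zero_le_one) (by positivity)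
      hBq0
  have hmean' : |∫ z, kern x₀ h (cov z) * (q (toUnit x₀ h (cov z)) * (trt z - p (cov z))) *
        (out z - m (cov z) - trt z * T (cov z)) ∂P - ∫ v, ξ v * wproj b μ w g v ∂μ| ≤
      Cb * R + Bq * D * M₀ * C₀ * R := by
    -- The mean of the product of residuals is ∫ ξ g plus the smoothing term, so subtracting the
    -- mean of the U-statistic leaves the projection bias.
    have e1 : ∫ z, kern x₀ h (cov z) * (q (toUnit x₀ h (cov z)) * (trt z - p (cov z))) *
        (out z - m (cov z) - trt z * T (cov z)) ∂P - ∫ v, ξ v * wproj b μ w g v ∂μ =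
        ∫ v, ξ v * (g v - wproj b μ w g v) ∂μ +
        ∫ v, q v * (π (fromUnit x₀ h v) * (1 - π (fromUnit x₀ h v)) *
          (τ (fromUnit x₀ h v) - T (fromUnit x₀ h v))) ∂μ := by
      have e2 : ∫ v, ξ v * (g v - wproj b μ w g v) ∂μ =
          ∫ v, ξ v * g v ∂μ - ∫ v, ξ v * wproj b μ w g v ∂μ := by
        rw [← integral_sub hI1 hI2]
        exact integral_congr_ae (.of_forall fun v => by simp only; ring)
      rw [e2, hmean, sub_add_eq_add_sub, ← integral_add hI1 hI3]
      congr 1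
      exact integral_congr_ae (.of_forall fun v => by simp only [ξ, g, f₁, f₂, r]; ring)
    rw [e1]
    exact (abs_add_le _ _).trans (add_le_add hbias hrest)
  -- the error of the estimating equation
  have hX₁ : Measurable fun z : Obs d => q (toUnit x₀ h (cov z)) * (trt z - p (cov z)) :=
    (hqm.comp ((continuous_toUnit x₀ h).measurable.comp measurable_cov)).mul
      (measurable_trt.sub (hp.comp measurable_cov))
  have hX₂ : Measurable fun z : Obs d => out z - m (cov z) - trt z * T (cov z) :=
    (measurable_out.sub (hm.comp measurable_cov)).sub
      (measurable_trt.mul (hTm.comp measurable_cov))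
  have bX₁ := kern_mul_abs_le (x₀ := x₀) (h := h) (B := B₁) hM.cov_mem hh
    (X := fun z => q (toUnit x₀ h (cov z)) * (trt z - p (cov z))) (.of_forall fun z h1 h2 => by
      rw [abs_mul]
      have h3 : |trt z - p (cov z)| ≤ 2 * B := by
        have h4 : |trt z| ≤ 1 := by rcases trt_mem z with h | h <;> simp [h]
        exact (abs_sub _ _).trans (by linarith [pB _ h1])
      exact mul_le_mul (hBq _ h2) h3 (abs_nonneg _) hBq0)
  have bX₂ := kern_mul_abs_le (x₀ := x₀) (h := h) (B := B₂) hM.cov_mem hh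
    (X := fun z => out z - m (cov z) - trt z * T (cov z)) (yB.mono fun z h0 h1 h2 => by
      have h4 : |trt z * T (cov z)| ≤ B := by
        rcases trt_mem z with h | h
        · simp only [h, zero_mul, abs_zero]; linarith
        · simpa [h] using TB _ h1
      have h5 := abs_sub (out z - m (cov z)) (trt z * T (cov z))
      have h6 := abs_sub (out z) (m (cov z))
      have h7 := mB _ h1
      simp only [B₂]; linarith)
  obtain ⟨r1, r2⟩ := (localSample P hh).integral_abs_mean_sub_uStat_le hbm hbL hwm hc hwc hwB huw
    hX₁ hX₂ hB₁0 bX₁ bX₂ Lξ Lg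
    (fun φ hφ hφi => integral_kern_mul_treatment_residual hM hh hqm hBq hp pB πB hφ hφi)
    (fun φ hφ hφi => integral_kern_mul_outcome_residual hM hh hm hTm yB mB TB πB μB τB hφ hφi) hn
  have e := fun Z : Fin n → Obs d => estR_sub_estQ_mulVec hh hN'.abs_cont b p m hθ i Z
  refine ⟨r1.congr (.of_forall fun Z => (e Z).symm),
    (integral_congr_ae (.of_forall fun Z => congrArg abs (e Z))).trans_le (r2.trans ?_)⟩
  have hv := variance_terms_le (B₁ := B₁) (B₂ := B₂) (M₀ := M₀) (c := c) (κ := 1 / h ^ d) hM₀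
    hR.le (by positivity : (0 : ℝ) < n) (by positivity : 0 < h ^ d) rfl hmass
    ht.variance_linear ht.variance_quadratic (sqb hB₂0 bg) (sqb hB₁0 bξ)
  linarith

end

/-! ### The risk of the estimator -/

/-- The error of the solution of a perturbed linear equation. -/
lemma abs_dotProduct_inv_mulVec_sub_le {ι : Type*} [Fintype ι] [DecidableEq ι]
    {Q Qh : Matrix ι ι ℝ} {c M : ℝ} (hc : 0 < c) (hQt : Q.transpose = Q) (hQ : EigBounded c M Q)
    (hu : IsUnit Qh) (hM : opNorm (Qh⁻¹ - Q⁻¹) ≤ M) (ρ θ R : ι → ℝ) :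
    |ρ ⬝ᵥ Qh⁻¹.mulVec R - ρ ⬝ᵥ θ| ≤
      ‖WithLp.toLp 2 ρ‖ * (|M| + c⁻¹) * ∑ i, |R i - (Qh.mulVec θ) i| := by
  have hdet := (Matrix.isUnit_iff_isUnit_det _).1 hu
  have e1 : ρ ⬝ᵥ Qh⁻¹.mulVec R - ρ ⬝ᵥ θ = ρ ⬝ᵥ Qh⁻¹.mulVec (R - Qh.mulVec θ) := by
    rw [Matrix.mulVec_sub, Matrix.mulVec_mulVec, Matrix.nonsing_inv_mul _ hdet, Matrix.one_mulVec,
      dotProduct_sub]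
  have h1 : opNorm Qh⁻¹ ≤ |M| + c⁻¹ := by
    have h2 := opNorm_add_le (Qh⁻¹ - Q⁻¹) Q⁻¹
    rw [sub_add_cancel] at h2
    have h3 := hQ.opNorm_inv_le hQt hc
    linarith [le_abs_self M]
  rw [e1, mul_assoc]
  refine (abs_dotProduct_le_norm _ _).trans (mul_le_mul_of_nonneg_left ?_ (norm_nonneg _))
  refine (norm_mulVec_le_opNorm _ _).trans ?_
  exact mul_le_mul h1 (norm_toLp_le_sum _) (norm_nonneg _) (by positivity)

lemma rhoh_self {d : ℕ} (N : ℕ) (x₀ : Cov d) (h : ℝ) :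
    rhoh N x₀ h x₀ = rho N (WithLp.toLp 2 fun _ => 1 / 2) := by
  simp [rhoh, toUnit]

/-- A bound on an integral over an event in a product space by means of its sections. -/
lemma setLIntegral_prod_le {T E : Type*} [MeasurableSpace T] [MeasurableSpace E] {ν : Measure T}
    [IsProbabilityMeasure ν] {Λ : Measure E} [SFinite Λ] {G : Set (T × E)}
    (hG : MeasurableSet G) {p : T → Prop} {f : T × E → ENNReal} {q : T × E → ENNReal}
    {K : ENNReal} (hpG : ∀ᵐ ω ∂ν.prod Λ, ω ∈ G → p ω.1 ∧ f ω ≤ q ω)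
    (hq : ∀ t, p t → ∫⁻ z, q (t, z) ∂Λ ≤ K) :
    ∫⁻ ω in G, f ω ∂ν.prod Λ ≤ K := by
  rw [← lintegral_indicator hG]
  -- Only this inequality of Tonelli's theorem is needed, and it requires no measurability of the
  -- integrand.
  refine (lintegral_prod_le _).trans ?_
  have h1 : ∀ᵐ t ∂ν, ∫⁻ z, G.indicator f (t, z) ∂Λ ≤ K := by
    filter_upwards [Measure.ae_ae_of_ae_prod hpG] with t ht
    -- If `p t` fails then the section of `G` at `t` is null; otherwise the restriction to `G` is
    -- dropped and the section bounded by the full integral of `q`.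
    by_cases hp : p t
    · refine le_trans (lintegral_mono_ae ?_) (hq t hp)
      filter_upwards [ht] with z hz
      by_cases hzG : (t, z) ∈ G
      · rw [Set.indicator_of_mem hzG]; exact (hz hzG).2
      · rw [Set.indicator_of_notMem hzG]; exact zero_le
    · have h2 : ∫⁻ z, G.indicator f (t, z) ∂Λ = 0 := by
        rw [← lintegral_zero (μ := Λ)]
        refine lintegral_congr_ae ?_
        filter_upwards [ht] with z hz
        exact Set.indicator_of_notMem (fun hzG => hp (hz hzG).1) _
      rw [h2]; exact zero_le
  refine (lintegral_mono_ae h1).trans ?_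
  simp

end RLearner

end

/-! ### The risk bound -/

open RLearner in
theorem theorem2 (d : ℕ) (hd : 0 < d) (α β γ s : ℝ) (hα : 0 < α) (hβ : 0 < β) (hγ : 0 < γ)
    (hs : s = (α + β) / 2) :
    ∃ rmax : ℝ, 0 < rmax ∧
    ∀ (x₀ : Cov d), (∀ j, x₀ j ∈ Set.Ioo (0 : ℝ) 1) →
    ∀ (ε L c M : ℝ) (A : ℝ → ℝ), 0 < ε → 0 < c →
    ∃ C : ℝ, 0 < C ∧
    -- the sample size and the law `P` of an observation
    ∀ (n : ℕ), 2 ≤ n →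
    ∀ (P : Measure (Obs d)) [IsProbabilityMeasure P] (π μ₀ μ₁ : Cov d → ℝ), IsModel P π μ₀ μ₁ →
    (∀ᵐ z ∂P, out z ^ 2 ≤ M) →
    IsHolder α L π → (∀ x ∈ unitCube d, ε ≤ π x ∧ π x ≤ 1 - ε) →
    IsHolder β L μ₀ → IsHolder γ L (cate μ₀ μ₁) →
    -- the tuning parameters and the basis
    ∀ (h : ℝ) (k : ℕ), TuningOK d s γ c M n h k →
    ∀ (b : Cov d → Fin k → ℝ), Measurable b →
    HolderApprox b (locMeasure (P.map cov) x₀ h) rmax A →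
    EigBounded c M (popQ (sfloor γ) (P.map cov) π x₀ h) →
    EigBounded c M (gram b (locMeasure (P.map cov) x₀ h)) →
    -- the independent training sample, with law `ν`, and the nuisance estimators
    ∀ (T : Type*) [MeasurableSpace T] (ν : Measure T) [IsProbabilityMeasure ν]
      (pihat muhat : T → Cov d → ℝ) (Fhat : Kernel T (Cov d)) [IsMarkovKernel Fhat],
    Measurable (Function.uncurry pihat) → Measurable (Function.uncurry muhat) →
    -- an event (for instance the sure event) on which the conditions on estimates hold
    ∀ (G : Set (T × (Fin n → Obs d))), MeasurableSet G →
    (∀ᵐ ω ∂(ν.prod (Measure.pi fun _ : Fin n => P)), ω ∈ G →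
      NuisanceOK α β γ L c M n (P.map cov) π μ₀ x₀ h (pihat ω.1) (muhat ω.1) (Fhat ω.1) ∧
      IsUnit (estQ (sfloor γ) (pihat ω.1) (Fhat ω.1) b x₀ h ω.2) ∧
      opNorm ((estQ (sfloor γ) (pihat ω.1) (Fhat ω.1) b x₀ h ω.2)⁻¹
        - (popQ (sfloor γ) (P.map cov) π x₀ h)⁻¹) ≤ M) →
    (s < (d / 4) / (1 + d / (2 * γ)) →
      ∫⁻ ω in G, ENNReal.ofReal
          |tauHat (sfloor γ) (pihat ω.1) (muhat ω.1) (Fhat ω.1) b x₀ h ω.2 - cate μ₀ μ₁ x₀|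
          ∂(ν.prod (Measure.pi fun _ : Fin n => P))
        ≤ ENNReal.ofReal (C * (n : ℝ) ^ (-1 / (1 + d / (2 * γ) + d / (4 * s))))) ∧
    ((d / 4) / (1 + d / (2 * γ)) ≤ s →
      ∫⁻ ω in G, ENNReal.ofReal
          |tauHat (sfloor γ) (pihat ω.1) (muhat ω.1) (Fhat ω.1) b x₀ h ω.2 - cate μ₀ μ₁ x₀|
          ∂(ν.prod (Measure.pi fun _ : Fin n => P))
        ≤ ENNReal.ofReal (C * (n : ℝ) ^ (-1 / (2 + d / γ)))) := by
  obtain ⟨rmax, hrα, hrβ, Htune⟩ := exists_tuningRates d hd hα hβ hγ hs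
  refine ⟨rmax, hα.trans_le hrα, fun x₀ hx₀ ε L c M A hε hc => ?_⟩
  obtain ⟨⟨C₁, hC₁⟩, hlg⟩ := Htune c M hc
  obtain ⟨h₀, hh₀, hmaps⟩ := exists_mapsTo_fromUnit hx₀
  obtain ⟨C₂, hC₂, hC₂'⟩ := hlg h₀ hh₀
  have hx₀c : x₀ ∈ unitCube d := fun j => Set.Ioo_subset_Icc_self (hx₀ j)
  have hs0 : 0 < s := by rw [hs]; linarith
  have hC₀ : 0 ≤ max C₁ C₂ := hC₂.trans (le_max_right _ _)
  choose Ce hCe He using fun i : MIdx d (sfloor γ) =>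
    exists_integral_abs_error_le hα hβ hγ hrα hrβ i L M hε hc hC₀ A hx₀c hmaps
  set K := ‖WithLp.toLp 2 (rho (d := d) (sfloor γ) (WithLp.toLp 2 fun _ => 1 / 2))‖ *
    (|M| + c⁻¹)
  have hK : 0 ≤ K := by positivity
  have hsum : 0 ≤ ∑ i, Ce i := Finset.sum_nonneg fun i _ => hCe i
  -- The 1 only serves to make the constant positive.
  refine ⟨K * ∑ i, Ce i + 1, by positivity, ?_⟩
  intro n hn P _ π μ₀ μ₁ hM hY hπ hπε hμ hτ h k hhk b hb hA hQ hGr T _ ν _ pihat muhat Fhat _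
    hpm hmm G hG hcond
  have ht := (hC₁ n hn h k hhk).mono (le_max_left C₁ C₂)
  have hR := ht.rate_pos
  have hlarge : h₀ ≤ h → 1 ≤ max C₁ C₂ * targetRate d s γ n := fun hle =>
    (hC₂' n hn h k hhk hle).trans (mul_le_mul_of_nonneg_right (le_max_right _ _) hR.le)
  obtain ⟨θ, hθ⟩ := exists_taylorPoly_eq_rhoh x₀ ht.h_pos.ne' (sfloor γ) (cate μ₀ μ₁)
  have hθ₀ : cate μ₀ μ₁ x₀ = rhoh (sfloor γ) x₀ h x₀ ⬝ᵥ θ := by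
    rw [← hθ, taylorPoly_self]
  have main : ∫⁻ ω in G, ENNReal.ofReal
      |tauHat (sfloor γ) (pihat ω.1) (muhat ω.1) (Fhat ω.1) b x₀ h ω.2 - cate μ₀ μ₁ x₀|
      ∂(ν.prod (Measure.pi fun _ : Fin n => P)) ≤
      ENNReal.ofReal ((K * ∑ i, Ce i + 1) * targetRate d s γ n) := by
    -- The conditions on the nuisance estimates depend on the training sample alone and can be fixed
    -- section by section. The condition on Q̂ also involves the main sample; it is used pointwise
    -- on `G` to pass to the estimating equation, whose mean absolute value is then bounded without
    -- restricting to `G`.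
    refine setLIntegral_prod_le hG
      (p := fun t => NuisanceOK α β γ L c M n (P.map cov) π μ₀ x₀ h (pihat t) (muhat t) (Fhat t))
      (q := fun ω => ENNReal.ofReal (K * ∑ i, |estR (sfloor γ) (pihat ω.1) (muhat ω.1) (Fhat ω.1)
        b x₀ h ω.2 i - ((estQ (sfloor γ) (pihat ω.1) (Fhat ω.1) b x₀ h ω.2).mulVec θ) i|)) ?_ ?_
    · filter_upwards [hcond] with ω hω hωG
      obtain ⟨h1, h2, h3⟩ := hω hωG
      refine ⟨h1, ENNReal.ofReal_le_ofReal ?_⟩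
      rw [tauHat, hθ₀]
      have h4 := abs_dotProduct_inv_mulVec_sub_le hc (popQ_transpose _ _ _ _ _) hQ h2 h3
        (rhoh (sfloor γ) x₀ h x₀) θ (estR (sfloor γ) (pihat ω.1) (muhat ω.1) (Fhat ω.1) b x₀ h ω.2)
      -- The vector ρ_h(x₀) is ρ at the centre of the cube for every `h`, so `K` is a fixed
      -- constant.
      rwa [rhoh_self] at h4 ⊢
    · intro t hN
      have hpt : Measurable (pihat t) := hpm.comp measurable_prodMk_left
      have hmt : Measurable (muhat t) := hmm.comp measurable_prodMk_left
      have H := fun i => He i n hn P π μ₀ μ₁ hM hY hπ hπε hμ hτ h _ k ht hlarge b hb hA hQ hGr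
        (pihat t) (muhat t) hpt hmt (Fhat t) hN
        (by rw [← targetRate_eq d hd hs0 hγ n, hs]) θ hθ
      have hi : ∀ i ∈ Finset.univ, Integrable (fun Z : Fin n → Obs d =>
          |estR (sfloor γ) (pihat t) (muhat t) (Fhat t) b x₀ h Z i -
            ((estQ (sfloor γ) (pihat t) (Fhat t) b x₀ h Z).mulVec θ) i|)
          (Measure.pi fun _ : Fin n => P) := fun i _ => (H i).1.abs
      rw [← ofReal_integral_eq_lintegral_ofReal ((integrable_finsetSum _ hi).const_mul K)
        (.of_forall fun Z => mul_nonneg hK (Finset.sum_nonneg fun i _ => abs_nonneg _))]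
      refine ENNReal.ofReal_le_ofReal ?_
      rw [integral_const_mul, integral_finsetSum _ hi]
      calc _ ≤ K * ∑ i, Ce i * targetRate d s γ n :=
            mul_le_mul_of_nonneg_left (Finset.sum_le_sum fun i _ => (H i).2) hK
        _ = K * (∑ i, Ce i) * targetRate d s γ n := by rw [← Finset.sum_mul]; ring
        _ ≤ _ := by gcongr; linarith
  constructor
  · intro hlow
    rwa [targetRate, if_pos hlow] at main
  · intro hhigh
    rwa [targetRate, if_neg (not_lt.2 hhigh)] at main
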